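/- Notation. For $0<\varepsilon<1$ let $f_\varepsilon:[0,\infty)\to[0,1]$ be $0$ on $[0,\varepsilon/2]$, $1$ on $[\varepsilon,\infty)$ and linear on $[\varepsilon/2,\varepsilon]$. For positive elements $a,b$ of a C*-algebra $A$ write $a\lesssim b$ if $x_n^*bx_n\to a$ in norm for some sequence $(x_n)$ in $A$. Let $\mathrm T(A)$ be the set of tracial states of $A$ and $\overline{\mathrm T(A)}^{\mathrm w}$ its weak* closure in $A^*$. A positive element $a\in A$ is strictly positive if $aAa$ is dense in $A$. A C*-algebra is simple if it has no closed two-sided ideals other than $\{0\}$ and itself. Let $\mathcal C$ be the class of C*-algebras (up to isomorphism) $$A(F_1,F_2,\phi_0,\phi_1)=\{(f,g)\in C([0,1],F_2)\oplus F_1:\ f(0)=\phi_0(g),\ f(1)=\phi_1(g)\},$$ where $F_1,F_2$ are finite-dimensional C*-algebras and $\phi_0,\phi_1:F_1\to F_2$ are (not necessarily unital) *-homomorphisms. Let $\mathcal C_0$ be the class of those $C\in\mathcal C$ with $\mathrm K_1(C)=\{0\}$, $\mathrm K_0(C)_+=\{0\}$ and $0\notin\overline{\mathrm T(C)}^{\mathrm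 w}$, and let $\mathcal C_0^0$ be the class of those $C\in\mathcal C_0$ with $\mathrm K_0(C)=\{0\}$. Let $\mathcal C_0'$ (resp. ${\mathcal C_0^0}'$) be the class of C*-algebras isomorphic to full hereditary sub-C*-algebras of algebras in $\mathcal C_0$ (resp. $\mathcal C_0^0$). A nonzero simple C*-algebra $A$ is in $\mathcal D$ (resp. $\mathcal D_0$) if there are a strictly positive element $a\in A$ with $\|a\|=1$ and a number $0<\mathfrak f_a<1$ such that, for every $\varepsilon>0$, every finite subset $\mathcal F\subset A$ and every nonzero positive $b\in A$, there are a nonzero sub-C*-algebra $D\subset A$ with $D\in\mathcal C_0'$ (resp. $D\in{\mathcal C_0^0}'$) and completely positive contractive maps $\phi:A\to A$ and $\psi:A\to D$ with $\phi(A)D=\{0\}$ such that 1. $\|\phi(xy)-\phi(x)\phi(y)\|<\varepsilon$ and $\|\psi(xy)-\psi(x)\psi(y)\|<\varepsilon$ for all $x,y\in\mathcal F$; 2. $\|x-(\phi(x)+\psi(x))\|<\varepsilon$ for all $x\in\mathcal F\cup\{a\}$; 3. $\phi(a)\lesssim b$; 4. $t(f_{1/4}(\psi(a)))\ge\mathfrak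 f_a$ for all $t\in\mathrm T(D)$. The zero algebra is regarded as belonging to both $\mathcal D$ and $\mathcal D_0$. Proposition. Let $A$ be a separable simple C*-algebra in $\mathcal D$ (resp. in $\mathcal D_0$). Then every hereditary sub-C*-algebra of $A$ is also in $\mathcal D$ (resp. in $\mathcal D_0$). Moreover, if $A\neq\{0\}$, then $\mathrm T(A)\neq\emptyset$. -/

import Mathlib

open scoped Matrix CStarAlgebra

noncomputable section

/-! ### Ideals, hereditary subalgebras, tracial states -/

/-- A C*-algebra is simple if it has no closed two-sided ideals besides `0` and itself
(the zero algebra is allowed). -/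
def IsSimpleCStar (A : Type*) [NonUnitalCStarAlgebra A] : Prop :=
  ∀ I : TwoSidedIdeal A, IsClosed (I : Set A) → I = ⊥ ∨ I = ⊤

/-- A subset is full if it is contained in no proper closed two-sided ideal. -/
def IsFullSubset {A : Type*} [NonUnitalCStarAlgebra A] (S : Set A) : Prop :=
  ∀ I : TwoSidedIdeal A, IsClosed (I : Set A) → S ⊆ (I : Set A) → I = ⊤

section
open scoped ComplexOrder

/-- The set `T(A)` of tracial states, as a subset of the dual with its weak* topology. -/
def tracialStates (A : Type*) [NonUnitalCStarAlgebra A] : Set (WeakDual ℂ A) :=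
  {τ | ‖WeakDual.toStrongDual τ‖ = 1 ∧ (∀ x : A, 0 ≤ τ (star x * x)) ∧
    ∀ x y : A, τ (x * y) = τ (y * x)}

end

section
/- Every C*-algebra carries its canonical order: `a ≤ b` iff `b - a` is self-adjoint with
spectrum in `[0, ∞)`. -/
attribute [local instance] CStarAlgebra.spectralOrder CStarAlgebra.spectralOrderedRing

/-- Hereditary sub-C*-algebras. -/
structure IsHereditary {A : Type*} [NonUnitalCStarAlgebra A]
    (B : NonUnitalStarSubalgebra ℂ A) : Prop where
  isClosed : IsClosed (B : Set A)
  mem_of_le : ∀ a b : A, b ∈ B → 0 ≤ a → a ≤ b → a ∈ B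

end

/-! ### K-theory -/

section KTheory

variable {R S : Type*} [Ring R] [StarRing R] [Ring S] [StarRing S]

/-- The block diagonal matrix `diag(p, q)`. -/
def blockSum {T : Type*} [Zero T] {m n : ℕ} (p : Matrix (Fin m) (Fin m) T)
    (q : Matrix (Fin n) (Fin n) T) : Matrix (Fin (m + n)) (Fin (m + n)) T :=
  (Matrix.fromBlocks p 0 0 q).reindex finSumFinEquiv finSumFinEquiv

theorem blockSum_mul {T : Type*} [NonUnitalRing T] {m n : ℕ} (p p' : Matrix (Fin m) (Fin m) T)
    (q q' : Matrix (Fin n) (Fin n) T) :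
    blockSum p q * blockSum p' q' = blockSum (p * p') (q * q') := by
  simp [blockSum, Matrix.submatrix_mul_equiv, Matrix.fromBlocks_multiply]

theorem star_blockSum {T : Type*} [NonUnitalRing T] [StarRing T] {m n : ℕ}
    (p : Matrix (Fin m) (Fin m) T) (q : Matrix (Fin n) (Fin n) T) :
    star (blockSum p q) = blockSum (star p) (star q) := by
  simp [blockSum, Matrix.star_eq_conjTranspose, Matrix.conjTranspose_submatrix,
    Matrix.fromBlocks_conjTranspose]

theorem blockSum_one {T : Type*} [Ring T] {m n : ℕ} :
    blockSum (1 : Matrix (Fin m) (Fin m) T) (1 : Matrix (Fin n) (Fin n) T) = 1 := by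
  simp [blockSum, Matrix.fromBlocks_one]

theorem map_blockSum {T T' : Type*} [Zero T] [Zero T'] (f : T → T') (hf : f 0 = 0) {m n : ℕ}
    (p : Matrix (Fin m) (Fin m) T) (q : Matrix (Fin n) (Fin n) T) :
    (blockSum p q).map f = blockSum (p.map f) (q.map f) := by
  have h0 : ∀ k l : ℕ, (0 : Matrix (Fin k) (Fin l) T).map f = 0 := fun k l => by
    ext; simp [hf]
  simp [blockSum, ← Matrix.submatrix_map, Matrix.fromBlocks_map, h0]

/-- Projections in matrix algebras over `R`. -/
structure MatProj (R : Type*) [NonUnitalRing R] [StarRing R] where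
  size : ℕ
  mat : Matrix (Fin size) (Fin size) R
  isStarProjection : IsStarProjection mat

/-- The direct sum of two projections. -/
def MatProj.sum (p q : MatProj R) : MatProj R where
  size := p.size + q.size
  mat := blockSum p.mat q.mat
  isStarProjection :=
    ⟨by rw [IsIdempotentElem, blockSum_mul, p.isStarProjection.isIdempotentElem.eq,
          q.isStarProjection.isIdempotentElem.eq],
      by rw [IsSelfAdjoint, star_blockSum, p.isStarProjection.isSelfAdjoint.star_eq,
          q.isStarProjection.isSelfAdjoint.star_eq]⟩

/-- Murray-von Neumann equivalence, through a possibly rectangular matrix. -/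
def MatProj.Equiv (p q : MatProj R) : Prop :=
  ∃ v : Matrix (Fin q.size) (Fin p.size) R, vᴴ * v = p.mat ∧ v * vᴴ = q.mat

/-- The image of a projection under a *-homomorphism applied entrywise. -/
def MatProj.map {T T' : Type*} [NonUnitalRing T] [StarRing T] [NonUnitalRing T'] [StarRing T']
    (f : T →⋆ₙ+* T') (p : MatProj T) : MatProj T' where
  size := p.size
  mat := p.mat.map f
  isStarProjection :=
    ⟨by rw [IsIdempotentElem, ← Matrix.map_mul, p.isStarProjection.isIdempotentElem.eq],
      by
        have h := p.isStarProjection.isSelfAdjoint.star_eq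
        ext i j
        have hij := congrArg f (congrFun (congrFun h i) j)
        simpa [Matrix.star_apply, map_star] using hij⟩

/-- The relations `[p ⊕ q] = [p] + [q]`, and `[p] = [q]` for equivalent `p`, `q`. -/
def K0Rel (R : Type*) [Ring R] [StarRing R] : Set (FreeAbelianGroup (MatProj R)) :=
  {x | ∃ p q : MatProj R, x = .of (p.sum q) - .of p - .of q} ∪
    {x | ∃ p q : MatProj R, p.Equiv q ∧ x = .of p - .of q}

/-- `K₀` of a unital C*-algebra: the Grothendieck group of the semigroup of Murray-von Neumann
classes of projections in matrix algebras, given by generators and relations. -/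
abbrev K0Unital (R : Type*) [Ring R] [StarRing R] : Type _ :=
  FreeAbelianGroup (MatProj R) ⧸ AddSubgroup.closure (K0Rel R)

/-- The map induced on `K₀`. -/
def K0Unital.map (f : R →⋆ₙ+* S) : K0Unital R →+ K0Unital S :=
  QuotientAddGroup.map _ _ (FreeAbelianGroup.map (MatProj.map f)) (by
    rw [AddSubgroup.closure_le]
    rintro x (⟨p, q, rfl⟩ | ⟨p, q, ⟨v, hv₁, hv₂⟩, rfl⟩)
    · refine AddSubgroup.subset_closure (Or.inl ⟨p.map f, q.map f, ?_⟩)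
      have h : (p.sum q).map f = (p.map f).sum (q.map f) := by
        simp only [MatProj.sum, MatProj.map, map_blockSum f (map_zero f)]
      simp [h]
    · have h := Matrix.conjTranspose_map (A := v) f (fun a => map_star f a)
      refine AddSubgroup.subset_closure (Or.inr ⟨p.map f, q.map f, ⟨v.map f, ?_, ?_⟩, ?_⟩)
      · change (v.map f)ᴴ * v.map f = p.mat.map f
        rw [← h, ← hv₁, Matrix.map_mul]
      · change v.map f * (v.map f)ᴴ = q.mat.map f
        rw [← h, ← hv₂, Matrix.map_mul]
      · simp)

variable (A : Type*) [NonUnitalCStarAlgebra A]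

/-- The quotient map from the unitization to the scalars. -/
def unitizationToScalars : Unitization ℂ A →⋆ₙ+* ℂ :=
  { (Unitization.fstHom ℂ A : Unitization ℂ A →+* ℂ) with
    map_star' := fun _ => rfl }

/-- The inclusion into the unitization. -/
def toUnitization : A →⋆ₙ+* Unitization ℂ A where
  toFun a := (a : Unitization ℂ A)
  map_mul' := Unitization.inr_mul ℂ
  map_zero' := Unitization.inr_zero ℂ
  map_add' := Unitization.inr_add ℂ
  map_star' := fun a => Unitization.inr_star a

/-- `K₀(A)`: the kernel of the map `K₀(Ã) → K₀(ℂ)`. -/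
def K0 : AddSubgroup (K0Unital (Unitization ℂ A)) :=
  (K0Unital.map (unitizationToScalars A)).ker

/-- `K₀(A)₊`: the classes of projections in matrix algebras over `A` itself. -/
def K0Pos : Set (K0 A) :=
  {x | ∃ p : MatProj A, (x : K0Unital (Unitization ℂ A)) =
    QuotientAddGroup.mk (FreeAbelianGroup.of (p.map (toUnitization A)))}

/-- Unitaries in matrix algebras over `R`. -/
structure MatUnitary (R : Type*) [Ring R] [StarRing R] where
  size : ℕ
  mat : unitary (Matrix (Fin size) (Fin size) R)

/-- The direct sum of two unitaries. -/
def MatUnitary.sum (u v : MatUnitary R) : MatUnitary R where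
  size := u.size + v.size
  mat := ⟨blockSum u.mat.1 v.mat.1, by
    rw [Unitary.mem_iff, star_blockSum, blockSum_mul, blockSum_mul,
      Unitary.star_mul_self_of_mem u.mat.2, Unitary.star_mul_self_of_mem v.mat.2,
      Unitary.mul_star_self_of_mem u.mat.2, Unitary.mul_star_self_of_mem v.mat.2]
    exact ⟨blockSum_one, blockSum_one⟩⟩

/-- The relations `[u ⊕ v] = [u] + [v]`, `[1] = 0`, and `[u] = [v]` whenever `u`, `v` of the same
size are joined by a continuous path of unitaries. -/
def K1Rel (R : Type*) [Ring R] [StarRing R] [TopologicalSpace R] :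
    Set (FreeAbelianGroup (MatUnitary R)) :=
  {x | ∃ u v : MatUnitary R, x = .of (u.sum v) - .of u - .of v} ∪
    {x | ∃ n : ℕ, x = .of ⟨n, 1⟩} ∪
    {x | ∃ (n : ℕ) (u v : unitary (Matrix (Fin n) (Fin n) R)), Joined u v ∧
      x = .of ⟨n, u⟩ - .of ⟨n, v⟩}

/-- `K₁(A)`: stable homotopy classes of unitaries in matrix algebras over the unitization. -/
abbrev K1 : Type _ :=
  FreeAbelianGroup (MatUnitary (Unitization ℂ A)) ⧸
    AddSubgroup.closure (K1Rel (Unitization ℂ A))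

end KTheory

/-! ### One-dimensional noncommutative complexes -/

section Complexes

variable {F₁ F₂ : Type*} [NonUnitalCStarAlgebra F₁] [NonUnitalCStarAlgebra F₂]

/-- `A(F₁, F₂, φ₀, φ₁) = {(f, g) ∈ C([0,1], F₂) ⊕ F₁ : f(0) = φ₀(g), f(1) = φ₁(g)}`. -/
def mappingTorus (φ₀ φ₁ : F₁ →⋆ₙₐ[ℂ] F₂) :
    NonUnitalStarSubalgebra ℂ (C(unitInterval, F₂) × F₁) where
  carrier := {x | x.1 0 = φ₀ x.2 ∧ x.1 1 = φ₁ x.2}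
  add_mem' := by rintro x y ⟨h₀, h₁⟩ ⟨k₀, k₁⟩; simp [h₀, h₁, k₀, k₁]
  zero_mem' := by simp
  mul_mem' := by rintro x y ⟨h₀, h₁⟩ ⟨k₀, k₁⟩; simp [h₀, h₁, k₀, k₁]
  smul_mem' := by rintro c x ⟨h₀, h₁⟩; simp [h₀, h₁]
  star_mem' := by rintro x ⟨h₀, h₁⟩; simp [h₀, h₁, map_star]

instance mappingTorus_isClosed (φ₀ φ₁ : F₁ →⋆ₙₐ[ℂ] F₂) :
    IsClosed (mappingTorus φ₀ φ₁ : Set (C(unitInterval, F₂) × F₁)) := by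
  have h₀ : Continuous φ₀ := map_continuous φ₀
  have h₁ : Continuous φ₁ := map_continuous φ₁
  have e (t : unitInterval) : Continuous fun x : C(unitInterval, F₂) × F₁ => x.1 t :=
    (continuous_eval_const t).comp continuous_fst
  exact (isClosed_eq (e 0) (h₀.comp continuous_snd)).inter
    (isClosed_eq (e 1) (h₁.comp continuous_snd))

end Complexes

/-- The class `𝒞`, up to isomorphism. -/
def InC (C : Type*) [NonUnitalCStarAlgebra C] : Prop :=
  ∃ (F₁ F₂ : Type) (_ : NonUnitalCStarAlgebra F₁) (_ : NonUnitalCStarAlgebra F₂)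
    (_ : FiniteDimensional ℂ F₁) (_ : FiniteDimensional ℂ F₂) (φ₀ φ₁ : F₁ →⋆ₙₐ[ℂ] F₂),
    Nonempty (C ≃⋆ₐ[ℂ] mappingTorus φ₀ φ₁)

/-- The class `𝒞₀`: members of `𝒞` with `K₁ = 0`, `(K₀)₊ = 0`, and such that `0` is not a weak*
limit of tracial states. -/
structure InC0 (C : Type*) [NonUnitalCStarAlgebra C] : Prop where
  inC : InC C
  K1_eq_zero : Subsingleton (K1 C)
  K0Pos_eq_zero : K0Pos C = {0}
  zero_notMem : (0 : WeakDual ℂ C) ∉ closure (tracialStates C)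

/-- The class `𝒞₀⁰`: members of `𝒞₀` with `K₀ = 0`. -/
structure InC00 (C : Type*) [NonUnitalCStarAlgebra C] : Prop extends InC0 C where
  K0_eq_zero : Subsingleton (K0 C)

/-- `D` is isomorphic to a full hereditary sub-C*-algebra of an algebra in the class `𝒮`. -/
def IsFullHereditaryIn (𝒮 : (C : Type) → [NonUnitalCStarAlgebra C] → Prop)
    (D : Type*) [NonUnitalCStarAlgebra D] : Prop :=
  ∃ (C : Type) (_ : NonUnitalCStarAlgebra C) (H : NonUnitalStarSubalgebra ℂ C),
    𝒮 C ∧ IsHereditary H ∧ IsFullSubset (H : Set C) ∧ Nonempty (D ≃⋆ₐ[ℂ] H)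

/-- The class `𝒞₀'`. -/
def InC0' (D : Type*) [NonUnitalCStarAlgebra D] : Prop :=
  IsFullHereditaryIn (fun C _ => InC0 C) D

/-- The class `(𝒞₀⁰)'`. -/
def InC00' (D : Type*) [NonUnitalCStarAlgebra D] : Prop :=
  IsFullHereditaryIn (fun C _ => InC00 C) D

/-! ### The classes `𝒟` and `𝒟₀` -/

section
attribute [local instance] CStarAlgebra.spectralOrder CStarAlgebra.spectralOrderedRing

/-- The function `f_ε`: `0` on `[0, ε/2]`, linear on `[ε/2, ε]`, and `1` on `[ε, ∞)`. -/
def fCut (ε t : ℝ) : ℝ := max 0 (min 1 ((t - ε / 2) / (ε / 2)))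

/-- Cuntz subequivalence. -/
def CuntzLE {A : Type*} [NonUnitalCStarAlgebra A] (a b : A) : Prop :=
  ∃ x : ℕ → A, Filter.Tendsto (fun n => star (x n) * b * x n) Filter.atTop (nhds a)

/-- A positive element `a` is strictly positive if `aAa` is dense in `A`. -/
def IsStrictlyPositiveElem {A : Type*} [NonUnitalCStarAlgebra A] (a : A) : Prop :=
  0 ≤ a ∧ Dense (Set.range fun x : A => a * x * a)

/-- Completely positive maps, with respect to the canonical orders. -/
abbrev CPMap (A B : Type*) [NonUnitalCStarAlgebra A] [NonUnitalCStarAlgebra B] : Type _ :=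
  A →CP B

/-- `φ` is an `F`-`ε`-multiplicative contractive map. -/
def IsApproxMultContractive {A B : Type*} [NonUnitalCStarAlgebra A] [NonUnitalCStarAlgebra B]
    (F : Finset A) (ε : ℝ) (φ : CPMap A B) : Prop :=
  (∀ x, ‖φ x‖ ≤ ‖x‖) ∧ ∀ x ∈ F, ∀ y ∈ F, ‖φ (x * y) - φ x * φ y‖ < ε

/-- Simple C*-algebras `A` that are tracially approximated by nonzero subalgebras in the class `𝒮`;
the zero algebra is included by convention. -/
def IsTraciallyIn.{u} (𝒮 : (D : Type u) → [NonUnitalCStarAlgebra D] → Prop)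
    (A : Type u) [NonUnitalCStarAlgebra A] : Prop :=
  IsSimpleCStar A ∧ (Subsingleton A ∨
    ∃ a : A, IsStrictlyPositiveElem a ∧ ‖a‖ = 1 ∧ ∃ 𝔣 : ℝ, 0 < 𝔣 ∧ 𝔣 < 1 ∧
      ∀ ε : ℝ, 0 < ε → ∀ (F : Finset A) (b : A), 0 ≤ b → b ≠ 0 →
        ∃ (D : NonUnitalStarSubalgebra ℂ A) (_ : IsClosed (D : Set A))
          (φ : CPMap A A) (ψ : CPMap A D),
          IsApproxMultContractive F ε φ ∧ IsApproxMultContractive F ε ψ ∧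
          (∀ x : A, ∀ d ∈ D, φ x * d = 0) ∧
          (∀ x : A, x ∈ F ∨ x = a → ‖x - (φ x + ψ x)‖ < ε) ∧
          Nontrivial D ∧ 𝒮 D ∧
          CuntzLE (φ a) b ∧
          ∀ t ∈ tracialStates D, 𝔣 ≤ (t (cfcₙ (fCut (1 / 4)) (ψ a))).re)

/-- The class `𝒟`. -/
def InD (A : Type*) [NonUnitalCStarAlgebra A] : Prop :=
  IsTraciallyIn (fun D _ => InC0' D) A

/-- The class `𝒟₀`. -/
def InD0 (A : Type*) [NonUnitalCStarAlgebra A] : Prop :=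
  IsTraciallyIn (fun D _ => InC00' D) A

end

end

set_option linter.unusedSectionVars false

noncomputable section

/-! ### Cut-off functions and approximate factorization -/

/-! An approximate decomposition of `A` is compressed to the hereditary subalgebra `B`. Take a
positive contraction `e` in `B` that is almost a unit for the given finite set, and decompose `A` so
finely that s = φ(e) + ψ(e) is very close to e. A polar decomposition (`exists_polar`,
`exists_conjugator`) gives w in the closure of eA with w*w = f² for f = f_r(s), such that V = wg,
with g = f_{2r}(s), satisfies Vs ≈ s. Conjugation by V maps all of A into B and barely moves what e
almost fixes.

Since φ(A)D = 0, a function of s acts on D as a function of ψ(e), and on φ(A) as a function of φ(e).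
So the corner D₁ = {z ∈ D : fz = z = zf} is hereditary in D, z ↦ wzw* embeds it in B, and x ↦
Vφ(x)V*, x ↦ gψ(x)g are the new maps (`exists_corner_maps`, `exists_corner_approx`). The new φ stays
small: e is close to some q*aq, so φ(e) is close to φ(q)*φ(a)φ(q), and cutting down by f_{2r}(φ(e))
gives something Cuntz below φ(a), hence below b.

It remains to see that D₁ is full in D and that its traces are large on f_{1/4}(ψ'(a')), where a' is
strictly positive in B. Fix a nonzero h' with a'h' = h'. By simplicity a is close to a finite sum ∑
xh'y, so every positive trace τ on D satisfies τ(ψ(h')) ≥ κ‖τ‖, with κ fixed before the tolerance,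
the finite set and b are given. Two facts about subalgebras of C([0,1], F), F finite-dimensional,
finish the argument. A proper closed ideal is annihilated by a nonzero trace
(`exists_trace_of_ideal`), which forces fullness. Traces extend from full hereditary subalgebras
(`IsPosTrace.exists_extension`), by means of a bound ‖∑ zz*‖ ≤ N‖∑ z*z‖; this carries the lower
bound from D to D₁.

Only two properties of the building blocks enter: they embed in some C([0,1], F), and full
hereditary subalgebras of full hereditary subalgebras are again such. K-theory is merely carried
along with the ambient algebra, so 𝒟 and 𝒟₀ are treated together. A tracial state on `A` is obtained
by normalizing a weak* limit of the functionals t ∘ ψ, with t a tracial state of D. -/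

/-- A continuous approximation to `t ↦ t ^ (-1/2)` that vanishes at `0`. -/
def rootCut (ε t : ℝ) : ℝ := min 1 (t / ε) / √(max t ε)

/-- The function `t ↦ t * rootCut ε t ^ 2`, which is `1` on `[ε, ∞)`. -/
def cubeCut (ε t : ℝ) : ℝ := t * rootCut ε t ^ 2

section Cut

variable {ε t : ℝ}

theorem continuous_rootCut (hε : 0 < ε) : Continuous (rootCut ε) := by
  unfold rootCut
  refine Continuous.div (by fun_prop) (by fun_prop) fun t => ?_
  have : 0 < max t ε := lt_max_of_lt_right hε
  positivity

theorem continuous_cubeCut (hε : 0 < ε) : Continuous (cubeCut ε) :=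
  continuous_id.mul ((continuous_rootCut hε).pow 2)

@[simp] theorem rootCut_zero (ε : ℝ) : rootCut ε 0 = 0 := by simp [rootCut]

@[simp] theorem cubeCut_zero (ε : ℝ) : cubeCut ε 0 = 0 := by simp [cubeCut]

theorem rootCut_sq (hε : 0 < ε) (t : ℝ) : rootCut ε t ^ 2 = min 1 (t / ε) ^ 2 / max t ε := by
  have : 0 < max t ε := lt_max_of_lt_right hε
  rw [rootCut, div_pow, Real.sq_sqrt this.le]

theorem cubeCut_of_le (hε : 0 < ε) (h : ε ≤ t) : cubeCut ε t = 1 := by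
  have ht : 0 < t := hε.trans_le h
  rw [cubeCut, rootCut_sq hε, max_eq_left h, min_eq_left ((one_le_div hε).2 h)]
  field_simp

theorem cubeCut_nonneg (ht : 0 ≤ t) : 0 ≤ cubeCut ε t := by
  unfold cubeCut; positivity

theorem cubeCut_le_one (hε : 0 < ε) (ht : 0 ≤ t) : cubeCut ε t ≤ 1 := by
  rcases le_total ε t with h | h
  · exact (cubeCut_of_le hε h).le
  · have h1 : t / ε ≤ 1 := (div_le_one hε).2 h
    have h0 : 0 ≤ t / ε := by positivity
    rw [cubeCut, rootCut_sq hε, max_eq_right h, min_eq_right h1]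
    calc t * ((t / ε) ^ 2 / ε) = (t / ε) ^ 3 := by field_simp
      _ ≤ 1 := pow_le_one₀ h0 h1

/-- The function is zero from ε on, and below ε the outer factors are at most 1. It controls ‖x - x
· `cubeCut`(m)‖² whenever x*x ≤ m. -/
theorem cubeCut_defect (hε : 0 < ε) (ht : 0 ≤ t) : (1 - cubeCut ε t) * t * (1 - cubeCut ε t) ≤ ε := by
  rcases le_total ε t with h | h
  · simp [cubeCut_of_le hε h, hε.le]
  · have h0 := cubeCut_nonneg (ε := ε) ht
    have h1 := cubeCut_le_one hε ht
    have h2 : (1 - cubeCut ε t) * (1 - cubeCut ε t) ≤ 1 := by nlinarith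
    nlinarith

theorem rootCut_nonneg (hε : 0 < ε) (ht : 0 ≤ t) : 0 ≤ rootCut ε t := by
  unfold rootCut; positivity

theorem continuous_fCut (ε : ℝ) : Continuous (fCut ε) := by
  unfold fCut; fun_prop

theorem fCut_nonneg (ε t : ℝ) : 0 ≤ fCut ε t := le_max_left _ _

theorem fCut_le_one (ε t : ℝ) : fCut ε t ≤ 1 := max_le zero_le_one (min_le_left _ _)

theorem fCut_of_le_half (hε : 0 < ε) (h : t ≤ ε / 2) : fCut ε t = 0 := by
  have : (t - ε / 2) / (ε / 2) ≤ 0 := div_nonpos_of_nonpos_of_nonneg (by linarith) (by linarith)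
  exact max_eq_left ((min_le_right _ _).trans this)

theorem fCut_of_le (hε : 0 < ε) (h : ε ≤ t) : fCut ε t = 1 := by
  have : 1 ≤ (t - ε / 2) / (ε / 2) := by rw [one_le_div (by linarith)]; linarith
  simp [fCut, min_eq_left this]

theorem fCut_zero (hε : 0 < ε) : fCut ε 0 = 0 := fCut_of_le_half hε (by linarith)

theorem fCut_le_mul (hε : 0 < ε) (ht : 0 ≤ t) : fCut ε t ≤ 2 / ε * t := by
  rcases le_total t (ε / 2) with h | h
  · rw [fCut_of_le_half hε h]; positivity
  · have : 1 ≤ 2 / ε * t := by rw [div_mul_eq_mul_div, one_le_div hε]; linarith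
    exact (fCut_le_one _ _).trans this

/-- The support of f_{2ε} starts at ε, where f_ε has already reached 1. This is why cut-offs are
always used in pairs ε, 2ε: one is a unit for the other. -/
theorem fCut_mul_fCut (hε : 0 < ε) (t : ℝ) : fCut ε t * fCut (2 * ε) t = fCut (2 * ε) t := by
  rcases le_total t ε with h | h
  · rw [fCut_of_le_half (ε := 2 * ε) (by linarith) (by linarith), mul_zero]
  · rw [fCut_of_le hε h, one_mul]

end Cut

section CStar

variable {A : Type*} [NonUnitalCStarAlgebra A] [PartialOrder A] [StarOrderedRing A]

theorem real_quasispectrum_nonneg {m : A} (hm : 0 ≤ m) {t : ℝ} (ht : t ∈ quasispectrum ℝ m) :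
    0 ≤ t := quasispectrum_nonneg_of_nonneg m hm t ht

theorem quasispectrum_le_norm {m : A} (hm : IsSelfAdjoint m) {t : ℝ} (ht : t ∈ quasispectrum ℝ m) :
    |t| ≤ ‖m‖ :=
  NonUnitalIsometricContinuousFunctionalCalculus.norm_quasispectrum_le (𝕜 := ℝ) m ht hm

theorem cubeCut_nonneg_cfc {m : A} (hm : 0 ≤ m) (ε : ℝ) : 0 ≤ cfcₙ (cubeCut ε) m :=
  cfcₙ_nonneg fun _ ht => cubeCut_nonneg (real_quasispectrum_nonneg hm ht)

theorem norm_cubeCut_le {m : A} (hm : 0 ≤ m) {ε : ℝ} (hε : 0 < ε) :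
    ‖cfcₙ (cubeCut ε) m‖ ≤ 1 := by
  refine norm_cfcₙ_le fun t ht => ?_
  have h := real_quasispectrum_nonneg hm ht
  rw [Real.norm_of_nonneg (cubeCut_nonneg h)]
  exact cubeCut_le_one hε h

/-- This form shows the cut-off as a conjugate of m: if m is a sum of elements z*z, so is the
cut-off, with zR in place of z. The one-sided form after it places the cut-off in every ideal
containing m. -/
theorem cfcₙ_cubeCut {m : A} (hm : IsSelfAdjoint m) {ε : ℝ} (hε : 0 < ε) :
    cfcₙ (cubeCut ε) m = cfcₙ (rootCut ε) m * m * cfcₙ (rootCut ε) m := by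
  have hc := continuous_rootCut hε
  have h : cubeCut ε = fun t => rootCut ε t * t * rootCut ε t := by
    ext t; simp only [cubeCut]; ring
  rw [h, cfcₙ_mul (fun t => rootCut ε t * t) (rootCut ε) m (by fun_prop) (by simp)
    (by fun_prop) (by simp), cfcₙ_mul (rootCut ε) (fun t => t) m (by fun_prop) (by simp)
    (by fun_prop) (by simp), cfcₙ_id' ℝ m]

theorem cfcₙ_cubeCut_left {m : A} (hm : IsSelfAdjoint m) {ε : ℝ} (hε : 0 < ε) :
    cfcₙ (cubeCut ε) m = m * cfcₙ (fun t => rootCut ε t ^ 2) m := by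
  have hc := continuous_rootCut hε
  have h : cubeCut ε = fun t => t * (rootCut ε t ^ 2) := rfl
  rw [h, cfcₙ_mul (fun t => t) (fun t => rootCut ε t ^ 2) m (by fun_prop) (by simp)
    (by fun_prop) (by simp), cfcₙ_id' ℝ m]

/-- With Q = 1 - p(m), the C*-identity gives ‖xQ‖² = ‖Qx*xQ‖ ≤ ‖QmQ‖ + ‖QrQ‖, and QmQ is a function
of m. -/
theorem norm_sub_mul_cutoff_sq {x m r : A} (hm : 0 ≤ m) (hx : star x * x ≤ m + r) {p : ℝ → ℝ}
    (hp : Continuous p) (hp0 : p 0 = 0) {ε : ℝ}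
    (h1 : ∀ t, 0 ≤ t → |1 - p t| ≤ 1) (h2 : ∀ t, 0 ≤ t → |(1 - p t) * t * (1 - p t)| ≤ ε) :
    ‖x - x * cfcₙ p m‖ ^ 2 ≤ ε + ‖r‖ := by
  have hε : 0 ≤ ε := (abs_nonneg _).trans (h2 0 le_rfl)
  have hr : IsSelfAdjoint r := by
    have : IsSelfAdjoint (m + r) := by
      have h := (IsSelfAdjoint.of_nonneg (sub_nonneg.2 hx)).add (IsSelfAdjoint.star_mul_self x)
      simpa using h
    simpa using this.sub (IsSelfAdjoint.of_nonneg hm)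
  have hm' : (0 : Unitization ℂ A) ≤ m := Unitization.inr_nonneg_iff.2 hm
  have hsa : IsSelfAdjoint (m : Unitization ℂ A) := .of_nonneg hm'
  -- The function 1 - p does not vanish at 0, so this calculus has to take place in the unitization.
  set Q : Unitization ℂ A := cfc (fun t => 1 - p t) (m : Unitization ℂ A) with hQ
  have hQ1 : Q = 1 - (cfcₙ p m : A) := by
    rw [hQ, cfc_sub (fun _ => 1) p _ (by fun_prop) (by fun_prop), cfc_const_one ℝ _,
      Unitization.real_cfcₙ_eq_cfc_inr m p hp0]
  have hQsa : star Q = Q := (IsSelfAdjoint.cfc (f := fun t => 1 - p t)).star_eq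
  have hspec : ∀ t ∈ spectrum ℝ (m : Unitization ℂ A), 0 ≤ t := fun t ht =>
    spectrum_nonneg_of_nonneg hm' ht
  have e1 : ((x - x * cfcₙ p m : A) : Unitization ℂ A) = x * Q := by
    rw [hQ1]; simp [mul_sub]
  have e2 : Q * m * Q = cfc (fun t => (1 - p t) * t * (1 - p t)) (m : Unitization ℂ A) := by
    rw [cfc_mul (fun t => (1 - p t) * t) (fun t => 1 - p t) _ (by fun_prop) (by fun_prop),
      cfc_mul (fun t => 1 - p t) (fun t => t) _ (by fun_prop) (by fun_prop), cfc_id' ℝ _]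
  have hle : star (x : Unitization ℂ A) * x ≤ m + r := by
    have := (Unitization.inr_le_iff (star x * x) (m + r) (.star_mul_self x)
      ((IsSelfAdjoint.of_nonneg hm).add hr)).2 hx
    simpa using this
  have hQn : ‖Q‖ ≤ 1 := norm_cfc_le zero_le_one fun t ht => h1 t (hspec t ht)
  rw [← Unitization.norm_inr (𝕜 := ℂ), e1, sq, ← CStarRing.norm_star_mul_self]
  calc ‖star (x * Q) * (x * Q)‖ = ‖star Q * (star (x : Unitization ℂ A) * x) * Q‖ := by
        simp [mul_assoc]
    _ ≤ ‖star Q * ((m : Unitization ℂ A) + r) * Q‖ := by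
        refine CStarAlgebra.norm_le_norm_of_nonneg_of_le
          (star_left_conjugate_nonneg (star_mul_self_nonneg _) _)
          (star_left_conjugate_le_conjugate hle _)
    _ = ‖Q * m * Q + Q * r * Q‖ := by rw [hQsa, mul_add, add_mul]
    _ ≤ ‖Q * m * Q‖ + ‖Q * r * Q‖ := norm_add_le _ _
    _ ≤ ε + ‖r‖ := by
        gcongr
        · rw [e2]; exact norm_cfc_le hε fun t ht => h2 t (hspec t ht)
        · calc ‖Q * r * Q‖ ≤ ‖Q‖ * ‖(r : Unitization ℂ A)‖ * ‖Q‖ :=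
                (norm_mul_le _ _).trans (by gcongr; exact norm_mul_le _ _)
            _ ≤ 1 * ‖(r : Unitization ℂ A)‖ * 1 := by gcongr
            _ = ‖r‖ := by simp [Unitization.norm_inr]

theorem norm_sub_mul_cubeCut_sq {x m r : A} (hm : 0 ≤ m) (hx : star x * x ≤ m + r) {ε : ℝ}
    (hε : 0 < ε) : ‖x - x * cfcₙ (cubeCut ε) m‖ ^ 2 ≤ ε + ‖r‖ := by
  refine norm_sub_mul_cutoff_sq hm hx (continuous_cubeCut hε) (cubeCut_zero ε)
    (fun t ht => ?_) fun t ht => ?_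
  · have h0 := cubeCut_nonneg (ε := ε) ht
    have h1 := cubeCut_le_one hε ht
    rw [abs_le]; constructor <;> linarith
  · have h1 := cubeCut_le_one hε ht
    rw [abs_of_nonneg (by have := sub_nonneg.2 h1; positivity)]
    exact cubeCut_defect hε ht

/-- After rescaling x the previous estimate applies with r = 0. Thus the cut-offs of m form a right
approximate unit for everything dominated by a multiple of m. -/
theorem tendsto_mul_cubeCut {x m : A} (hm : 0 ≤ m) {K : ℝ} (hx : star x * x ≤ K • m) :
    Filter.Tendsto (fun n : ℕ => x * cfcₙ (cubeCut (1 / (n + 1))) m) Filter.atTop (nhds x) := by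
  have hK : (0 : ℝ) < |K| + 1 := by positivity
  -- `K` may be zero or negative; the added 1 makes the scaling factor invertible.
  set k : ℝ := √(|K| + 1) with hk
  have hk0 : 0 < k := Real.sqrt_pos.2 hK
  have hy : star (k⁻¹ • x) * (k⁻¹ • x) ≤ m + 0 := by
    have h2 : k⁻¹ * k⁻¹ * (|K| + 1) = 1 := by
      have : k * k = |K| + 1 := Real.mul_self_sqrt hK.le
      rw [← this]; field_simp
    have h1 : star x * x ≤ (|K| + 1) • m :=
      hx.trans (smul_le_smul_of_nonneg_right ((le_abs_self K).trans (by linarith)) hm)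
    calc star (k⁻¹ • x) * (k⁻¹ • x) = (k⁻¹ * k⁻¹) • (star x * x) := by
          simp [smul_mul_smul_comm]
      _ ≤ (k⁻¹ * k⁻¹) • ((|K| + 1) • m) := smul_le_smul_of_nonneg_left h1 (by positivity)
      _ = m + 0 := by rw [smul_smul, h2, one_smul, add_zero]
  have hlim : Filter.Tendsto (fun n : ℕ => k⁻¹ • x * cfcₙ (cubeCut (1 / (n + 1))) m)
      Filter.atTop (nhds (k⁻¹ • x)) := by
    rw [tendsto_iff_norm_sub_tendsto_zero]
    have hs : Filter.Tendsto (fun n : ℕ => √(1 / ((n : ℝ) + 1))) Filter.atTop (nhds 0) := by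
      simpa using! (tendsto_one_div_add_atTop_nhds_zero_nat (𝕜 := ℝ)).sqrt
    refine squeeze_zero (fun _ => norm_nonneg _) (fun n => ?_) hs
    rw [norm_sub_rev]
    refine Real.le_sqrt_of_sq_le ?_
    have := norm_sub_mul_cubeCut_sq hm hy (ε := 1 / ((n : ℝ) + 1)) (by positivity)
    simpa using this
  have := hlim.const_smul k
  simpa [smul_smul, hk0.ne', smul_mul_assoc] using this

end CStar

/-! ### Polar decomposition, and functional calculus of elements agreeing on a subalgebra -/

section CStar

variable {A : Type*} [NonUnitalCStarAlgebra A] [PartialOrder A] [StarOrderedRing A]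

/-- The difference of the two sides is (a - b)*(a - b). -/
theorem star_mul_self_add_le (a b : A) :
    star (a + b) * (a + b) ≤ (2 : ℝ) • (star a * a) + (2 : ℝ) • (star b * b) := by
  have h := star_mul_self_nonneg (a - b)
  rw [← sub_nonneg]
  convert h using 1
  simp only [star_add, star_sub, mul_add, add_mul, mul_sub, sub_mul, two_smul]
  abel

/-- The square root is uniformly continuous on positive elements. -/
theorem norm_sub_sq_le_of_nonneg {a b : A} (ha : 0 ≤ a) (hb : 0 ≤ b) :
    ‖a - b‖ ^ 2 ≤ ‖a * a - b * b‖ := by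
  -- One-sided estimate: a² ≤ b² + r² ≤ (b + r)², and the square root is operator monotone. The
  -- unitization supplies the scalar r.
  have key : ∀ a b : Unitization ℂ A, 0 ≤ a → 0 ≤ b → ∀ r : ℝ, 0 ≤ r → ‖a * a - b * b‖ ≤ r ^ 2 →
      a - b ≤ algebraMap ℝ _ r := by
    intro a b ha hb r hr h
    have hsa : IsSelfAdjoint (a * a - b * b) :=
      (IsSelfAdjoint.of_nonneg ha).commute_iff (.of_nonneg ha) |>.1 (Commute.refl a) |>.sub
        ((IsSelfAdjoint.of_nonneg hb).commute_iff (.of_nonneg hb) |>.1 (Commute.refl b))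
    have hr' : (0 : Unitization ℂ A) ≤ algebraMap ℝ _ r := algebraMap_nonneg _ hr
    have h1 : a * a - b * b ≤ algebraMap ℝ (Unitization ℂ A) (r ^ 2) :=
      hsa.le_algebraMap_norm_self.trans (algebraMap_mono _ h)
    have hc : algebraMap ℝ (Unitization ℂ A) r * b = b * algebraMap ℝ _ r := Algebra.commutes r b
    have hrb : (0 : Unitization ℂ A) ≤ algebraMap ℝ _ r * b := by
      rw [← Algebra.smul_def]; exact smul_nonneg hr hb
    have h2 : a * a ≤ (b + algebraMap ℝ _ r) * (b + algebraMap ℝ _ r) := by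
      calc a * a = (a * a - b * b) + b * b := by abel
        _ ≤ algebraMap ℝ (Unitization ℂ A) (r ^ 2) + b * b := by gcongr
        _ ≤ algebraMap ℝ (Unitization ℂ A) (r ^ 2) + b * b
            + (algebraMap ℝ _ r * b + algebraMap ℝ _ r * b) :=
          le_add_of_nonneg_right (add_nonneg hrb hrb)
        _ = _ := by rw [map_pow, mul_add, add_mul, add_mul, ← hc, sq]; abel
    have h3 := CFC.sqrt_le_sqrt _ _ h2
    rw [CFC.sqrt_mul_self a ha, CFC.sqrt_mul_self _ (add_nonneg hb hr')] at h3
    exact sub_le_iff_le_add'.2 h3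
  set r := √‖a * a - b * b‖ with hr
  have hr2 : ‖a * a - b * b‖ = r ^ 2 := (Real.sq_sqrt (norm_nonneg _)).symm
  have ha' : (0 : Unitization ℂ A) ≤ a := Unitization.inr_nonneg_iff.2 ha
  have hb' : (0 : Unitization ℂ A) ≤ b := Unitization.inr_nonneg_iff.2 hb
  have e : ‖(a : Unitization ℂ A) * a - b * b‖ = ‖a * a - b * b‖ := by
    rw [← Unitization.norm_inr (𝕜 := ℂ) (a * a - b * b)]; simp
  have h1 := key a b ha' hb' r (Real.sqrt_nonneg _) (e.trans hr2).le
  have h2 := key b a hb' ha' r (Real.sqrt_nonneg _) (by rw [norm_sub_rev, e, hr2])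
  have hsa : IsSelfAdjoint ((a : Unitization ℂ A) - b) :=
    (IsSelfAdjoint.of_nonneg ha').sub (.of_nonneg hb')
  have hn : ‖(a : Unitization ℂ A) - b‖ ≤ r := by
    rw [← cfc_id ℝ ((a : Unitization ℂ A) - b) hsa]
    refine norm_cfc_le (Real.sqrt_nonneg _) fun x hx => ?_
    rw [Real.norm_eq_abs, abs_le]
    constructor
    · refine (algebraMap_le_iff_le_spectrum hsa).1 ?_ x hx
      rw [map_neg, ← neg_sub, neg_le_neg_iff]; exact h2
    · exact (le_algebraMap_iff_spectrum_le hsa).1 h1 x hx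
  rw [hr2]
  have e2 : ‖a - b‖ = ‖(a : Unitization ℂ A) - b‖ := by
    rw [← Unitization.norm_inr (𝕜 := ℂ)]; simp
  rw [e2]
  gcongr

/-- The elements x · `rootCut`(x*x) approximate the partial isometry in the polar decomposition of
x; their squared modulus is a `cubeCut`. -/
theorem norm_mul_cfcₙ_rootCut_le {x : A} {ε : ℝ} (hε : 0 < ε) :
    ‖x * cfcₙ (rootCut ε) (star x * x)‖ ≤ 1 := by
  have hm : 0 ≤ star x * x := star_mul_self_nonneg x
  have hR : star (cfcₙ (rootCut ε) (star x * x)) = cfcₙ (rootCut ε) (star x * x) :=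
    (IsSelfAdjoint.cfcₙ (f := rootCut ε)).star_eq
  rw [← sq_le_one_iff₀ (norm_nonneg _), sq, ← CStarRing.norm_star_mul_self, star_mul, hR]
  calc _ = ‖cfcₙ (cubeCut ε) (star x * x)‖ := by
        rw [cfcₙ_cubeCut (.of_nonneg hm) hε]; simp only [mul_assoc]
    _ ≤ 1 := norm_cubeCut_le hm hε

/-- Beyond ε both cut-offs equal t^(-1/2). Below ε, t times the square of either one is at most 1,
hence so is t times the square of their difference, and one factor t ≤ ε is left over. This is the
Cauchy estimate for `exists_polar`. -/
theorem rootCut_sub_sq_mul_le {ε δ t : ℝ} (hδ : 0 < δ) (h : δ ≤ ε) (ht : 0 ≤ t) :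
    ((rootCut ε t - rootCut δ t) * t) ^ 2 ≤ ε := by
  have hε := hδ.trans_le h
  rcases le_total ε t with hεt | hεt
  · have : rootCut ε t = rootCut δ t := by
      rw [rootCut, rootCut, max_eq_left hεt, max_eq_left (h.trans hεt),
        min_eq_left ((one_le_div hε).2 hεt), min_eq_left ((one_le_div hδ).2 (h.trans hεt))]
    simp [this, hε.le]
  · have h1 := rootCut_nonneg hε ht
    have h2 := rootCut_nonneg hδ ht
    have h3 : t * rootCut ε t ^ 2 ≤ 1 := cubeCut_le_one hε ht
    have h4 : t * rootCut δ t ^ 2 ≤ 1 := cubeCut_le_one hδ ht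
    have h5 : t * (rootCut ε t - rootCut δ t) ^ 2 ≤ 1 := by
      rcases le_total (rootCut ε t) (rootCut δ t) with h6 | h6
      · have : (rootCut ε t - rootCut δ t) ^ 2 ≤ rootCut δ t ^ 2 := by nlinarith
        exact (mul_le_mul_of_nonneg_left this ht).trans h4
      · have : (rootCut ε t - rootCut δ t) ^ 2 ≤ rootCut ε t ^ 2 := by nlinarith
        exact (mul_le_mul_of_nonneg_left this ht).trans h3
    calc ((rootCut ε t - rootCut δ t) * t) ^ 2 = t * (rootCut ε t - rootCut δ t) ^ 2 * t := by ring
      _ ≤ 1 * ε := mul_le_mul h5 hεt ht zero_le_one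
      _ = ε := one_mul _

/-- If `f * star f` is dominated by a multiple of `star x * x`, then the product `w = v * f` of
`f` with the partial isometry `v` in the polar decomposition of `x` exists. -/
theorem exists_polar {x f : A} {K : ℝ} (hf : f * star f ≤ K • (star x * x)) (hf0 : 0 ≤ f) :
    ∃ w ∈ closure (Set.range fun y => x * y), star w * w = f * f ∧
      ‖w - f‖ ≤ ‖x - f‖ + √‖f * f - star x * x‖ := by
  set m := star x * x with hm
  have hm0 : 0 ≤ m := star_mul_self_nonneg x
  have hmsa : IsSelfAdjoint m := .of_nonneg hm0
  have hfs : star f = f := (IsSelfAdjoint.of_nonneg hf0).star_eq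
  set ε : ℕ → ℝ := fun n => 1 / ((n : ℝ) + 1) with hεdef
  have hε : ∀ n, 0 < ε n := fun n => by simp only [hεdef]; positivity
  have hεlim : Filter.Tendsto ε Filter.atTop (nhds 0) := tendsto_one_div_add_atTop_nhds_zero_nat
  have hanti : ∀ {n k}, n ≤ k → ε k ≤ ε n := fun {n k} h => by
    simp only [hεdef]; gcongr
  set R : ℕ → A := fun n => cfcₙ (rootCut (ε n)) m with hR
  have hRs : ∀ n, star (R n) = R n := fun n => (IsSelfAdjoint.cfcₙ (f := rootCut (ε n))).star_eq
  set w : ℕ → A := fun n => x * R n * f with hw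
  have hff : f * f ≤ |K| • m := by
    rw [hfs] at hf
    exact hf.trans (smul_le_smul_of_nonneg_right (le_abs_self K) hm0)
  -- the sequence is Cauchy
  have hdist : ∀ n k, n ≤ k → ‖w n - w k‖ ^ 2 ≤ |K| * ε n := by
    intro n k hnk
    have hc1 := continuous_rootCut (hε n)
    have hc2 := continuous_rootCut (hε k)
    set q : ℝ → ℝ := fun t => rootCut (ε n) t - rootCut (ε k) t with hq
    have hqc : Continuous q := by fun_prop
    have hq0 : q 0 = 0 := by simp [hq]
    set Q := cfcₙ q m with hQ
    have hQs : star Q = Q := (IsSelfAdjoint.cfcₙ (f := q)).star_eq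
    have hQe : Q = R n - R k := cfcₙ_sub _ _ m (by fun_prop) (by simp) (by fun_prop) (by simp)
    -- With S² = QmQ, the squared distance is ‖(Sf)*(Sf)‖ = ‖S f² S‖. Turning the product around
    -- puts f² in the middle, where f² ≤ |K|m can be used.
    set S := cfcₙ (fun t => q t * √t) m with hS
    have hSs : star S = S := (IsSelfAdjoint.cfcₙ (f := fun t => q t * √t)).star_eq
    have hsq : Continuous fun t => q t * √t := hqc.mul Real.continuous_sqrt
    have hSS : S * S = Q * m * Q := by
      rw [hS, ← cfcₙ_mul (fun t => q t * √t) (fun t => q t * √t) m (by fun_prop) (by simp)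
        (by fun_prop) (by simp), hQ]
      conv_rhs => rw [← cfcₙ_id' ℝ m hmsa]
      rw [cfcₙ_id' ℝ m hmsa]
      conv_rhs =>
        enter [1, 2]
        rw [← cfcₙ_id' ℝ m hmsa]
      rw [← cfcₙ_mul q (fun t => t) m (by fun_prop) hq0 (by fun_prop) (by simp),
        ← cfcₙ_mul (fun t => q t * t) q m (by fun_prop) (by simp) (by fun_prop) hq0]
      refine cfcₙ_congr fun t ht => ?_
      have h0 := Real.mul_self_sqrt (real_quasispectrum_nonneg hm0 ht)
      change q t * √t * (q t * √t) = q t * t * q t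
      linear_combination (q t * q t) * h0
    have hSmS : ‖S * m * S‖ ≤ ε n := by
      have : S * m * S = cfcₙ (fun t => (q t * t) ^ 2) m := by
        conv_lhs =>
          enter [1, 2]
          rw [← cfcₙ_id' ℝ m hmsa]
        rw [hS, ← cfcₙ_mul (fun t => q t * √t) (fun t => t) m (by fun_prop) (by simp)
          (by fun_prop) (by simp), ← cfcₙ_mul (fun t => q t * √t * t) (fun t => q t * √t) m
          (by fun_prop) (by simp) (by fun_prop) (by simp)]
        refine cfcₙ_congr fun t ht => ?_
        have h0 := Real.mul_self_sqrt (real_quasispectrum_nonneg hm0 ht)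
        change q t * √t * t * (q t * √t) = (q t * t) ^ 2
        linear_combination (q t * q t * t) * h0
      rw [this]
      refine norm_cfcₙ_le fun t ht => ?_
      rw [Real.norm_of_nonneg (sq_nonneg _)]
      exact rootCut_sub_sq_mul_le (hε k) (hanti hnk) (real_quasispectrum_nonneg hm0 ht)
    have e1 : star (w n - w k) * (w n - w k) = star (S * f) * (S * f) := by
      have : w n - w k = x * Q * f := by simp only [hw, hQe, mul_sub, sub_mul]
      rw [this, star_mul, star_mul, hQs, star_mul, hSs]
      calc star f * (Q * star x) * (x * Q * f) = star f * (Q * (star x * x) * Q) * f := by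
            simp only [mul_assoc]
        _ = _ := by rw [← hm, ← hSS]; simp only [mul_assoc]
    calc ‖w n - w k‖ ^ 2 = ‖star (S * f) * (S * f)‖ := by
          rw [sq, ← CStarRing.norm_star_mul_self, e1]
      _ = ‖S * (f * f) * star S‖ := by
          rw [CStarRing.norm_star_mul_self, ← CStarRing.norm_self_mul_star, star_mul, hfs]
          simp only [mul_assoc]
      _ ≤ ‖S * (|K| • m) * star S‖ :=
          CStarAlgebra.norm_le_norm_of_nonneg_of_le
            (star_right_conjugate_nonneg (by simpa only [hfs] using mul_star_self_nonneg f) _)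
            (star_right_conjugate_le_conjugate hff _)
      _ = |K| * ‖S * m * S‖ := by
          rw [hSs, mul_smul_comm, smul_mul_assoc, norm_smul, Real.norm_eq_abs, abs_abs]
      _ ≤ |K| * ε n := by gcongr
  have hcau : CauchySeq w := by
    refine cauchySeq_of_le_tendsto_0 (fun n => 2 * √(|K| * ε n)) (fun n k N hn hk => ?_) ?_
    · have h1 : ∀ j, N ≤ j → ‖w N - w j‖ ≤ √(|K| * ε N) := fun j hj =>
        Real.le_sqrt_of_sq_le (hdist N j hj)
      calc dist (w n) (w k) ≤ dist (w N) (w n) + dist (w N) (w k) := dist_triangle_left _ _ _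
        _ ≤ √(|K| * ε N) + √(|K| * ε N) := by
          rw [dist_eq_norm, dist_eq_norm]; exact add_le_add (h1 n hn) (h1 k hk)
        _ = _ := by ring
    · have : Filter.Tendsto (fun n => 2 * √(|K| * ε n)) Filter.atTop (nhds (2 * √(|K| * 0))) :=
        ((hεlim.const_mul _).sqrt).const_mul 2
      simpa using this
  obtain ⟨w₀, hw₀⟩ := cauchySeq_tendsto_of_complete hcau
  refine ⟨w₀, mem_closure_of_tendsto hw₀ (.of_forall fun n => ⟨R n * f, ?_⟩), ?_, ?_⟩
  · simp only [hw, mul_assoc]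
  · have h1 : Filter.Tendsto (fun n => star (w n) * w n) Filter.atTop (nhds (star w₀ * w₀)) :=
      hw₀.star.mul hw₀
    have h2 : Filter.Tendsto (fun n => f * cfcₙ (cubeCut (ε n)) m * f) Filter.atTop
        (nhds (f * f)) :=
      (tendsto_mul_cubeCut (x := f) (K := |K|) hm0 (by rwa [hfs])).mul_const f
    refine tendsto_nhds_unique h1 (h2.congr fun n => ?_)
    rw [cfcₙ_cubeCut hmsa (hε n)]
    simp only [hw, star_mul, hRs, hfs]
    change f * (R n * (star x * x) * R n) * f = _
    simp only [mul_assoc]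
  · -- compare with `x` itself
    have hsqrt0 : 0 ≤ CFC.sqrt m := CFC.sqrt_nonneg m
    have hbd : ∀ n, ‖w n - x‖ ≤ ‖f - CFC.sqrt m‖ + √(ε n) := by
      intro n
      have hc1 := continuous_rootCut (hε n)
      set p : ℝ → ℝ := fun t => rootCut (ε n) t * √t with hp
      have hpc : Continuous p := hc1.mul Real.continuous_sqrt
      have e1 : R n * CFC.sqrt m = cfcₙ p m := by
        rw [CFC.sqrt_eq_real_sqrt m hm0, hR,
          ← cfcₙ_mul (rootCut (ε n)) Real.sqrt m (by fun_prop) (by simp)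
            Real.continuous_sqrt.continuousOn (by simp)]
      have hp01 : ∀ t, 0 ≤ t → 0 ≤ p t ∧ p t ≤ 1 ∧ (ε n ≤ t → p t = 1) := by
        intro t ht
        have h0 : 0 ≤ p t := mul_nonneg (rootCut_nonneg (hε n) ht) (Real.sqrt_nonneg _)
        have hsq : p t ^ 2 = cubeCut (ε n) t := by
          simp only [hp, cubeCut, mul_pow, Real.sq_sqrt ht]; ring
        refine ⟨h0, ?_, fun h => ?_⟩
        · rw [← sq_le_one_iff₀ h0, hsq]; exact cubeCut_le_one (hε n) ht
        · rw [cubeCut_of_le (hε n) h] at hsq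
          exact (pow_eq_one_iff_of_nonneg h0 two_ne_zero).1 hsq
      have e2 : ‖x - x * cfcₙ p m‖ ^ 2 ≤ ε n + ‖(0 : A)‖ := by
        refine norm_sub_mul_cutoff_sq hm0 (by rw [add_zero]) hpc (by simp [hp])
          (fun t ht => ?_) fun t ht => ?_
        · obtain ⟨h1, h2, -⟩ := hp01 t ht
          rw [abs_le]; constructor <;> linarith
        · obtain ⟨h1, h2, h3⟩ := hp01 t ht
          rcases le_total (ε n) t with h | h
          · simp [h3 h, (hε n).le]
          · have h4 : 0 ≤ 1 - p t := by linarith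
            rw [abs_of_nonneg (by positivity)]
            have : (1 - p t) * (1 - p t) ≤ 1 := by nlinarith
            nlinarith
      -- Writing |x| = √m, x is almost xR|x|, so passing from w to x amounts to replacing f by |x|
      -- behind the contraction xR.
      have e3 : w n - x = x * R n * (f - CFC.sqrt m) - (x - x * cfcₙ p m) := by
        rw [← e1]; simp only [hw, mul_sub, mul_assoc]; abel
      rw [e3]
      refine (norm_sub_le _ _).trans (add_le_add ?_ ?_)
      · calc ‖x * R n * (f - CFC.sqrt m)‖ ≤ ‖x * R n‖ * ‖f - CFC.sqrt m‖ := norm_mul_le _ _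
          _ ≤ 1 * ‖f - CFC.sqrt m‖ := by
            gcongr; exact norm_mul_cfcₙ_rootCut_le (hε n)
          _ = _ := one_mul _
      · refine Real.le_sqrt_of_sq_le ?_
        simpa using e2
    have hlim : ‖w₀ - x‖ ≤ ‖f - CFC.sqrt m‖ := by
      have h1 : Filter.Tendsto (fun n => ‖w n - x‖) Filter.atTop (nhds ‖w₀ - x‖) :=
        (hw₀.sub_const x).norm
      have h2 : Filter.Tendsto (fun n => ‖f - CFC.sqrt m‖ + √(ε n)) Filter.atTop
          (nhds (‖f - CFC.sqrt m‖ + √0)) := (hεlim.sqrt).const_add _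
      simpa using le_of_tendsto_of_tendsto' h1 h2 hbd
    have hs : ‖f - CFC.sqrt m‖ ≤ √‖f * f - m‖ := by
      refine Real.le_sqrt_of_sq_le ?_
      have := norm_sub_sq_le_of_nonneg hf0 hsqrt0
      rwa [CFC.sqrt_mul_sqrt_self m hm0] at this
    calc ‖w₀ - f‖ = ‖(w₀ - x) + (x - f)‖ := by congr 1; abel
      _ ≤ ‖w₀ - x‖ + ‖x - f‖ := norm_add_le _ _
      _ ≤ ‖x - f‖ + √‖f * f - m‖ := by linarith

/-- If two self-adjoint elements act in the same way on a closed subalgebra containing one of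
them, then so do their continuous functions. -/
theorem cfcₙ_mul_eq_of_mul_eq {E : NonUnitalStarSubalgebra ℂ A} (hE : IsClosed (E : Set A))
    {s c : A} (hs : IsSelfAdjoint s) (hc : IsSelfAdjoint c) (hcE : c ∈ E)
    (h : ∀ z ∈ E, s * z = c * z) {f : ℝ → ℝ} (hf : Continuous f) :
    cfcₙ f c ∈ E ∧ ∀ z ∈ E, cfcₙ f s * z = cfcₙ f c * z := by
  -- The pairs (s, c) acting equally on E, together with their adjoints, form a closed *-subalgebra
  -- of A × A. It is therefore stable under functional calculus, which is computed coordinatewise.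
  let N : NonUnitalStarSubalgebra ℂ (A × A) :=
    { carrier := {p | p.2 ∈ E ∧ (∀ z ∈ E, p.1 * z = p.2 * z) ∧
        ∀ z ∈ E, star p.1 * z = star p.2 * z}
      add_mem' := by
        rintro p q ⟨hp, hp1, hp2⟩ ⟨hq, hq1, hq2⟩
        refine ⟨add_mem hp hq, fun z hz => ?_, fun z hz => ?_⟩
        · simp [add_mul, hp1 z hz, hq1 z hz]
        · simp [add_mul, hp2 z hz, hq2 z hz]
      zero_mem' := ⟨zero_mem E, by simp, by simp⟩
      mul_mem' := by
        rintro p q ⟨hp, hp1, hp2⟩ ⟨hq, hq1, hq2⟩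
        refine ⟨mul_mem hp hq, fun z hz => ?_, fun z hz => ?_⟩
        · simp [mul_assoc, hq1 z hz, hp1 _ (mul_mem hq hz)]
        · simp [mul_assoc, hp2 z hz, hq2 _ (mul_mem (star_mem hp) hz)]
      smul_mem' := by
        rintro k p ⟨hp, hp1, hp2⟩
        refine ⟨SMulMemClass.smul_mem k hp, fun z hz => ?_, fun z hz => ?_⟩
        · simp [smul_mul_assoc, hp1 z hz]
        · simp [smul_mul_assoc, hp2 z hz]
      star_mem' := by
        rintro p ⟨hp, hp1, hp2⟩
        exact ⟨star_mem hp, by simpa using hp2, by simpa using hp1⟩ }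
  have hN : IsClosed (N : Set (A × A)) := by
    have : (N : Set (A × A)) = {p | p.2 ∈ E} ∩ ((⋂ z ∈ E, {p | p.1 * z = p.2 * z}) ∩
        ⋂ z ∈ E, {p | star p.1 * z = star p.2 * z}) := by
      ext p
      simp only [Set.mem_inter_iff, Set.mem_iInter]
      exact Iff.rfl
    rw [this]
    refine (hE.preimage continuous_snd).inter ((isClosed_biInter fun z _ => ?_).inter
      (isClosed_biInter fun z _ => ?_))
    · exact isClosed_eq (by fun_prop) (by fun_prop)
    · exact isClosed_eq (by fun_prop) (by fun_prop)
  have hmem : (s, c) ∈ N :=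
    ⟨hcE, h, fun z hz => by simp only [hs.star_eq, hc.star_eq]; exact h z hz⟩
  have := cfcₙ_mem (𝕜 := ℝ) (𝕜' := ℂ) (s := N) (hs := hN) f hmem
  rw [cfcₙ_map_prod (S := ℂ) f s c (by fun_prop)
    (by rw [isSelfAdjoint_iff, Prod.star_def, hs.star_eq, hc.star_eq]) hs hc] at this
  exact ⟨this.1, this.2.1⟩

end CStar

/-! ### Cuntz subequivalence and conjugation into a hereditary subalgebra -/

section CStar

variable {A : Type*} [NonUnitalCStarAlgebra A] [PartialOrder A] [StarOrderedRing A]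

theorem exists_approx_unit (G : Finset A) {ε : ℝ} (hε : 0 < ε) :
    ∃ u : A, 0 ≤ u ∧ ‖u‖ ≤ 1 ∧
      ∀ y ∈ G, ‖y - u * y‖ < ε ∧ ‖y - y * u‖ < ε ∧ ‖y - u * y * u‖ < ε := by
  have hu := CStarAlgebra.increasingApproximateUnit A
  have := hu.neBot
  have h1 : ∀ y ∈ G, ∀ᶠ u in CStarAlgebra.approximateUnit A,
      ‖y - u * y‖ < ε / 2 ∧ ‖y - y * u‖ < ε / 2 := by
    intro y _
    have e1 := (tendsto_iff_norm_sub_tendsto_zero.1 (hu.tendsto_mul_right y)).eventually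
      (gt_mem_nhds (half_pos hε))
    have e2 := (tendsto_iff_norm_sub_tendsto_zero.1 (hu.tendsto_mul_left y)).eventually
      (gt_mem_nhds (half_pos hε))
    filter_upwards [e1, e2] with u h1 h2
    exact ⟨by rwa [norm_sub_rev], by rwa [norm_sub_rev]⟩
  obtain ⟨u, h2, h3, h4⟩ := (((Filter.eventually_all_finset G).2 h1).and
    (hu.eventually_nonneg.and hu.eventually_norm)).exists
  refine ⟨u, h3, h4, fun y hy => ⟨(h2 y hy).1.trans (by linarith), (h2 y hy).2.trans (by linarith),
    ?_⟩⟩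
  calc ‖y - u * y * u‖ = ‖(y - u * y) + u * (y - y * u)‖ := by
        congr 1; simp only [mul_sub, mul_assoc]; abel
    _ ≤ ‖y - u * y‖ + ‖u‖ * ‖y - y * u‖ := (norm_add_le _ _).trans (by gcongr; exact norm_mul_le _ _)
    _ ≤ ‖y - u * y‖ + 1 * ‖y - y * u‖ := by gcongr
    _ < ε / 2 + 1 * (ε / 2) := by
        have := h2 y hy
        gcongr
        exacts [this.1, this.2]
    _ = ε := by ring

theorem cuntzLE_iff {a b : A} :
    CuntzLE a b ↔ ∀ ε : ℝ, 0 < ε → ∃ x : A, ‖star x * b * x - a‖ < ε := by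
  constructor
  · rintro ⟨x, hx⟩ ε hε
    obtain ⟨n, hn⟩ := ((tendsto_iff_norm_sub_tendsto_zero.1 hx).eventually (gt_mem_nhds hε)).exists
    exact ⟨x n, hn⟩
  · intro h
    choose x hx using fun n : ℕ => h (1 / ((n : ℝ) + 1)) (by positivity)
    refine ⟨x, tendsto_iff_norm_sub_tendsto_zero.2 ?_⟩
    exact squeeze_zero (fun _ => norm_nonneg _) (fun n => (hx n).le)
      tendsto_one_div_add_atTop_nhds_zero_nat

theorem CuntzLE.trans {a b c : A} (hab : CuntzLE a b) (hbc : CuntzLE b c) : CuntzLE a c := by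
  rw [cuntzLE_iff] at *
  intro ε hε
  obtain ⟨x, hx⟩ := hab (ε / 2) (half_pos hε)
  obtain ⟨y, hy⟩ := hbc (ε / 2 / (‖x‖ * ‖x‖ + 1)) (by positivity)
  refine ⟨y * x, ?_⟩
  have e : star (y * x) * c * (y * x) - a =
      star x * (star y * c * y - b) * x + (star x * b * x - a) := by
    simp only [star_mul, mul_sub, sub_mul, mul_assoc]; abel
  have h1 : ‖star x * (star y * c * y - b) * x‖ ≤ ε / 2 := by
    calc _ ≤ ‖x‖ * ‖star y * c * y - b‖ * ‖x‖ :=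
          (norm_mul_le _ _).trans (by gcongr; exact (norm_mul_le _ _).trans (by rw [norm_star]))
      _ ≤ ‖x‖ * (ε / 2 / (‖x‖ * ‖x‖ + 1)) * ‖x‖ := by gcongr
      _ = ε / 2 * ((‖x‖ * ‖x‖) / (‖x‖ * ‖x‖ + 1)) := by ring
      _ ≤ ε / 2 * 1 := by
          gcongr
          rw [div_le_one (by positivity)]; linarith
      _ = ε / 2 := mul_one _
  rw [e]
  calc _ ≤ _ := norm_add_le _ _
    _ < ε := by linarith

/-- For m = y*py and z = √a, domination gives z c(m) z → a along the cut-offs c(m) = RmR, and each z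
c(m) z is the conjugate of p by yRz. -/
theorem cuntzLE_of_le_conj {a p y : A} (ha : 0 ≤ a) (hp : 0 ≤ p) (h : a ≤ star y * p * y) :
    CuntzLE a p := by
  set m := star y * p * y with hm
  have hm0 : 0 ≤ m := star_left_conjugate_nonneg hp y
  set z := CFC.sqrt a
  have hz0 : 0 ≤ z := CFC.sqrt_nonneg a
  have hzs : star z = z := (IsSelfAdjoint.of_nonneg hz0).star_eq
  have hzz : z * z = a := CFC.sqrt_mul_sqrt_self a ha
  refine ⟨fun n => y * cfcₙ (rootCut (1 / ((n : ℝ) + 1))) m * z, ?_⟩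
  have h1 := (tendsto_mul_cubeCut (x := z) (K := 1) hm0 (by rwa [hzs, hzz, one_smul])).mul_const z
  rw [hzz] at h1
  refine h1.congr fun n => ?_
  have hR : star (cfcₙ (rootCut (1 / ((n : ℝ) + 1))) m) = cfcₙ (rootCut (1 / ((n : ℝ) + 1))) m :=
    (IsSelfAdjoint.cfcₙ (f := rootCut (1 / ((n : ℝ) + 1)))).star_eq
  rw [cfcₙ_cubeCut (.of_nonneg hm0) (by positivity)]
  simp only [star_mul, hR, hzs]
  rw [hm]
  simp only [mul_assoc]

/-- A small perturbation `s` of an element `e` can be cut down and conjugated into the hereditary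
subalgebra generated by `e`. -/
theorem exists_conjugator {e s : A} (he : 0 ≤ e) (hs : 0 ≤ s) (hs2 : ‖s‖ ≤ 2)
    {ε δ : ℝ} (hε : 0 < ε) (hδ : δ ≤ ε / 4) (hes : ‖e - s‖ ≤ δ) :
    ∃ w ∈ closure (Set.range fun y => e * y),
      star w * w = cfcₙ (fCut ε) s * cfcₙ (fCut ε) s ∧
      ‖w * cfcₙ (fCut (2 * ε)) s * s - s‖ ≤ 2 * (2 * δ / ε + √(3 * (2 * δ / ε))) + 2 * ε := by
  have hssa : IsSelfAdjoint s := .of_nonneg hs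
  have hδ0 : 0 ≤ δ := (norm_nonneg _).trans hes
  have hcf := continuous_fCut ε
  have hcg := continuous_fCut (2 * ε)
  -- This is f_ε(t)/t, kept continuous by bounding the denominator below; f_ε vanishes where the
  -- bound is active. Hence sκ(s) = f_ε(s), and eκ(s) is a perturbation of it lying in eA.
  set κ : ℝ → ℝ := fun t => fCut ε t / max t (ε / 2) with hκ
  have hκc : Continuous κ := by
    refine hcf.div (by fun_prop) fun t => ?_
    have : 0 < max t (ε / 2) := lt_max_of_lt_right (by linarith)
    exact this.ne'
  have hf0 := fCut_zero hε
  have hg0 := fCut_zero (ε := 2 * ε) (by linarith)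
  have hκ0 : κ 0 = 0 := by simp [hκ, hf0]
  have hκt : ∀ t, t * κ t = fCut ε t := by
    intro t
    rcases le_total t (ε / 2) with h | h
    · simp [hκ, fCut_of_le_half hε h]
    · have : 0 < t := by linarith
      simp only [hκ, max_eq_left h]; field_simp
  have hκn : ∀ t, 0 ≤ κ t := fun t =>
    div_nonneg (fCut_nonneg _ _) (le_max_of_le_right (by linarith))
  have hκle : ∀ t, κ t ≤ 2 / ε * fCut ε t := by
    intro t
    rw [hκ, div_mul_eq_mul_div, mul_comm (2 : ℝ), mul_div_assoc]
    have h1 : (max t (ε / 2))⁻¹ ≤ 2 / ε := by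
      rw [inv_le_comm₀ (lt_max_of_lt_right (by linarith)) (by positivity)]
      calc (2 / ε)⁻¹ = ε / 2 := by rw [inv_div]
        _ ≤ _ := le_max_right _ _
    simp only [div_eq_mul_inv] at h1 ⊢
    exact mul_le_mul_of_nonneg_left h1 (fCut_nonneg _ _)
  set F := cfcₙ (fCut ε) s with hF
  set G := cfcₙ (fCut (2 * ε)) s with hG
  set Kp := cfcₙ κ s with hKp
  have hF0 : 0 ≤ F := cfcₙ_nonneg fun t _ => fCut_nonneg _ _
  have hFs : star F = F := (IsSelfAdjoint.of_nonneg hF0).star_eq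
  have hF1 : ‖F‖ ≤ 1 := norm_cfcₙ_le fun t _ => by
    rw [Real.norm_of_nonneg (fCut_nonneg _ _)]; exact fCut_le_one _ _
  have hKs : star Kp = Kp := (IsSelfAdjoint.cfcₙ (f := κ)).star_eq
  have hsK : s * Kp = F := by
    rw [hF, ← funext hκt, cfcₙ_mul (fun t => t) κ s (by fun_prop) (by simp) (by fun_prop) hκ0,
      cfcₙ_id' ℝ s hssa]
  have hKn : ‖Kp‖ ≤ 2 / ε := norm_cfcₙ_le fun t _ => by
    rw [Real.norm_of_nonneg (hκn t)]
    calc κ t ≤ 2 / ε * fCut ε t := hκle t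
      _ ≤ 2 / ε * 1 := by gcongr; exact fCut_le_one _ _
      _ = 2 / ε := mul_one _
  have hKK : Kp * Kp ≤ (2 / ε) ^ 2 • (F * F) := by
    rw [hKp, hF, ← cfcₙ_mul κ κ s (by fun_prop) hκ0 (by fun_prop) hκ0,
      ← cfcₙ_mul (fCut ε) (fCut ε) s (by fun_prop) hf0 (by fun_prop) hf0,
      ← cfcₙ_smul ((2 / ε) ^ 2) (fun t => fCut ε t * fCut ε t) s (by fun_prop) (by simp [hf0])]
    refine cfcₙ_mono (fun t _ => ?_) (by fun_prop) (by fun_prop) (by simp [hκ0]) (by simp [hf0])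
    have := mul_self_le_mul_self (hκn t) (hκle t)
    simp only [smul_eq_mul]
    calc _ ≤ _ := this
      _ = _ := by ring
  have hFG : F * G = G := by
    rw [hF, hG, ← cfcₙ_mul (fCut ε) (fCut (2 * ε)) s (by fun_prop) hf0 (by fun_prop) hg0]
    simp only [fCut_mul_fCut hε]
  have hG1 : ‖G‖ ≤ 1 := norm_cfcₙ_le fun t _ => by
    rw [Real.norm_of_nonneg (fCut_nonneg _ _)]; exact fCut_le_one _ _
  have hGs : ‖G * s - s‖ ≤ 2 * ε := by
    have : G * s - s = cfcₙ (fun t => fCut (2 * ε) t * t - t) s := by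
      rw [cfcₙ_sub (fun t => fCut (2 * ε) t * t) (fun t => t) s (by fun_prop) (by simp)
        (by fun_prop) (by simp),
        cfcₙ_mul (fCut (2 * ε)) (fun t => t) s (by fun_prop) hg0 (by fun_prop) (by simp),
        cfcₙ_id' ℝ s hssa]
    rw [this]
    refine norm_cfcₙ_le fun t ht => ?_
    have h0 := real_quasispectrum_nonneg hs ht
    rw [Real.norm_eq_abs]
    rcases le_total (2 * ε) t with h | h
    · rw [fCut_of_le (by linarith) h]; simp [hε.le]
    · have h1 := fCut_nonneg (2 * ε) t
      have h2 := fCut_le_one (2 * ε) t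
      rw [abs_le]; constructor <;> nlinarith
  set x := e * Kp with hx
  set ρ := 2 * δ / ε with hρ
  have hρ0 : 0 ≤ ρ := by positivity
  have hρ1 : ρ ≤ 1 / 2 := by
    rw [hρ, div_le_iff₀ hε]; linarith
  have hxF : ‖x - F‖ ≤ ρ := by
    have : x - F = (e - s) * Kp := by rw [hx, ← hsK, sub_mul]
    rw [this]
    calc _ ≤ ‖e - s‖ * ‖Kp‖ := norm_mul_le _ _
      _ ≤ δ * (2 / ε) := by gcongr
      _ = ρ := by rw [hρ]; ring
  -- The hypothesis δ ≤ ε/4 makes ρ ≤ 1/2, so the error z = F - x has z*z ≤ F²/4. Then F² ≤ 2x*x +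
  -- 2z*z ≤ 2x*x + F²/2, and the last term is absorbed on the left.
  have hdom : F * F ≤ (4 : ℝ) • (star x * x) := by
    set z := (s - e) * Kp with hz
    have hxz : F = x + z := by rw [hx, hz, ← hsK, sub_mul]; abel
    have hesa : IsSelfAdjoint (s - e) := hssa.sub (.of_nonneg he)
    have hzz : star z * z ≤ (1 / 4 : ℝ) • (F * F) := by
      have h1 : star z * z = star Kp * ((s - e) * (s - e)) * Kp := by
        rw [hz, star_mul, hesa.star_eq]; simp only [mul_assoc]
      have h2 : IsSelfAdjoint ((s - e) * (s - e)) := by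
        have := IsSelfAdjoint.star_mul_self (s - e)
        rwa [hesa.star_eq] at this
      have h3 : ‖(s - e) * (s - e)‖ ≤ δ * δ := by
        refine (norm_mul_le _ _).trans ?_
        rw [norm_sub_rev] at hes
        gcongr
      have hKK0 : 0 ≤ star Kp * Kp := star_mul_self_nonneg _
      have hFF0 : 0 ≤ F * F := by
        have := star_mul_self_nonneg F
        rwa [hFs] at this
      rw [h1]
      calc _ ≤ ‖(s - e) * (s - e)‖ • (star Kp * Kp) :=
            CStarAlgebra.star_left_conjugate_le_norm_smul h2
        _ ≤ (δ * δ) • (star Kp * Kp) := smul_le_smul_of_nonneg_right h3 hKK0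
        _ ≤ (δ * δ) • ((2 / ε) ^ 2 • (F * F)) := by
            rw [hKs]; exact smul_le_smul_of_nonneg_left hKK (by positivity)
        _ = (ρ * ρ) • (F * F) := by rw [smul_smul, hρ]; congr 1; ring
        _ ≤ (1 / 4 : ℝ) • (F * F) := smul_le_smul_of_nonneg_right (by nlinarith) hFF0
    have h4 : F * F ≤ (2 : ℝ) • (star x * x) + (2 : ℝ) • (star z * z) := by
      conv_lhs => rw [← hFs]; rw [hFs]
      have := star_mul_self_add_le x z
      rw [← hxz, hFs] at this
      exact this
    have h5 : F * F ≤ (2 : ℝ) • (star x * x) + (1 / 2 : ℝ) • (F * F) := by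
      refine h4.trans ?_
      gcongr
      calc (2 : ℝ) • (star z * z) ≤ (2 : ℝ) • ((1 / 4 : ℝ) • (F * F)) :=
            smul_le_smul_of_nonneg_left hzz (by norm_num)
        _ = _ := by rw [smul_smul]; norm_num
    have h6 : (1 / 2 : ℝ) • (F * F) ≤ (2 : ℝ) • (star x * x) := by
      have h7 : F * F = (1 / 2 : ℝ) • (F * F) + (1 / 2 : ℝ) • (F * F) := by
        rw [← add_smul]; norm_num
      nth_rewrite 1 [h7] at h5
      exact le_of_add_le_add_right h5
    have := smul_le_smul_of_nonneg_left h6 (show (0 : ℝ) ≤ 2 by norm_num)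
    rw [smul_smul, smul_smul] at this
    norm_num at this
    exact this
  obtain ⟨w, hwc, hww, hwF⟩ := exists_polar (x := x) (f := F) (K := 4) (by rwa [hFs]) hF0
  refine ⟨w, ?_, hww, ?_⟩
  · refine closure_mono ?_ hwc
    rintro _ ⟨y, rfl⟩
    exact ⟨Kp * y, by simp only [hx, mul_assoc]⟩
  · have hxn : ‖x‖ ≤ 2 := by
      calc ‖x‖ = ‖(x - F) + F‖ := by rw [sub_add_cancel]
        _ ≤ ‖x - F‖ + ‖F‖ := norm_add_le _ _
        _ ≤ 2 := by linarith
    have h1 : ‖F * F - star x * x‖ ≤ 3 * ρ := by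
      have : F * F - star x * x = (star F - star x) * F + star x * (F - x) := by
        rw [hFs, sub_mul, mul_sub]; abel
      rw [this]
      calc _ ≤ ‖star F - star x‖ * ‖F‖ + ‖star x‖ * ‖F - x‖ :=
            (norm_add_le _ _).trans (add_le_add (norm_mul_le _ _) (norm_mul_le _ _))
        _ ≤ ρ * 1 + 2 * ρ := by
            rw [← star_sub, norm_star, norm_star, norm_sub_rev]
            gcongr
        _ = 3 * ρ := by ring
    have h2 : ‖w - F‖ ≤ ρ + √(3 * ρ) :=
      hwF.trans (add_le_add hxF (Real.sqrt_le_sqrt h1))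
    -- Since FG = G, replacing w by F leaves exactly Gs, which is within 2ε of s.
    have h3 : w * G * s - s = (w - F) * (G * s) + (G * s - s) := by
      rw [sub_mul, ← mul_assoc F, hFG, mul_assoc w]; abel
    rw [h3]
    calc _ ≤ ‖w - F‖ * (‖G‖ * ‖s‖) + ‖G * s - s‖ :=
          (norm_add_le _ _).trans (by
            gcongr
            exact (norm_mul_le _ _).trans (by gcongr; exact norm_mul_le _ _))
      _ ≤ (ρ + √(3 * ρ)) * (1 * 2) + 2 * ε := by gcongr
      _ = _ := by ring

end CStar

/-! ### Order-hereditary subalgebras as corners -/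

section Hereditary

attribute [local instance] CStarAlgebra.spectralOrder CStarAlgebra.spectralOrderedRing

variable {A : Type*} [NonUnitalCStarAlgebra A]

/-- For y ≥ 0 one has c*yc ≤ ‖y‖c*c, which lies in B. Polarization treats two different outer
factors, and positive elements span A. -/
theorem IsHereditary.mul_mul_mem {B : NonUnitalStarSubalgebra ℂ A} (hB : IsHereditary B) {b b' : A}
    (hb : b ∈ B) (hb' : b' ∈ B) (x : A) : b * x * b' ∈ B := by
  have h1 : ∀ c ∈ B, ∀ y : A, 0 ≤ y → star c * y * c ∈ B := by
    intro c hc y hy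
    refine hB.mem_of_le _ (‖y‖ • (star c * c)) ?_ (star_left_conjugate_nonneg hy c)
      (CStarAlgebra.star_left_conjugate_le_norm_smul (.of_nonneg hy))
    rw [← Complex.coe_smul]
    exact SMulMemClass.smul_mem _ (mul_mem (star_mem hc) hc)
  have h2 : ∀ u ∈ B, ∀ v ∈ B, ∀ y : A, 0 ≤ y → star u * y * v ∈ B := by
    intro u hu v hv y hy
    have hI : ∀ c : ℂ, c • u ∈ B := fun c => SMulMemClass.smul_mem c hu
    have e : star u * y * v = (1 / 4 : ℂ) • ((star (v + u) * y * (v + u)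
        - star (v - u) * y * (v - u)) + Complex.I • (star (v + Complex.I • u) * y *
          (v + Complex.I • u) - star (v - Complex.I • u) * y * (v - Complex.I • u))) := by
      simp only [star_add, star_sub, star_smul, add_mul, sub_mul, mul_add, mul_sub, smul_mul_assoc,
        mul_smul_comm, smul_add, smul_sub, smul_smul, Complex.star_def, Complex.conj_I]
      match_scalars <;> ring_nf <;> simp [Complex.I_sq] <;> norm_num
    rw [e]
    have hs := fun c hc => h1 c hc y hy
    refine SMulMemClass.smul_mem _ (add_mem (sub_mem (hs _ (add_mem hv hu)) (hs _ (sub_mem hv hu)))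
      (SMulMemClass.smul_mem _ (sub_mem (hs _ (add_mem hv (hI _))) (hs _ (sub_mem hv (hI _))))))
  have h3 : x ∈ Submodule.span ℂ {a : A | 0 ≤ a} := by
    rw [CStarAlgebra.span_nonneg]; trivial
  induction h3 using Submodule.span_induction with
  | mem y hy => simpa using h2 _ (star_mem hb) _ hb' y hy
  | zero => simp
  | add y z _ _ hy hz => rw [mul_add, add_mul]; exact add_mem hy hz
  | smul c y _ hy => rw [mul_smul_comm, smul_mul_assoc]; exact SMulMemClass.smul_mem _ hy

/-- Cuntz subequivalence passes to hereditary subalgebras. -/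
theorem cuntzLE_of_map {B : Type*} [NonUnitalCStarAlgebra B] (ι : B →⋆ₙₐ[ℂ] A)
    (hι : Function.Injective ι) (hher : ∀ b b' x, ∃ c, ι c = ι b * x * ι b') {p b : B}
    (h : CuntzLE (ι p) (ι b)) : CuntzLE p b := by
  have hn := NonUnitalStarAlgHom.norm_map ι hι
  rw [cuntzLE_iff] at *
  intro ε hε
  obtain ⟨x, hx⟩ := h (ε / 3) (by linarith)
  classical
  -- The witness x is replaced by uxu. The tolerance for b is divided by ‖x‖² + 1 because the error
  -- b - ubu is conjugated by x.
  obtain ⟨v, hv0, hv1, hv⟩ := exists_approx_unit {p, b}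
    (ε := min (ε / 3) (ε / 3 / (‖x‖ * ‖x‖ + 1))) (by positivity)
  set u := ι v with hu
  have husA : star u = u := by
    rw [hu, ← map_star, (IsSelfAdjoint.of_nonneg hv0).star_eq]
  have hu1A : ‖u‖ ≤ 1 := by rw [hu, hn]; exact hv1
  have h1 : ‖ι p - u * ι p * u‖ < ε / 3 := by
    have := (hv p (by simp)).2.2.trans_le (min_le_left _ _)
    rwa [← hn, map_sub, map_mul, map_mul] at this
  have h2 : ‖ι b - u * ι b * u‖ ≤ ε / 3 / (‖x‖ * ‖x‖ + 1) := by
    have := (hv b (by simp)).2.2.le.trans (min_le_right _ _)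
    rwa [← hn, map_sub, map_mul, map_mul] at this
  obtain ⟨c, hc⟩ := hher v v x
  refine ⟨c, ?_⟩
  rw [← hn, map_sub, map_mul, map_mul, map_star, hc]
  have e : star (u * x * u) * ι b * (u * x * u) - ι p =
      u * (star x * ι b * x - ι p) * u - u * (star x * (ι b - u * ι b * u) * x) * u - (ι p - u * ι p * u) := by
    simp only [star_mul, husA, mul_sub, sub_mul, mul_assoc]; abel
  have hconj : ∀ y : A, ‖u * y * u‖ ≤ ‖y‖ := fun y => by
    calc _ ≤ ‖u‖ * ‖y‖ * ‖u‖ :=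
          (norm_mul_le _ _).trans (by gcongr; exact norm_mul_le _ _)
      _ ≤ 1 * ‖y‖ * 1 := by gcongr
      _ = ‖y‖ := by ring
  have h3 : ‖star x * (ι b - u * ι b * u) * x‖ ≤ ε / 3 := by
    calc _ ≤ ‖x‖ * ‖ι b - u * ι b * u‖ * ‖x‖ :=
          (norm_mul_le _ _).trans (by gcongr; exact (norm_mul_le _ _).trans (by rw [norm_star]))
      _ ≤ ‖x‖ * (ε / 3 / (‖x‖ * ‖x‖ + 1)) * ‖x‖ := by gcongr
      _ = ε / 3 * ((‖x‖ * ‖x‖) / (‖x‖ * ‖x‖ + 1)) := by ring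
      _ ≤ ε / 3 * 1 := by
          gcongr
          rw [div_le_one (by positivity)]; linarith
      _ = ε / 3 := mul_one _
  rw [e]
  have h4 := hconj (star x * ι b * x - ι p)
  have h5 := hconj (star x * (ι b - u * ι b * u) * x)
  calc _ ≤ _ + _ := norm_sub_le _ _
    _ ≤ (‖u * (star x * ι b * x - ι p) * u‖ + ‖u * (star x * (ι b - u * ι b * u) * x) * u‖)
        + ‖ι p - u * ι p * u‖ := by gcongr; exact norm_sub_le _ _
    _ < ε := by linarith

end Hereditary

/-! ### Positive traces -/

section
open scoped ComplexOrder

/-- Bounded positive tracial functionals. -/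
structure IsPosTrace {D : Type*} [NonUnitalCStarAlgebra D] (τ : D →L[ℂ] ℂ) : Prop where
  nonneg : ∀ x, 0 ≤ τ (star x * x)
  comm : ∀ x y, τ (x * y) = τ (y * x)

theorem mem_tracialStates_iff {D : Type*} [NonUnitalCStarAlgebra D] {t : WeakDual ℂ D} :
    t ∈ tracialStates D ↔
      ‖WeakDual.toStrongDual t‖ = 1 ∧ IsPosTrace (WeakDual.toStrongDual t) :=
  ⟨fun h => ⟨h.1, h.2.1, h.2.2⟩, fun h => ⟨h.1, h.2.1, h.2.2⟩⟩

variable {D : Type*} [NonUnitalCStarAlgebra D] {τ : D →L[ℂ] ℂ}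

theorem IsPosTrace.of_re_im (h : ∀ x, 0 ≤ (τ (star x * x)).re ∧ (τ (star x * x)).im = 0)
    (hc : ∀ x y, τ (x * y) = τ (y * x)) : IsPosTrace τ :=
  ⟨fun x => Complex.nonneg_iff.2 ⟨(h x).1, (h x).2.symm⟩, hc⟩

theorem IsPosTrace.exists_tracialState (hτ : IsPosTrace τ) (h0 : τ ≠ 0) :
    ∃ t ∈ tracialStates D, ∀ x, t x = (‖τ‖⁻¹ : ℝ) * τ x := by
  have hn : 0 < ‖τ‖ := norm_pos_iff.2 h0
  refine ⟨StrongDual.toWeakDual (((‖τ‖⁻¹ : ℝ) : ℂ) • τ), ?_, fun x => rfl⟩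
  rw [mem_tracialStates_iff]
  refine ⟨?_, fun x => ?_, fun x y => ?_⟩
  · change ‖((‖τ‖⁻¹ : ℝ) : ℂ) • τ‖ = 1
    rw [norm_smul, Complex.norm_real, norm_inv, norm_norm, inv_mul_cancel₀ hn.ne']
  · change 0 ≤ ((‖τ‖⁻¹ : ℝ) : ℂ) * τ (star x * x)
    have h2 : (0 : ℂ) ≤ ((‖τ‖⁻¹ : ℝ) : ℂ) := by
      rw [Complex.zero_le_real]; positivity
    exact mul_nonneg h2 (hτ.nonneg x)
  · change ((‖τ‖⁻¹ : ℝ) : ℂ) * τ (x * y) = ((‖τ‖⁻¹ : ℝ) : ℂ) * τ (y * x)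
    rw [hτ.comm]

variable [PartialOrder D] [StarOrderedRing D]

theorem IsPosTrace.re_nonneg (hτ : IsPosTrace τ) {a : D} (ha : 0 ≤ a) : 0 ≤ (τ a).re := by
  obtain ⟨b, rfl⟩ := CStarAlgebra.nonneg_iff_eq_star_mul_self.1 ha
  exact (Complex.nonneg_iff.1 (hτ.nonneg b)).1

theorem IsPosTrace.im_eq_zero (hτ : IsPosTrace τ) {a : D} (ha : 0 ≤ a) : (τ a).im = 0 := by
  obtain ⟨b, rfl⟩ := CStarAlgebra.nonneg_iff_eq_star_mul_self.1 ha
  exact (Complex.nonneg_iff.1 (hτ.nonneg b)).2.symm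

theorem IsPosTrace.re_mono (hτ : IsPosTrace τ) {a b : D} (h : a ≤ b) : (τ a).re ≤ (τ b).re := by
  have := hτ.re_nonneg (sub_nonneg.2 h)
  rw [map_sub, Complex.sub_re] at this
  linarith

theorem IsPosTrace.im_eq_zero_of_isSelfAdjoint (hτ : IsPosTrace τ) {a : D}
    (ha : IsSelfAdjoint a) : (τ a).im = 0 := by
  rw [← CFC.posPart_sub_negPart a ha, map_sub, Complex.sub_im,
    hτ.im_eq_zero (CFC.posPart_nonneg a), hτ.im_eq_zero (CFC.negPart_nonneg a), sub_zero]

/-- The trace of the self-adjoint element i(x - x*) is real, which says that τ(x - x*) has no real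
part. -/
theorem IsPosTrace.re_star (hτ : IsPosTrace τ) (x : D) : (τ (star x)).re = (τ x).re := by
  have h : IsSelfAdjoint (Complex.I • (x - star x)) := by
    rw [isSelfAdjoint_iff, star_smul, star_sub, star_star, Complex.star_def, Complex.conj_I,
      neg_smul, ← smul_neg, neg_sub]
  have := hτ.im_eq_zero_of_isSelfAdjoint h
  simp at this
  linarith

/-- With z = √k and y = ba, the trace property turns τ(akb) into τ(zyz). Its real part is half that
of z(y + y*)z, which is at most ‖y + y*‖k. -/
theorem IsPosTrace.re_mul_mul_le (hτ : IsPosTrace τ) {k : D} (hk : 0 ≤ k) (a b : D) :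
    (τ (a * k * b)).re ≤ ‖a‖ * ‖b‖ * (τ k).re := by
  set z := CFC.sqrt k
  have hz : IsSelfAdjoint z := .of_nonneg (CFC.sqrt_nonneg k)
  have hzz : z * z = k := CFC.sqrt_mul_sqrt_self k hk
  set y := b * a
  have e1 : τ (a * k * b) = τ (z * y * z) := by
    rw [← hzz, show a * (z * z) * b = (a * z) * (z * b) by simp only [mul_assoc], hτ.comm]
    simp only [y, mul_assoc]
  have e2 : (τ (z * star y * z)).re = (τ (z * y * z)).re := by
    rw [← hτ.re_star (z * y * z)]
    simp only [star_mul, hz.star_eq, mul_assoc]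
  have h1 : z * (y + star y) * z ≤ ‖y + star y‖ • (z * z) := by
    have := CStarAlgebra.star_left_conjugate_le_norm_smul (a := z)
      (IsSelfAdjoint.add_star_self y)
    rwa [hz.star_eq] at this
  have h2 := hτ.re_mono h1
  rw [hzz, mul_add, add_mul, map_add, Complex.add_re, e2, ← Complex.coe_smul, map_smul,
    smul_eq_mul, Complex.re_ofReal_mul] at h2
  have h3 : ‖y + star y‖ ≤ 2 * (‖a‖ * ‖b‖) := by
    calc _ ≤ ‖y‖ + ‖star y‖ := norm_add_le _ _
      _ = 2 * ‖y‖ := by rw [norm_star]; ring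
      _ ≤ 2 * (‖b‖ * ‖a‖) := by gcongr; exact norm_mul_le _ _
      _ = _ := by ring
  have h4 := mul_le_mul_of_nonneg_right h3 (hτ.re_nonneg hk)
  rw [e1]
  linarith

end

/-! ### Traces on finite-dimensional C*-algebras -/

section FiniteDimensional

variable {F : Type*} [NonUnitalCStarAlgebra F] [FiniteDimensional ℂ F]

/-- An eigenvector y satisfies (xy)*(xy) = μy*y, with positive elements on both sides and y*y ≠ 0.
-/
theorem eigenvalue_nonneg (x : F) {μ : ℂ}
    (h : Module.End.HasEigenvalue (LinearMap.mulLeft ℂ (star x * x)) μ) : 0 ≤ μ.re ∧ μ.im = 0 := by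
  let _ := CStarAlgebra.spectralOrder F
  let _ := CStarAlgebra.spectralOrderedRing F
  obtain ⟨y, hy, hy0⟩ := h.exists_hasEigenvector
  have h1 : star x * x * y = μ • y := Module.End.mem_eigenspace_iff.1 hy
  have h2 : star (x * y) * (x * y) = μ • (star y * y) := by
    rw [star_mul, show star y * star x * (x * y) = star y * (star x * x * y) by
      simp only [mul_assoc], h1, mul_smul_comm]
  have hyy : star y * y ≠ 0 := (CStarRing.star_mul_self_ne_zero_iff y).2 hy0
  have him : μ.im = 0 := by
    have h3 := congrArg star h2
    rw [(IsSelfAdjoint.star_mul_self (x * y)).star_eq, star_smul,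
      (IsSelfAdjoint.star_mul_self y).star_eq, h2] at h3
    have := smul_left_injective ℂ hyy h3
    exact (Complex.conj_eq_iff_im.1 this.symm)
  refine ⟨?_, him⟩
  by_contra hneg
  push Not at hneg
  have hμ : μ = (μ.re : ℂ) := Complex.ext rfl (by simp [him])
  have h4 : (0 : F) ≤ (-μ.re) • (star y * y) :=
    smul_nonneg (by linarith) (star_mul_self_nonneg y)
  have h5 := star_mul_self_nonneg (x * y)
  rw [h2, hμ, Complex.coe_smul] at h5
  rw [neg_smul, Left.nonneg_neg_iff] at h4
  have h6 := le_antisymm h4 h5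
  rcases smul_eq_zero.1 h6 with h7 | h7
  · linarith
  · exact hyy h7

/-- The functional is the trace of left multiplication on F, so no decomposition into matrix blocks
is needed. It is the sum of the eigenvalues; if it vanishes at x*x, all eigenvalues vanish, left
multiplication by x*x is nilpotent, and the C*-identity gives x = 0. -/
theorem exists_faithful_trace : ∃ T : F →ₗ[ℂ] ℂ, (∀ x y, T (x * y) = T (y * x)) ∧
    (∀ x, 0 ≤ (T (star x * x)).re ∧ (T (star x * x)).im = 0) ∧
    ∀ x, (T (star x * x)).re = 0 → x = 0 := by
  let T : F →ₗ[ℂ] ℂ := (LinearMap.trace ℂ F).comp (LinearMap.mul ℂ F)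
  have hT : ∀ x, T x = LinearMap.trace ℂ F (LinearMap.mulLeft ℂ x) := fun x => rfl
  have hroots : ∀ x : F, ∀ μ ∈ (LinearMap.mulLeft ℂ (star x * x)).charpoly.roots,
      0 ≤ μ.re ∧ μ.im = 0 := fun x μ hμ =>
    eigenvalue_nonneg x ((Module.End.hasEigenvalue_iff_isRoot_charpoly _ μ).2
      (Polynomial.isRoot_of_mem_roots hμ))
  have hsum : ∀ x : F, T (star x * x) = (LinearMap.mulLeft ℂ (star x * x)).charpoly.roots.sum :=
    fun x => Module.End.trace_eq_sum_roots_charpoly_of_splits (IsAlgClosed.splits _)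
  have hre : ∀ s : Multiset ℂ, s.sum.re = (s.map Complex.re).sum := fun s =>
    map_multiset_sum Complex.reAddGroupHom s
  have him : ∀ s : Multiset ℂ, s.sum.im = (s.map Complex.im).sum := fun s =>
    map_multiset_sum Complex.imAddGroupHom s
  refine ⟨T, fun x y => ?_, fun x => ⟨?_, ?_⟩, fun x hx => ?_⟩
  · rw [hT, hT, LinearMap.mulLeft_mul, LinearMap.mulLeft_mul]
    exact LinearMap.trace_mul_comm ℂ _ _
  · rw [hsum, hre]
    refine Multiset.sum_nonneg fun r hr => ?_
    obtain ⟨μ, hμ, rfl⟩ := Multiset.mem_map.1 hr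
    exact (hroots x μ hμ).1
  · rw [hsum, him]
    refine Multiset.sum_eq_zero fun r hr => ?_
    obtain ⟨μ, hμ, rfl⟩ := Multiset.mem_map.1 hr
    exact (hroots x μ hμ).2
  · set a := star x * x with ha
    have hsa : star a = a := (IsSelfAdjoint.star_mul_self x).star_eq
    rw [hsum, hre] at hx
    have hz : ∀ μ ∈ (LinearMap.mulLeft ℂ a).charpoly.roots, μ = 0 := by
      intro μ hμ
      have h0 := (Multiset.all_zero_of_le_zero_le_of_sum_eq_zero (s :=
        (LinearMap.mulLeft ℂ a).charpoly.roots.map Complex.re) (fun r hr => by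
          obtain ⟨μ, hμ, rfl⟩ := Multiset.mem_map.1 hr
          exact (hroots x μ hμ).1) hx) _ (Multiset.mem_map_of_mem Complex.re hμ)
      exact Complex.ext h0 (hroots x μ hμ).2
    have hnil : IsNilpotent (LinearMap.mulLeft ℂ a) := by
      rw [LinearMap.isNilpotent_iff_charpoly]
      have hs := (IsAlgClosed.splits (LinearMap.mulLeft ℂ a).charpoly)
      have h1 := hs.eq_prod_roots_of_monic (LinearMap.charpoly_monic _)
      have hcard : Multiset.card (LinearMap.mulLeft ℂ a).charpoly.roots = Module.finrank ℂ F := by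
        rw [← hs.natDegree_eq_card_roots, LinearMap.charpoly_natDegree]
      rw [Multiset.eq_replicate.2 ⟨hcard, hz⟩] at h1
      simpa using h1
    -- The C*-identity removes one power of the self-adjoint a, so nilpotency descends to a · a = 0.
    have hstep : ∀ y : F, a * (a * y) = 0 → a * y = 0 := by
      intro y hy
      have : star (a * y) * (a * y) = 0 := by
        rw [star_mul, hsa, mul_assoc, hy, mul_zero]
      exact (CStarRing.star_mul_self_eq_zero_iff _).1 this
    obtain ⟨n, hn⟩ := hnil
    have hall : ∀ k, ∀ y : F, (LinearMap.mulLeft ℂ a ^ k) y = 0 → a * y = 0 := by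
      intro k
      induction k with
      | zero => intro y hy; have : y = 0 := by simpa using hy
                rw [this, mul_zero]
      | succ k ih =>
        intro y hy
        refine hstep y (ih (a * y) ?_)
        rwa [pow_succ, Module.End.mul_apply] at hy
    have haa : star a * a = 0 := by
      rw [hsa]; exact hall n a (by rw [hn]; rfl)
    have ha0 : a = 0 := (CStarRing.star_mul_self_eq_zero_iff _).1 haa
    exact (CStarRing.star_mul_self_eq_zero_iff _).1 (ha ▸ ha0)

/-- On the compact unit sphere the trace of x*x attains a positive minimum; K is its inverse. -/
theorem exists_norm_sq_le_trace {T : F →ₗ[ℂ] ℂ} (h1 : ∀ x, 0 ≤ (T (star x * x)).re)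
    (h2 : ∀ x, (T (star x * x)).re = 0 → x = 0) :
    ∃ K : ℝ, 0 ≤ K ∧ ∀ x, ‖x‖ ^ 2 ≤ K * (T (star x * x)).re := by
  have : ProperSpace F := FiniteDimensional.proper ℂ F
  have hT : Continuous T := T.continuous_of_finiteDimensional
  rcases subsingleton_or_nontrivial F with hF | hF
  · exact ⟨0, le_rfl, fun x => by simp [Subsingleton.elim x 0]⟩
  have hc : IsCompact (Metric.sphere (0 : F) 1) := isCompact_sphere 0 1
  have hne : (Metric.sphere (0 : F) 1).Nonempty := by
    obtain ⟨x, hx⟩ := exists_ne (0 : F)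
    refine ⟨((‖x‖⁻¹ : ℝ) : ℂ) • x, ?_⟩
    rw [mem_sphere_zero_iff_norm, norm_smul, Complex.norm_real, norm_inv, norm_norm,
      inv_mul_cancel₀ (norm_ne_zero_iff.2 hx)]
  obtain ⟨y, hy, hmin⟩ := hc.exists_isMinOn hne
    (f := fun x => (T (star x * x)).re) (by fun_prop)
  have hy0 : y ≠ 0 := by
    rintro rfl; simp at hy
  have hpos : 0 < (T (star y * y)).re :=
    lt_of_le_of_ne (h1 y) fun h => hy0 (h2 y h.symm)
  refine ⟨(T (star y * y)).re⁻¹, by positivity, fun x => ?_⟩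
  rcases eq_or_ne x 0 with rfl | hx
  · simp
  have hxn : 0 < ‖x‖ := norm_pos_iff.2 hx
  have hmem : ((‖x‖⁻¹ : ℝ) : ℂ) • x ∈ Metric.sphere (0 : F) 1 := by
    rw [mem_sphere_zero_iff_norm, norm_smul, Complex.norm_real, norm_inv, norm_norm,
      inv_mul_cancel₀ hxn.ne']
  have h3 : (T (star y * y)).re ≤ ‖x‖⁻¹ * ‖x‖⁻¹ * (T (star x * x)).re := by
    have := hmin hmem
    simp only [Set.mem_ofPred_eq] at this
    refine this.trans (le_of_eq ?_)
    rw [star_smul, smul_mul_smul_comm, map_smul, smul_eq_mul, Complex.star_def, Complex.conj_ofReal,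
      ← Complex.ofReal_mul, Complex.re_ofReal_mul]
  rw [inv_mul_eq_div, le_div_iff₀ hpos]
  calc ‖x‖ ^ 2 * (T (star y * y)).re
      ≤ ‖x‖ ^ 2 * (‖x‖⁻¹ * ‖x‖⁻¹ * (T (star x * x)).re) := by gcongr
    _ = (T (star x * x)).re := by field_simp

end FiniteDimensional

/-! ### Subhomogeneous algebras -/

/-- Evaluation at a point, as a *-homomorphism. -/
def evalStarHom {X F : Type*} [TopologicalSpace X] [CompactSpace X] [NonUnitalCStarAlgebra F]
    (x : X) : C(X, F) →⋆ₙₐ[ℂ] F where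
  toFun f := f x
  map_smul' _ _ := rfl
  map_zero' := rfl
  map_add' _ _ := rfl
  map_mul' _ _ := rfl
  map_star' _ := rfl

/-! ### Closed two-sided ideals -/

section Ideal

variable {D : Type*} [NonUnitalCStarAlgebra D]

/-- The closure of a two-sided ideal. -/
def closureIdeal (I : TwoSidedIdeal D) : TwoSidedIdeal D :=
  TwoSidedIdeal.mk' (closure (I : Set D)) (subset_closure I.zero_mem)
    (fun hx hy => map_mem_closure₂ continuous_add hx hy fun _ ha _ hb => I.add_mem ha hb)
    (fun hx => map_mem_closure continuous_neg hx fun _ ha => I.neg_mem ha)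
    (fun {x _} hy => map_mem_closure (f := fun z => x * z) (continuous_const.mul continuous_id) hy
      fun _ ha => I.mul_mem_left x _ ha)
    (fun {_ y} hx => map_mem_closure (f := fun z => z * y) (continuous_id.mul continuous_const) hx
      fun _ ha => I.mul_mem_right _ y ha)

theorem coe_closureIdeal (I : TwoSidedIdeal D) :
    (closureIdeal I : Set D) = closure (I : Set D) := by
  simp [closureIdeal, TwoSidedIdeal.coe_mk']

theorem isClosed_closureIdeal (I : TwoSidedIdeal D) : IsClosed (closureIdeal I : Set D) := by
  rw [coe_closureIdeal]; exact isClosed_closure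

variable [PartialOrder D] [StarOrderedRing D]

/-- Two-sided ideals are only ring ideals here. Scalars come from c · x = lim x(c · v) along an
approximate unit. -/
theorem smul_mem_of_isClosed {I : TwoSidedIdeal D} (hI : IsClosed (I : Set D)) (c : ℂ) {x : D}
    (hx : x ∈ I) : c • x ∈ I := by
  have hu := CStarAlgebra.increasingApproximateUnit D
  have := hu.neBot
  have h1 : Filter.Tendsto (fun v => x * (c • v)) (CStarAlgebra.approximateUnit D)
      (nhds (c • x)) := by
    simpa only [mul_smul_comm] using (hu.tendsto_mul_left x).const_smul c
  exact hI.mem_of_tendsto h1 (.of_forall fun v => I.mul_mem_right _ _ hx)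

theorem cfcₙ_cubeCut_mem {I : TwoSidedIdeal D} {m : D} (hm : IsSelfAdjoint m) (hmI : m ∈ I) {ε : ℝ}
    (hε : 0 < ε) : cfcₙ (cubeCut ε) m ∈ I := by
  rw [cfcₙ_cubeCut_left hm hε]; exact I.mul_mem_right _ _ hmI

end Ideal

section Subhomogeneous

variable {D X F : Type*} [NonUnitalCStarAlgebra D] [PartialOrder D] [StarOrderedRing D]
  [TopologicalSpace X] [CompactSpace X] [NonUnitalCStarAlgebra F] [FiniteDimensional ℂ F]

/-- In each fibre ∑ zz* and ∑ z*z have the same trace, and for positive elements of F norm and trace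
are comparable. All fibres share the same F, so the constant is uniform in the point and in the
length of the sum. -/
theorem exists_norm_sum_mul_star_le (ι : D →⋆ₙₐ[ℂ] C(X, F)) (hι : Function.Injective ι) :
    ∃ N : ℝ, 0 ≤ N ∧ ∀ s : Multiset D,
      ‖(s.map fun z => z * star z).sum‖ ≤ N * ‖(s.map fun z => star z * z).sum‖ := by
  obtain ⟨T, hT, hT1, hT2⟩ := exists_faithful_trace (F := F)
  obtain ⟨K, hK0, hK⟩ := exists_norm_sq_le_trace (fun x => (hT1 x).1) hT2
  set C := ‖LinearMap.toContinuousLinearMap T‖ with hC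
  have hTC : ∀ y, ‖T y‖ ≤ C * ‖y‖ := fun y => (LinearMap.toContinuousLinearMap T).le_opNorm y
  refine ⟨K * C, by positivity, fun s => ?_⟩
  set w := (s.map fun z => z * star z).sum with hw
  set u := (s.map fun z => star z * z).sum with hu
  have hw0 : 0 ≤ w := Multiset.sum_nonneg fun y hy => by
    obtain ⟨z, -, rfl⟩ := Multiset.mem_map.1 hy
    exact mul_star_self_nonneg z
  rw [← NonUnitalStarAlgHom.norm_map ι hι, ContinuousMap.norm_le _ (by positivity)]
  intro x
  let π : D →⋆ₙₐ[ℂ] F := (evalStarHom x).comp ι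
  change ‖π w‖ ≤ _
  have hπu : ‖π u‖ ≤ ‖u‖ := by
    rw [← NonUnitalStarAlgHom.norm_map ι hι]; exact (ι u).norm_coe_le_norm x
  have htr : T (π w) = T (π u) := by
    rw [hw, hu, map_multiset_sum, map_multiset_sum, map_multiset_sum, map_multiset_sum]
    simp only [Multiset.map_map, Function.comp_def, map_mul, map_star]
    congr 2
    exact funext fun z => hT _ _
  obtain ⟨v, hv⟩ := CStarAlgebra.nonneg_iff_eq_star_mul_self.1 hw0
  have h1 : ‖π w‖ = ‖π v‖ ^ 2 := by
    rw [hv, map_mul π, map_star π, CStarRing.norm_star_mul_self, sq]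
  calc ‖π w‖ ≤ K * (T (star (π v) * π v)).re := h1 ▸ hK _
    _ = K * (T (π u)).re := by rw [← htr, hv, map_mul π, map_star π]
    _ ≤ K * (C * ‖u‖) := by
        gcongr
        calc _ ≤ ‖T (π u)‖ := Complex.re_le_norm _
          _ ≤ C * ‖π u‖ := hTC _
          _ ≤ C * ‖u‖ := by gcongr
    _ = _ := by ring

/-- If every value of every d were attained by I, compactness would give finitely many i in I such
that near each point one of them is close to d. A cut-off u of ∑ i*i lies in I and is almost a right
unit for each of these i, so du is close to d, and I is dense. -/
theorem exists_eval_notMem (ι : D →⋆ₙₐ[ℂ] C(X, F)) (hι : Function.Injective ι)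
    {I : TwoSidedIdeal D} (hI : IsClosed (I : Set D)) (hne : I ≠ ⊤) :
    ∃ (d : D) (x : X), ∀ i ∈ I, ι i x ≠ ι d x := by
  by_contra hcon
  push Not at hcon
  refine hne (eq_top_iff.2 fun d _ => ?_)
  change d ∈ (I : Set D)
  rw [← hI.closure_eq, Metric.mem_closure_iff]
  intro ε hε
  choose i hiI hi using hcon d
  set η := ε / 4 with hη
  have hη0 : 0 < η := by positivity
  have hU : ∀ x ∈ (Set.univ : Set X), {y | ‖ι (d - i x) y‖ < η} ∈ nhds x := by
    intro x _
    refine IsOpen.mem_nhds (isOpen_lt (by fun_prop) continuous_const) ?_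
    simp [map_sub, hi x, hη0]
  obtain ⟨t, -, ht⟩ := isCompact_univ.elim_nhds_subcover _ hU
  set m := ∑ x ∈ t, star (i x) * i x with hm
  have hm0 : 0 ≤ m := Finset.sum_nonneg fun x _ => star_mul_self_nonneg _
  have hmI : m ∈ I := I.finsetSum_mem _ _ fun x _ => I.mul_mem_left _ _ (hiI x)
  set u := cfcₙ (cubeCut (η ^ 2)) m with hu
  have hu1 : ‖u‖ ≤ 1 := norm_cubeCut_le hm0 (by positivity)
  refine ⟨d * u, I.mul_mem_left _ _ (cfcₙ_cubeCut_mem (.of_nonneg hm0) hmI (by positivity)), ?_⟩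
  rw [dist_eq_norm, ← NonUnitalStarAlgHom.norm_map ι hι]
  refine lt_of_le_of_lt (b := 3 * η) ?_ (by rw [hη]; linarith)
  rw [ContinuousMap.norm_le _ (by positivity)]
  intro y
  obtain ⟨x, hxt, hx⟩ := Set.mem_iUnion₂.1 (ht (Set.mem_univ y))
  have hx' : ‖ι (d - i x) y‖ < η := hx
  have h1 : ‖i x - i x * u‖ ≤ η := by
    have hle : star (i x) * i x ≤ m + 0 := by
      rw [add_zero]
      exact Finset.single_le_sum (f := fun x => star (i x) * i x)
        (fun x _ => star_mul_self_nonneg _) hxt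
    have := norm_sub_mul_cubeCut_sq hm0 hle (ε := η ^ 2) (by positivity)
    rw [norm_zero, add_zero] at this
    exact (pow_le_pow_iff_left₀ (norm_nonneg _) hη0.le two_ne_zero).1 this
  have e : ι (d - d * u) y = ι (d - i x) y - ι (d - i x) y * ι u y + ι (i x - i x * u) y := by
    simp only [map_sub, map_mul, ContinuousMap.sub_apply, ContinuousMap.mul_apply, sub_mul]; abel
  have h2 : ‖ι (i x - i x * u) y‖ ≤ η :=
    ((ι _).norm_coe_le_norm y).trans ((NonUnitalStarAlgHom.norm_map ι hι _).le.trans h1)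
  have h3 : ‖ι u y‖ ≤ 1 :=
    ((ι _).norm_coe_le_norm y).trans ((NonUnitalStarAlgHom.norm_map ι hι _).le.trans hu1)
  rw [e]
  calc _ ≤ ‖ι (d - i x) y‖ + ‖ι (d - i x) y‖ * ‖ι u y‖ + ‖ι (i x - i x * u) y‖ :=
        (norm_add_le _ _).trans (by
          gcongr
          exact (norm_sub_le _ _).trans (by gcongr; exact norm_mul_le _ _))
    _ ≤ η + η * 1 + η := by gcongr
    _ = 3 * η := by ring

/-- A finite-dimensional image of a closed ideal has a unit, which is central in the image of the
whole algebra. -/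
theorem exists_central_unit (π : D →⋆ₙₐ[ℂ] F) {I : TwoSidedIdeal D} (hI : IsClosed (I : Set D)) :
    ∃ p ∈ π '' (I : Set D), star p = p ∧ p * p = p ∧ (∀ i ∈ I, π i * p = π i) ∧
      ∀ y, π y * p = p * π y := by
  have : ProperSpace F := FiniteDimensional.proper ℂ F
  let Is : Submodule ℂ D :=
    { carrier := I
      add_mem' := fun h h' => I.add_mem h h'
      zero_mem' := I.zero_mem
      smul_mem' := fun c _ h => smul_mem_of_isClosed hI c h }
  let J : Submodule ℂ F := Is.map (π : D →ₗ[ℂ] F)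
  have hJ : ∀ y, y ∈ J ↔ ∃ i ∈ I, π i = y := fun y => Iff.rfl
  have hJc : IsClosed (J : Set F) := J.closed_of_finiteDimensional
  obtain ⟨S, hS⟩ := IsNoetherian.noetherian J
  have hSJ : ∀ y ∈ S, ∃ i ∈ I, π i = y := fun y hy =>
    (hJ y).1 (hS ▸ Submodule.subset_span hy)
  choose! i hiI hi using hSJ
  set m := ∑ y ∈ S, star (i y) * i y with hm
  have hm0 : 0 ≤ m := Finset.sum_nonneg fun x _ => star_mul_self_nonneg _
  have hmI : m ∈ I := I.finsetSum_mem _ _ fun y hy => I.mul_mem_left _ _ (hiI y hy)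
  -- The images of these cut-offs lie in a compact ball. A cluster point of them is a right unit for
  -- the generators, hence for all of J.
  set u : ℕ → D := fun n => cfcₙ (cubeCut (1 / ((n : ℝ) + 1))) m with hu
  have huI : ∀ n, u n ∈ I := fun n => cfcₙ_cubeCut_mem (.of_nonneg hm0) hmI (by positivity)
  have hun : ∀ n, π (u n) ∈ Metric.closedBall (0 : F) 1 := fun n => by
    rw [mem_closedBall_zero_iff]
    exact (NonUnitalStarAlgHom.norm_apply_le π _).trans (norm_cubeCut_le hm0 (by positivity))
  obtain ⟨p, -, φ, hφ, hp⟩ := (isCompact_closedBall (0 : F) 1).tendsto_subseq hun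
  have hpJ : p ∈ J := hJc.mem_of_tendsto hp (.of_forall fun n => (hJ _).2 ⟨_, huI _, rfl⟩)
  have hps : star p = p := by
    refine tendsto_nhds_unique (hp.star.congr fun n => ?_) hp
    have h := (cubeCut_nonneg_cfc hm0 (1 / ((φ n : ℝ) + 1)))
    change star (π (u (φ n))) = π (u (φ n))
    rw [← map_star, (IsSelfAdjoint.of_nonneg h).star_eq]
  have hright : ∀ y ∈ J, y * p = y := by
    intro y hy
    rw [← hS] at hy
    induction hy using Submodule.span_induction with
    | mem y hy =>
      have h1 : star (i y) * i y ≤ (1 : ℝ) • m := by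
        rw [one_smul]
        exact Finset.single_le_sum (f := fun x => star (i x) * i x)
          (fun x _ => star_mul_self_nonneg _) hy
      have h2 := (tendsto_mul_cubeCut hm0 h1).comp hφ.tendsto_atTop
      have h3 := ((map_continuous π).tendsto _).comp h2
      refine tendsto_nhds_unique (((hp.const_mul y)).congr fun n => ?_) (hi y hy ▸ h3)
      simp only [Function.comp_apply, map_mul, hi y hy, hu]
    | zero => simp
    | add a b _ _ ha hb => rw [add_mul, ha, hb]
    | smul c a _ ha => rw [smul_mul_assoc, ha]
  obtain ⟨i₀, hi₀I, hi₀⟩ := (hJ p).1 hpJ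
  have hleft : ∀ y ∈ J, p * y = y := by
    intro y hy
    obtain ⟨k, hk, rfl⟩ := (hJ y).1 hy
    -- J is not known to be self-adjoint. From π(k)p = π(k) the adjoint equals pπ(k)*, a product
    -- with a factor from J, hence in J.
    have h1 : star (π k) = π (i₀ * star k) := by
      conv_lhs => rw [← hright _ hy]
      rw [star_mul, hps, map_mul, map_star, hi₀]
    have h2 : star (π k) ∈ J := h1 ▸ (hJ _).2 ⟨_, I.mul_mem_right _ _ hi₀I, rfl⟩
    have h3 := congrArg star (hright _ h2)
    rwa [star_mul, star_star, hps] at h3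
  refine ⟨p, (hJ p).1 hpJ, hps, hright p hpJ, fun k hk => hright _ ((hJ _).2 ⟨k, hk, rfl⟩),
    fun y => ?_⟩
  have h1 : π y * p ∈ J := by
    rw [← hi₀, ← map_mul]; exact (hJ _).2 ⟨_, I.mul_mem_left _ _ hi₀I, rfl⟩
  have h2 : p * π y ∈ J := by
    rw [← hi₀, ← map_mul]; exact (hJ _).2 ⟨_, I.mul_mem_right _ _ hi₀I, rfl⟩
  rw [← hleft _ h1, ← mul_assoc, hright _ h2]

/-- A proper closed ideal of a subhomogeneous algebra is annihilated by a nonzero trace. -/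
theorem exists_trace_of_ideal (ι : D →⋆ₙₐ[ℂ] C(X, F)) (hι : Function.Injective ι)
    {I : TwoSidedIdeal D} (hI : IsClosed (I : Set D)) (hne : I ≠ ⊤) :
    ∃ τ : D →L[ℂ] ℂ, IsPosTrace τ ∧ τ ≠ 0 ∧ ∀ y ∈ I, τ y = 0 := by
  obtain ⟨d, x, hdx⟩ := exists_eval_notMem ι hι hI hne
  obtain ⟨T, hT, hT1, hT2⟩ := exists_faithful_trace (F := F)
  let π : D →⋆ₙₐ[ℂ] F := (evalStarHom x).comp ι
  obtain ⟨p, ⟨i₀, hi₀, hpi⟩, hps, hpp, hIp, hc⟩ := exists_central_unit π hI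
  have hTc : Continuous T := T.continuous_of_finiteDimensional
  have hπc : Continuous π := map_continuous π
  -- This is T((1 - p)π(·)): tracial because p is central, and zero on I because p is a unit there.
  -- If it vanished, faithfulness of T would give π(d) = π(d)p = π(di₀), a value attained by I.
  let τ : D →L[ℂ] ℂ :=
    { toFun := fun y => T (π y - π y * p)
      map_add' := fun y z => by rw [← map_add T, map_add π, add_mul]; congr 1; abel
      map_smul' := fun c y => by
        rw [map_smul π, smul_mul_assoc, ← smul_sub, map_smul T]; rfl
      cont := by fun_prop }
  have hτ : ∀ y, τ y = T (π y - π y * p) := fun _ => rfl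
  have hsq : ∀ y, τ (star y * y) = T (star (π y - π y * p) * (π y - π y * p)) := by
    intro y
    rw [hτ]
    congr 1
    have h1 := hc (star y * y)
    rw [map_mul π, map_star π] at h1
    have h2 : p * (star (π y) * π y) * p = star (π y) * π y * p := by
      rw [← h1, mul_assoc _ p p, hpp]
    simp only [map_mul, map_star, star_sub, star_mul, hps, mul_sub, sub_mul]
    simp only [← mul_assoc] at h1 h2 ⊢
    rw [h2, ← h1]; abel
  refine ⟨τ, .of_re_im (fun y => hsq y ▸ hT1 _) fun y z => ?_, fun h0 => ?_, fun y hy => ?_⟩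
  · rw [hτ, hτ, map_sub T, map_sub T, map_mul π, map_mul π, hT (π y) (π z), mul_assoc (π y), hc z,
      ← mul_assoc, hT (π y * p), ← mul_assoc]
  · have h1 := hsq d
    rw [h0] at h1
    have h2 : π d - π d * p = 0 := hT2 _ (by rw [← h1]; simp)
    refine hdx (d * i₀) (I.mul_mem_left _ _ hi₀) ?_
    change π (d * i₀) = π d
    rw [map_mul, hpi]
    exact (sub_eq_zero.1 h2).symm
  · rw [hτ, hIp y hy, sub_self, map_zero]

end Subhomogeneous

/-! ### Extension of traces from full hereditary subalgebras -/

/-- Weak* compactness of balls. The limit is taken along a filter finer than `l`, so convergence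
already known along `l` remains available. -/
theorem exists_weak_limit {E ι : Type*} [NormedAddCommGroup E] [NormedSpace ℂ E] (l : Filter ι)
    [l.NeBot] (τ : ι → E →L[ℂ] ℂ) {R : ℝ} (h : ∀ i, ‖τ i‖ ≤ R) :
    ∃ (τ₀ : E →L[ℂ] ℂ) (U : Filter ι), U.NeBot ∧ U ≤ l ∧
      ∀ x, Filter.Tendsto (fun i => τ i x) U (nhds (τ₀ x)) := by
  have hc := WeakDual.isCompact_closedBall (0 : StrongDual ℂ E) R
  obtain ⟨τ₀, -, hτ⟩ := hc.ultrafilter_le_nhds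
    ((Ultrafilter.of l).map fun i => StrongDual.toWeakDual (τ i)) (by
      rw [Filter.le_principal_iff, Ultrafilter.coe_map, Filter.mem_map]
      refine Filter.univ_mem' fun i => ?_
      change τ i ∈ Metric.closedBall 0 R
      rw [mem_closedBall_zero_iff]
      exact h i)
  refine ⟨WeakDual.toStrongDual τ₀, Ultrafilter.of l, inferInstance, Ultrafilter.of_le l,
    fun x => ?_⟩
  exact ((WeakDual.eval_continuous (𝕜 := ℂ) x).tendsto τ₀).comp hτ

section Reflect

variable {A B : Type*} [NonUnitalCStarAlgebra A] [PartialOrder A] [StarOrderedRing A]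
  [NonUnitalCStarAlgebra B] [PartialOrder B] [StarOrderedRing B]

/-- Here a⁻aa⁻ = -(a⁻)³ has a positive image, while (a⁻)³ also has a positive image. Injectivity
gives (a⁻)³ = 0, so a⁻ = 0. -/
theorem nonneg_of_map_nonneg (j : A →⋆ₙₐ[ℂ] B) (hj : Function.Injective j) {a : A}
    (h : 0 ≤ j a) : 0 ≤ a := by
  have ha : IsSelfAdjoint a := hj (by rw [map_star, (IsSelfAdjoint.of_nonneg h).star_eq])
  have hn : IsSelfAdjoint a⁻ := (CFC.negPart_nonneg a).isSelfAdjoint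
  rw [← CFC.negPart_eq_zero_iff a ha]
  have h1 : a⁻ * a * a⁻ = -(a⁻ * a⁻ * a⁻) := by
    have h := CFC.negPart_mul_posPart a
    have h' := CFC.posPart_sub_negPart a ha
    generalize a⁻ = m at h h' ⊢
    rw [← h', mul_sub, h, zero_sub, neg_mul]
  have h2 : 0 ≤ a⁻ * a⁻ * a⁻ := by
    simpa [hn.star_eq] using star_left_conjugate_nonneg (CFC.negPart_nonneg a) a⁻
  have h3 : j (a⁻ * a⁻ * a⁻) = 0 := by
    refine le_antisymm ?_ (map_nonneg j h2)
    have := star_left_conjugate_nonneg h (j a⁻)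
    rw [← map_star, hn.star_eq, ← map_mul, ← map_mul, h1, map_neg] at this
    exact neg_nonneg.1 this
  have h4 : a⁻ * a⁻ * a⁻ = 0 := hj (by rw [h3, map_zero])
  have h5 : star (a⁻ * a⁻) * (a⁻ * a⁻) = 0 := by
    rw [star_mul, hn.star_eq, ← mul_assoc, h4, zero_mul]
  have h6 : star a⁻ * a⁻ = 0 := by
    rw [hn.star_eq]; exact (CStarRing.star_mul_self_eq_zero_iff _).1 h5
  exact (CStarRing.star_mul_self_eq_zero_iff _).1 h6

end Reflect

section Extension

variable {D D₁ : Type*} [NonUnitalCStarAlgebra D] [PartialOrder D] [StarOrderedRing D]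
  [NonUnitalCStarAlgebra D₁] [PartialOrder D₁] [StarOrderedRing D₁]

/-- The ideal of elements dominated by finite sums of elements of `D* j(D₁) D`. -/
def dominatedIdeal (j : D₁ →⋆ₙₐ[ℂ] D) : TwoSidedIdeal D :=
  TwoSidedIdeal.mk'
    {y | ∃ S : Multiset D, (∀ z ∈ S, ∃ b c, z = j b * c) ∧
      star y * y ≤ (S.map fun z => star z * z).sum}
    ⟨0, by simp, by simp⟩
    (by
      rintro x y ⟨S, hS, hx⟩ ⟨T, hT, hy⟩
      -- Each family is taken twice to absorb the factor 2 in `star_mul_self_add_le`.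
      refine ⟨S + S + (T + T), fun z hz => ?_, (star_mul_self_add_le x y).trans ?_⟩
      · simp only [Multiset.mem_add, or_self] at hz
        exact hz.elim (hS z) (hT z)
      · simp only [two_smul, Multiset.map_add, Multiset.sum_add]
        exact add_le_add (add_le_add hx hx) (add_le_add hy hy))
    (by
      rintro x ⟨S, hS, hx⟩
      exact ⟨S, hS, by simpa using hx⟩)
    (by
      rintro x y ⟨S, hS, hy⟩
      refine ⟨S.map fun z => ‖x‖ • z, fun z hz => ?_, ?_⟩
      · obtain ⟨z', hz', rfl⟩ := Multiset.mem_map.1 hz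
        obtain ⟨b, c, rfl⟩ := hS z' hz'
        exact ⟨b, ‖x‖ • c, by rw [mul_smul_comm]⟩
      · have h1 : star (x * y) * (x * y) ≤ ‖x‖ ^ 2 • (star y * y) := by
          have := CStarAlgebra.star_left_conjugate_le_norm_smul (a := y)
            (IsSelfAdjoint.star_mul_self x)
          rw [CStarRing.norm_star_mul_self, ← sq] at this
          simpa only [star_mul, mul_assoc] using this
        refine h1.trans ((smul_le_smul_of_nonneg_left hy (by positivity)).trans (le_of_eq ?_))
        rw [Multiset.smul_sum, Multiset.map_map, Multiset.map_map]
        simp only [Function.comp_def, star_smul, star_trivial, smul_mul_smul_comm, sq])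
    (by
      rintro x y ⟨S, hS, hx⟩
      refine ⟨S.map fun z => z * y, fun z hz => ?_, ?_⟩
      · obtain ⟨z', hz', rfl⟩ := Multiset.mem_map.1 hz
        obtain ⟨b, c, rfl⟩ := hS z' hz'
        exact ⟨b, c * y, by rw [mul_assoc]⟩
      · have h1 := star_left_conjugate_le_conjugate hx y
        rw [← Multiset.sum_map_mul_left, ← Multiset.sum_map_mul_right] at h1
        rw [Multiset.map_map]
        simpa only [star_mul, mul_assoc, Function.comp_def] using h1)

theorem mem_dominatedIdeal {j : D₁ →⋆ₙₐ[ℂ] D} {y : D} : y ∈ dominatedIdeal j ↔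
    ∃ S : Multiset D, (∀ z ∈ S, ∃ b c, z = j b * c) ∧
      star y * y ≤ (S.map fun z => star z * z).sum := by
  change y ∈ (dominatedIdeal j : Set D) ↔ _
  simp [dominatedIdeal, TwoSidedIdeal.coe_mk']

/-- `D` has an approximate unit of elements `∑ z* z`, with `z` in `j(D₁) D`. -/
theorem exists_full_approx_unit (j : D₁ →⋆ₙₐ[ℂ] D)
    (hfull : ∀ I : TwoSidedIdeal D, IsClosed (I : Set D) → (∀ a, j a ∈ I) → I = ⊤)
    (G : Finset D) {ε : ℝ} (hε : 0 < ε) :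
    ∃ S : Multiset D, (∀ z ∈ S, ∃ b c, z = j b * c) ∧
      ‖(S.map fun z => star z * z).sum‖ ≤ 1 ∧
      ∀ x ∈ G, ‖x - x * (S.map fun z => star z * z).sum‖ < ε ∧
        ‖x - (S.map fun z => star z * z).sum * x‖ < ε := by
  classical
  have htop : closureIdeal (dominatedIdeal j) = ⊤ := by
    refine hfull _ (isClosed_closureIdeal _) fun a => ?_
    change j a ∈ (closureIdeal (dominatedIdeal j) : Set D)
    rw [coe_closureIdeal]
    have hu := CStarAlgebra.increasingApproximateUnit D₁
    have := hu.neBot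
    refine mem_closure_of_tendsto
      (((map_continuous j).tendsto _).comp (hu.tendsto_mul_left a)) (.of_forall fun u => ?_)
    refine mem_dominatedIdeal.2 ⟨{j a * j u}, ?_, ?_⟩
    · simp only [Multiset.mem_singleton, forall_eq]; exact ⟨a, j u, rfl⟩
    · simp
  have hd : ∀ x : D, x ∈ closure (dominatedIdeal j : Set D) := fun x => by
    rw [← coe_closureIdeal, htop]; trivial
  set η := ε / 4 with hη
  have hη0 : 0 < η := by positivity
  have hy : ∀ x : D, ∃ y, ‖x - y‖ < η ∧ ∃ S : Multiset D, (∀ z ∈ S, ∃ b c, z = j b * c) ∧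
      star y * y ≤ (S.map fun z => star z * z).sum := fun x => by
    obtain ⟨y, hy, hxy⟩ := Metric.mem_closure_iff.1 (hd x) η hη0
    exact ⟨y, by rwa [← dist_eq_norm], mem_dominatedIdeal.1 hy⟩
  choose y hxy S hS hyS using hy
  -- Only right multiplication is estimated; applied to x*, it gives the estimate for left
  -- multiplication.
  set G' := G ∪ G.image star with hG'
  set T : Multiset D := ∑ x ∈ G', S x with hT
  set m := (T.map fun z => star z * z).sum with hm
  have hSm : ∀ x, 0 ≤ ((S x).map fun z => star z * z).sum := fun x =>
    Multiset.sum_nonneg fun w hw => by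
      obtain ⟨z, -, rfl⟩ := Multiset.mem_map.1 hw
      exact star_mul_self_nonneg z
  have hm' : m = ∑ x ∈ G', ((S x).map fun z => star z * z).sum := by
    rw [hm, hT]
    induction G' using Finset.induction_on with
    | empty => simp
    | insert a s ha ih => rw [Finset.sum_insert ha, Finset.sum_insert ha, Multiset.map_add,
        Multiset.sum_add, ih]
  have hm0 : 0 ≤ m := hm' ▸ Finset.sum_nonneg fun x _ => hSm x
  have hmsa : IsSelfAdjoint m := .of_nonneg hm0
  set R := cfcₙ (rootCut (η ^ 2)) m with hR
  have hRs : star R = R := (cfcₙ_predicate _ m : IsSelfAdjoint R).star_eq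
  set u := cfcₙ (cubeCut (η ^ 2)) m with hu
  have hu1 : ‖u‖ ≤ 1 := norm_cubeCut_le hm0 (by positivity)
  have husa : star u = u := (IsSelfAdjoint.of_nonneg (cubeCut_nonneg_cfc hm0 _)).star_eq
  have huS : ((T.map fun z => z * R).map fun z => star z * z).sum = u := by
    rw [hu, cfcₙ_cubeCut hmsa (by positivity), ← hR, hm, ← Multiset.sum_map_mul_left,
      ← Multiset.sum_map_mul_right, Multiset.map_map]
    simp only [Function.comp_def, star_mul, hRs, mul_assoc]
  have key : ∀ x ∈ G', ‖x - x * u‖ < ε := by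
    intro x hx
    have h1 : star (y x) * y x ≤ m + 0 := by
      rw [add_zero, hm']
      exact (hyS x).trans (Finset.single_le_sum
        (f := fun x => ((S x).map fun z => star z * z).sum) (fun x _ => hSm x) hx)
    have h2 := norm_sub_mul_cubeCut_sq hm0 h1 (ε := η ^ 2) (by positivity)
    rw [norm_zero, add_zero] at h2
    have h3 := (pow_le_pow_iff_left₀ (norm_nonneg _) hη0.le two_ne_zero).1 h2
    have e : x - x * u = (x - y x) - (x - y x) * u + (y x - y x * u) := by
      rw [sub_mul]; abel
    calc ‖x - x * u‖ ≤ ‖x - y x‖ + ‖x - y x‖ * ‖u‖ + ‖y x - y x * u‖ := by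
          rw [e]
          refine (norm_add_le _ _).trans ?_
          gcongr
          exact (norm_sub_le _ _).trans (by gcongr; exact norm_mul_le _ _)
      _ ≤ η + η * 1 + η := by gcongr <;> exact (hxy x).le
      _ < ε := by rw [hη]; linarith
  refine ⟨T.map fun z => z * R, fun z hz => ?_, by rw [huS]; exact hu1, fun x hx => ?_⟩
  · obtain ⟨z', hz', rfl⟩ := Multiset.mem_map.1 hz
    obtain ⟨x, -, hx⟩ := Multiset.mem_sum.1 hz'
    obtain ⟨b, c, rfl⟩ := hS x z' hx
    exact ⟨b, c * R, by rw [mul_assoc]⟩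
  · rw [huS]
    refine ⟨key x (Finset.mem_union_left _ hx), ?_⟩
    have := key (star x) (Finset.mem_union_right _ (Finset.mem_image_of_mem _ hx))
    rwa [← norm_star, star_sub, star_mul, star_star, husa] at this

/-- The functional `x ↦ ∑ s(z x z*)`. -/
def sumConj (s : D →L[ℂ] ℂ) (S : Multiset D) : D →L[ℂ] ℂ :=
  (S.map fun z => s.comp ((ContinuousLinearMap.mul ℂ D z).comp
    ((ContinuousLinearMap.mul ℂ D).flip (star z)))).sum

theorem sumConj_apply (s : D →L[ℂ] ℂ) (S : Multiset D) (x : D) :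
    sumConj s S x = (S.map fun z => s (z * x * star z)).sum := by
  induction S using Multiset.induction_on with
  | empty => simp [sumConj]
  | cons a S ih =>
    rw [sumConj] at ih ⊢
    rw [Multiset.map_cons, Multiset.sum_cons, add_apply, ih,
      Multiset.map_cons, Multiset.sum_cons]
    simp [mul_assoc]

/-- For x = r² ≥ 0, ∑ zxz* = ∑ (zr)(zr)* is bounded by N‖∑ (zr)*(zr)‖ = N‖r(∑ z*z)r‖. The factor 4
comes from splitting a general x into four positive elements. -/
theorem norm_sumConj_le {N : ℝ} (hN : 0 ≤ N) (hBD : ∀ s : Multiset D,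
      ‖(s.map fun z => z * star z).sum‖ ≤ N * ‖(s.map fun z => star z * z).sum‖)
    (s : D →L[ℂ] ℂ) (S : Multiset D) (hS : ‖(S.map fun z => star z * z).sum‖ ≤ 1) :
    ‖sumConj s S‖ ≤ 4 * (‖s‖ * N) := by
  have hpos : ∀ x : D, 0 ≤ x → ‖sumConj s S x‖ ≤ ‖s‖ * N * ‖x‖ := by
    intro x hx
    set r := CFC.sqrt x
    have hr : star r = r := (CFC.sqrt_nonneg x).isSelfAdjoint.star_eq
    have hrr : r * r = x := CFC.sqrt_mul_sqrt_self x hx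
    have hrn : ‖r‖ * ‖r‖ = ‖x‖ := by
      rw [← CStarRing.norm_star_mul_self, hr, hrr]
    have h1 : sumConj s S x = s (((S.map fun z => z * r).map fun z => z * star z).sum) := by
      rw [sumConj_apply, map_multiset_sum, Multiset.map_map, Multiset.map_map]
      simp only [Function.comp_def, star_mul, hr, ← hrr, mul_assoc]
    have h2 : ((S.map fun z => z * r).map fun z => star z * z).sum =
        r * (S.map fun z => star z * z).sum * r := by
      rw [← Multiset.sum_map_mul_left, ← Multiset.sum_map_mul_right, Multiset.map_map]
      simp only [Function.comp_def, star_mul, hr, mul_assoc]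
    rw [h1]
    calc _ ≤ ‖s‖ * ‖((S.map fun z => z * r).map fun z => z * star z).sum‖ := s.le_opNorm _
      _ ≤ ‖s‖ * (N * (‖r‖ * 1 * ‖r‖)) := by
          gcongr
          refine (hBD _).trans ?_
          rw [h2]
          gcongr
          refine (norm_mul_le _ _).trans ?_
          gcongr
          exact (norm_mul_le _ _).trans (by gcongr)
      _ = _ := by rw [mul_one, hrn, mul_assoc]
  refine ContinuousLinearMap.opNorm_le_bound _ (by positivity) fun x => ?_
  obtain ⟨y, hy0, hyn, hy⟩ := CStarAlgebra.exists_sum_four_nonneg x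
  conv_lhs => rw [hy, map_sum]
  calc _ ≤ ∑ i : Fin 4, ‖s‖ * N * ‖x‖ := by
        refine norm_sum_le_of_le _ fun i _ => ?_
        rw [map_smul, norm_smul, norm_pow, Complex.norm_I, one_pow, one_mul]
        exact (hpos _ (hy0 i)).trans (by gcongr; exact hyn i)
    _ = _ := by simp; ring

open scoped ComplexOrder in
/-- A positive trace on a full hereditary subalgebra extends to the whole algebra, if finite sums
`∑ z z*` are controlled by `∑ z* z`. -/
theorem IsPosTrace.exists_extension {N : ℝ} (hN : 0 ≤ N) (hBD : ∀ s : Multiset D,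
      ‖(s.map fun z => z * star z).sum‖ ≤ N * ‖(s.map fun z => star z * z).sum‖)
    (j : D₁ →⋆ₙₐ[ℂ] D) (hj : Function.Injective j)
    (hher : ∀ a b x, ∃ c, j c = j a * x * j b)
    (hfull : ∀ I : TwoSidedIdeal D, IsClosed (I : Set D) → (∀ a, j a ∈ I) → I = ⊤)
    {t : D₁ →L[ℂ] ℂ} (ht : IsPosTrace t) :
    ∃ τ : D →L[ℂ] ℂ, IsPosTrace τ ∧ ∀ a, τ (j a) = t a := by
  classical
  let jl : D₁ →ₗᵢ[ℂ] D := ⟨(j : D₁ →ₗ[ℂ] D), fun x => NonUnitalStarAlgHom.norm_map j hj x⟩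
  -- A Hahn-Banach extension, which need be neither positive nor tracial. The functionals x ↦ ∑
  -- s(zxz*) evaluate s only inside j(D₁), where it is the trace t.
  obtain ⟨s, hs, -⟩ := exists_extension_norm_eq (LinearMap.range jl.toLinearMap)
    (t.comp (jl.equivRange.symm.toContinuousLinearEquiv :
      LinearMap.range jl.toLinearMap →L[ℂ] D₁))
  have hst : ∀ a, s (j a) = t a := fun a => by
    have := hs (jl.equivRange a)
    simp only [ContinuousLinearMap.comp_apply] at this
    exact this.trans (congrArg t (jl.equivRange.symm_apply_apply a))
  clear hs
  choose! S hSZ hS1 hS using fun (p : Finset D × ℕ) => exists_full_approx_unit j hfull p.1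
    (ε := 1 / ((p.2 : ℝ) + 1)) (by positivity)
  set u : Finset D × ℕ → D := fun p => ((S p).map fun z => star z * z).sum with hu
  have hlim : ∀ x, ∀ η > 0, ∀ᶠ p in Filter.atTop, ‖x - x * u p‖ < η ∧ ‖x - u p * x‖ < η := by
    intro x η hη
    obtain ⟨n, hn⟩ := exists_nat_one_div_lt hη
    filter_upwards [Filter.eventually_ge_atTop (({x} : Finset D), n)] with p hp
    have h1 : x ∈ p.1 := hp.1 (Finset.mem_singleton_self x)
    have h2 : 1 / ((p.2 : ℝ) + 1) < η :=
      (one_div_le_one_div_of_le (by positivity) (by gcongr; exact hp.2)).trans_lt hn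
    exact ⟨(hS p x h1).1.trans h2, (hS p x h1).2.trans h2⟩
  have hlr : ∀ x, Filter.Tendsto (fun p => x * u p) Filter.atTop (nhds x) := fun x =>
    Metric.tendsto_nhds.2 fun η hη => (hlim x η hη).mono fun p hp => by
      rw [dist_comm, dist_eq_norm]; exact hp.1
  have hbd : ∀ p, ‖sumConj s (S p)‖ ≤ 4 * (‖s‖ * N) := fun p => norm_sumConj_le hN hBD s _ (hS1 p)
  have hmove : ∀ p, ∀ z ∈ S p, ∀ x, ∀ z' ∈ S p, ∃ e, j e = z * x * star z' := by
    intro p z hz x z' hz'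
    obtain ⟨b, c, rfl⟩ := hSZ p z hz
    obtain ⟨b', c', rfl⟩ := hSZ p z' hz'
    obtain ⟨e, he⟩ := hher b (star b') (c * x * star c')
    exact ⟨e, by rw [he, star_mul, map_star]; simp only [mul_assoc]⟩
  -- Expanding u = ∑ z'*z' gives terms s(zxz'* · z'yz*) whose two factors lie in j(D₁), so they may
  -- be exchanged. In the limit u disappears and τ is a trace.
  have hcomm : ∀ p x y, sumConj s (S p) (x * u p * y) = sumConj s (S p) (y * u p * x) := by
    intro p x y
    have expand : ∀ x y, sumConj s (S p) (x * u p * y) =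
        ((S p).map fun z => ((S p).map fun z' => s (z * x * star z' * (z' * y * star z))).sum).sum := by
      intro x y
      rw [sumConj_apply]
      refine congrArg _ (Multiset.map_congr rfl fun z _ => ?_)
      have : z * (x * u p * y) * star z =
          ((S p).map fun z' => z * x * star z' * (z' * y * star z)).sum := by
        rw [hu]
        dsimp only
        rw [← Multiset.sum_map_mul_left, ← Multiset.sum_map_mul_right, ← Multiset.sum_map_mul_left,
          ← Multiset.sum_map_mul_right]
        simp only [mul_assoc]
      rw [this, map_multiset_sum, Multiset.map_map]
      rfl
    rw [expand, expand, Multiset.sum_map_sum_map]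
    refine congrArg _ (Multiset.map_congr rfl fun z hz => congrArg _
      (Multiset.map_congr rfl fun z' hz' => ?_))
    obtain ⟨e, he⟩ := hmove p z' hz' x z hz
    obtain ⟨e', he'⟩ := hmove p z hz y z' hz'
    rw [← he, ← he', ← map_mul, ← map_mul, hst, hst, ht.comm]
  have hext : ∀ p a a', sumConj s (S p) (j a * j a') = s (j a' * u p * j a) := by
    intro p a a'
    have h1 : s (j a' * u p * j a) = ((S p).map fun z => s (j a' * star z * (z * j a))).sum := by
      rw [hu]
      dsimp only
      rw [← Multiset.sum_map_mul_left, ← Multiset.sum_map_mul_right, map_multiset_sum,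
        Multiset.map_map]
      simp only [Function.comp_def, mul_assoc]
    rw [h1, sumConj_apply]
    refine congrArg _ (Multiset.map_congr rfl fun z hz => ?_)
    obtain ⟨b, c, rfl⟩ := hSZ p z hz
    obtain ⟨e, he⟩ := hher b a c
    obtain ⟨e', he'⟩ := hher a' (star b) (star c)
    have h2 : j a' * star (j b * c) = j e' := by
      rw [he', star_mul, map_star]; simp only [mul_assoc]
    rw [h2, show j b * c * (j a * j a') * star (j b * c) = (j b * c * j a) * (j a' * star (j b * c))
      by simp only [mul_assoc], h2, ← he, ← map_mul, ← map_mul, hst, hst, ht.comm]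
  obtain ⟨τ, U, hU, hUl, hτ⟩ := exists_weak_limit
    (Filter.atTop : Filter (Finset D × ℕ)) (fun p => sumConj s (S p)) hbd
  refine ⟨τ, ⟨fun x => ?_, fun x y => ?_⟩, fun a => ?_⟩
  · refine isClosed_Ici.mem_of_tendsto (hτ (star x * x)) (.of_forall fun p => ?_)
    change 0 ≤ sumConj s (S p) (star x * x)
    rw [sumConj_apply]
    refine Multiset.sum_nonneg fun w hw => ?_
    obtain ⟨z, hz, rfl⟩ := Multiset.mem_map.1 hw
    obtain ⟨e, he⟩ := hmove p z hz (star x * x) z hz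
    have h1 : 0 ≤ j e := by
      rw [he]; exact star_right_conjugate_nonneg (star_mul_self_nonneg x) z
    obtain ⟨f, rfl⟩ := CStarAlgebra.nonneg_iff_eq_star_mul_self.1 (nonneg_of_map_nonneg j hj h1)
    rw [← he, hst]
    exact ht.nonneg f
  · have hxy : ∀ x y, Filter.Tendsto (fun p => sumConj s (S p) (x * u p * y)) U
        (nhds (τ (x * y))) := by
      intro x y
      have h1 : Filter.Tendsto (fun p => 4 * (‖s‖ * N) * ‖x * u p * y - x * y‖) U (nhds 0) := by
        have h2 : Filter.Tendsto (fun p => x * u p * y - x * y) U (nhds 0) := by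
          simpa using (((hlr x).mul_const y).sub_const (x * y)).mono_left hUl
        simpa using h2.norm.const_mul (4 * (‖s‖ * N))
      have h3 : Filter.Tendsto (fun p => sumConj s (S p) (x * u p * y - x * y)) U (nhds 0) :=
        squeeze_zero_norm (fun p => (ContinuousLinearMap.le_opNorm _ _).trans
          (by gcongr; exact hbd p)) h1
      simpa [map_sub] using h3.add (hτ (x * y))
    exact tendsto_nhds_unique (hxy x y) ((hxy y x).congr fun p => hcomm p y x)
  -- Agreement with t is first obtained on products, where the same exchange brings u between the
  -- two factors. Approximate units reduce the general case to this one.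
  · have hprod : ∀ a a', τ (j (a * a')) = t (a * a') := by
      intro a a'
      have h1 : Filter.Tendsto (fun p => s (j a' * u p * j a)) U (nhds (s (j a' * j a))) :=
        (s.continuous.tendsto _).comp (((hlr _).mul_const _).mono_left hUl)
      rw [← map_mul, hst, ht.comm] at h1
      refine tendsto_nhds_unique (hτ _) (h1.congr fun p => ?_)
      rw [map_mul j, hext]
    have hv := CStarAlgebra.increasingApproximateUnit D₁
    have := hv.neBot
    refine tendsto_nhds_unique (((τ.continuous.comp (map_continuous j)).tendsto _).comp
      (hv.tendsto_mul_left a)) (((t.continuous.tendsto _).comp (hv.tendsto_mul_left a)).congr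
        fun v => (hprod a v).symm)

end Extension

/-! ### Hereditary embeddings -/

/-- Injective *-homomorphisms with hereditary range. -/
structure IsHereditaryHom {D₁ D : Type*} [NonUnitalCStarAlgebra D₁] [NonUnitalCStarAlgebra D]
    (j : D₁ →⋆ₙₐ[ℂ] D) : Prop where
  injective : Function.Injective j
  exists_eq : ∀ a b x, ∃ c, j c = j a * x * j b

/-- The range of `j` is contained in no proper closed ideal. -/
def IsFullHom {D₁ D : Type*} [NonUnitalCStarAlgebra D₁] [NonUnitalCStarAlgebra D]
    (j : D₁ →⋆ₙₐ[ℂ] D) : Prop :=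
  ∀ I : TwoSidedIdeal D, IsClosed (I : Set D) → (∀ a, j a ∈ I) → I = ⊤

/-- The class of algebras embedding into `C([0,1], F)` for a finite-dimensional `F`. -/
def IsSubhomogeneous (D : Type*) [NonUnitalCStarAlgebra D] : Prop :=
  ∃ (F : Type) (_ : NonUnitalCStarAlgebra F) (_ : FiniteDimensional ℂ F)
    (ι : D →⋆ₙₐ[ℂ] C(unitInterval, F)), Function.Injective ι

section HereditaryHom

variable {D₁ D C : Type*} [NonUnitalCStarAlgebra D₁] [NonUnitalCStarAlgebra D]
  [NonUnitalCStarAlgebra C]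

theorem isClosed_range_of_injective {j : D₁ →⋆ₙₐ[ℂ] D} (hj : Function.Injective j) :
    IsClosed (Set.range j) :=
  (NonUnitalStarAlgHom.isometry j hj).isClosedEmbedding.isClosed_range

theorem injective_comp {k : D →⋆ₙₐ[ℂ] C} {j : D₁ →⋆ₙₐ[ℂ] D} (hk : Function.Injective k)
    (hj : Function.Injective j) : Function.Injective (k.comp j) := fun _ _ h => hj (hk h)

/-- Insert an approximate unit u of D₁ next to a and b: j(u)xj(u) comes from D, and multiplying it
by a and b brings it into D₁. The range is closed. -/
theorem IsHereditaryHom.comp {k : D →⋆ₙₐ[ℂ] C} {j : D₁ →⋆ₙₐ[ℂ] D} (hk : IsHereditaryHom k)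
    (hj : IsHereditaryHom j) : IsHereditaryHom (k.comp j) := by
  refine ⟨injective_comp hk.injective hj.injective, fun a b x => ?_⟩
  let _ := CStarAlgebra.spectralOrder D₁
  let _ := CStarAlgebra.spectralOrderedRing D₁
  have hu := CStarAlgebra.increasingApproximateUnit D₁
  have := hu.neBot
  have hkj : Continuous (k.comp j) := map_continuous _
  have h1 : Filter.Tendsto (fun u => k.comp j (a * u) * x * k.comp j (u * b))
      (CStarAlgebra.approximateUnit D₁) (nhds (k.comp j a * x * k.comp j b)) :=
    (((hkj.tendsto _).comp (hu.tendsto_mul_left a)).mul_const x).mul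
      ((hkj.tendsto _).comp (hu.tendsto_mul_right b))
  refine (isClosed_range_of_injective (injective_comp hk.injective hj.injective)).mem_of_tendsto h1
    (.of_forall fun u => ?_)
  obtain ⟨y, hy⟩ := hk.exists_eq (j u) (j u) x
  obtain ⟨c, hc⟩ := hj.exists_eq a b y
  refine ⟨c, ?_⟩
  change k (j c) = k (j (a * u)) * x * k (j (u * b))
  rw [hc, map_mul, map_mul, hy, map_mul j, map_mul j, map_mul k, map_mul k]
  simp only [mul_assoc]

theorem IsFullHom.comp {k : D →⋆ₙₐ[ℂ] C} {j : D₁ →⋆ₙₐ[ℂ] D} (hk : IsFullHom k)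
    (hj : IsFullHom j) : IsFullHom (k.comp j) := by
  intro I hI h
  refine hk I hI fun a => ?_
  have h1 : TwoSidedIdeal.comap k I = ⊤ := by
    refine hj _ ?_ fun a => TwoSidedIdeal.mem_comap k |>.2 (h a)
    have : ((TwoSidedIdeal.comap k I : TwoSidedIdeal D) : Set D) = k ⁻¹' (I : Set C) := by
      ext; simp [TwoSidedIdeal.mem_comap]
    rw [this]
    exact hI.preimage (map_continuous k)
  have h2 : a ∈ TwoSidedIdeal.comap k I := h1 ▸ trivial
  exact (TwoSidedIdeal.mem_comap k).1 h2

theorem isHereditaryHom_equiv (e : D₁ ≃⋆ₐ[ℂ] D) : IsHereditaryHom (e : D₁ →⋆ₙₐ[ℂ] D) :=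
  ⟨e.injective, fun a b x => (e.surjective (e a * x * e b))⟩

theorem isFullHom_equiv (e : D₁ ≃⋆ₐ[ℂ] D) : IsFullHom (e : D₁ →⋆ₙₐ[ℂ] D) := by
  intro I _ h
  refine eq_top_iff.2 fun x _ => ?_
  obtain ⟨a, rfl⟩ := e.surjective x
  exact h a

section
attribute [local instance] CStarAlgebra.spectralOrder CStarAlgebra.spectralOrderedRing

theorem IsHereditary.isHereditaryHom {B : NonUnitalStarSubalgebra ℂ C} [IsClosed (B : Set C)]
    (hB : IsHereditary B) : IsHereditaryHom (NonUnitalStarSubalgebraClass.subtype B) :=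
  ⟨Subtype.val_injective, fun a b x => ⟨⟨_, hB.mul_mul_mem a.2 b.2 x⟩, rfl⟩⟩

/-- If 0 ≤ a ≤ j(b), then a is the limit of pap over cut-offs p of j(b). Each p is j(b) times
another element, on either side, so pap lies in the range. -/
theorem IsHereditaryHom.isHereditary_range {j : D →⋆ₙₐ[ℂ] C} (hj : IsHereditaryHom j) :
    IsHereditary (NonUnitalStarAlgHom.range j) := by
  have hc := isClosed_range_of_injective hj.injective
  refine ⟨by simpa using hc, ?_⟩
  rintro a _ ⟨b, rfl⟩ ha hab
  have hb0 : 0 ≤ j b := ha.trans hab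
  set s := CFC.sqrt a
  have hs : star s = s := (CFC.sqrt_nonneg a).isSelfAdjoint.star_eq
  have hss : s * s = a := CFC.sqrt_mul_sqrt_self a ha
  have h1 : Filter.Tendsto (fun n : ℕ => s * cfcₙ (cubeCut (1 / (n + 1))) (j b)) Filter.atTop
      (nhds s) := tendsto_mul_cubeCut hb0 (K := 1) (by rw [hs, hss, one_smul]; exact hab)
  have h2 := h1.star.mul h1
  rw [hs, hss] at h2
  refine hc.mem_of_tendsto h2 (.of_forall fun n => ?_)
  have hp := cubeCut_nonneg_cfc hb0 (1 / ((n : ℝ) + 1))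
  have hp1 := cfcₙ_cubeCut_left (.of_nonneg hb0) (ε := 1 / ((n : ℝ) + 1)) (m := j b)
    (by positivity)
  set p := cfcₙ (cubeCut (1 / ((n : ℝ) + 1))) (j b)
  set q := cfcₙ (fun t => rootCut (1 / ((n : ℝ) + 1)) t ^ 2) (j b)
  have hp2 : p = star q * j b := by
    rw [← (IsSelfAdjoint.of_nonneg hp).star_eq, hp1, star_mul, (IsSelfAdjoint.of_nonneg hb0).star_eq]
  obtain ⟨c, hc⟩ := hj.exists_eq b b (q * a * star q)
  refine ⟨c, ?_⟩
  rw [hc, star_mul, hs, (IsSelfAdjoint.of_nonneg hp).star_eq]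
  calc _ = (j b * q) * a * (star q * j b) := by simp only [mul_assoc]
    _ = _ := by rw [← hp1, ← hp2, ← hss]; simp only [mul_assoc]

end

end HereditaryHom

/-- The pair (f, g) becomes t ↦ (f(t), g). The constant coordinate g must be kept, since the
endpoint maps need not be injective. -/
theorem InC.isSubhomogeneous {C : Type} [NonUnitalCStarAlgebra C] (h : InC C) :
    IsSubhomogeneous C := by
  obtain ⟨F₁, F₂, _, _, _, _, φ₀, φ₁, ⟨e⟩⟩ := h
  let κ : mappingTorus φ₀ φ₁ →⋆ₙₐ[ℂ] C(unitInterval, F₂ × F₁) :=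
    { toFun := fun x => x.1.1.prodMk (.const _ x.1.2)
      map_smul' := fun _ _ => rfl
      map_zero' := rfl
      map_add' := fun _ _ => rfl
      map_mul' := fun _ _ => rfl
      map_star' := fun _ => rfl }
  refine ⟨F₂ × F₁, inferInstance, inferInstance, κ.comp (e : C →⋆ₙₐ[ℂ] mappingTorus φ₀ φ₁),
    injective_comp (fun x y hxy => ?_) e.injective⟩
  have h1 : ∀ t, (x.1.1 t, x.1.2) = (y.1.1 t, y.1.2) := fun t => congrArg (· t) hxy
  exact Subtype.ext (Prod.ext (ContinuousMap.ext fun t => (Prod.ext_iff.1 (h1 t)).1)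
    (Prod.ext_iff.1 (h1 0)).2)

section Class

variable {𝒮 : (C : Type) → [NonUnitalCStarAlgebra C] → Prop} {D₁ D : Type*}
  [NonUnitalCStarAlgebra D₁] [NonUnitalCStarAlgebra D]

theorem IsFullHereditaryIn.exists_hom (h : IsFullHereditaryIn 𝒮 D) :
    ∃ (C : Type) (_ : NonUnitalCStarAlgebra C) (k : D →⋆ₙₐ[ℂ] C), 𝒮 C ∧ IsHereditaryHom k ∧
      IsFullHom k := by
  obtain ⟨C, _, H, hC, hH, hf, ⟨e⟩⟩ := h
  have := hH.isClosed
  refine ⟨C, inferInstance, (NonUnitalStarSubalgebraClass.subtype H).comp (e : D →⋆ₙₐ[ℂ] H), hC,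
    hH.isHereditaryHom.comp (isHereditaryHom_equiv e), IsFullHom.comp ?_ (isFullHom_equiv e)⟩
  exact fun I hI h => hf I hI fun x hx => h ⟨x, hx⟩

theorem IsFullHereditaryIn.of_hom {C : Type} [NonUnitalCStarAlgebra C] (hC : 𝒮 C)
    {k : D →⋆ₙₐ[ℂ] C} (hk : IsHereditaryHom k) (hk' : IsFullHom k) : IsFullHereditaryIn 𝒮 D := by
  refine ⟨C, inferInstance, NonUnitalStarAlgHom.range k, hC, hk.isHereditary_range, ?_,
    ⟨StarAlgEquiv.ofInjective' k hk.injective⟩⟩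
  exact fun I hI h => hk' I hI fun a => h ⟨a, rfl⟩

theorem IsFullHereditaryIn.comp (h : IsFullHereditaryIn 𝒮 D) {j : D₁ →⋆ₙₐ[ℂ] D}
    (hj : IsHereditaryHom j) (hj' : IsFullHom j) : IsFullHereditaryIn 𝒮 D₁ := by
  obtain ⟨C, _, k, hC, hk, hk'⟩ := h.exists_hom
  exact .of_hom hC (hk.comp hj) (hk'.comp hj')

theorem IsFullHereditaryIn.isSubhomogeneous
    (h𝒮 : ∀ (C : Type) [NonUnitalCStarAlgebra C], 𝒮 C → InC C) (h : IsFullHereditaryIn 𝒮 D) :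
    IsSubhomogeneous D := by
  obtain ⟨C, _, k, hC, hk, -⟩ := h.exists_hom
  obtain ⟨F, _, _, ι, hι⟩ := (h𝒮 C hC).isSubhomogeneous
  exact ⟨F, inferInstance, inferInstance, ι.comp k, injective_comp hι hk.injective⟩

end Class

theorem IsSubhomogeneous.exists_trace {D : Type*} [NonUnitalCStarAlgebra D]
    (h : IsSubhomogeneous D) {I : TwoSidedIdeal D} (hI : IsClosed (I : Set D)) (hne : I ≠ ⊤) :
    ∃ τ : D →L[ℂ] ℂ, IsPosTrace τ ∧ τ ≠ 0 ∧ ∀ y ∈ I, τ y = 0 := by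
  obtain ⟨F, _, _, ι, hι⟩ := h
  let _ := CStarAlgebra.spectralOrder D
  let _ := CStarAlgebra.spectralOrderedRing D
  exact exists_trace_of_ideal ι hι hI hne

theorem IsSubhomogeneous.nonempty_tracialStates {D : Type*} [NonUnitalCStarAlgebra D]
    [Nontrivial D] (h : IsSubhomogeneous D) : (tracialStates D).Nonempty := by
  have hb : ((⊥ : TwoSidedIdeal D) : Set D) = {0} := by ext; simp
  obtain ⟨x, hx⟩ := exists_ne (0 : D)
  obtain ⟨τ, hτ, h0, -⟩ := h.exists_trace (I := ⊥) (by rw [hb]; exact isClosed_singleton)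
    fun h => hx ((TwoSidedIdeal.mem_bot D).1 (h ▸ trivial))
  obtain ⟨t, ht, -⟩ := hτ.exists_tracialState h0
  exact ⟨t, ht⟩

theorem IsPosTrace.exists_extension_of_isSubhomogeneous {D₁ D : Type*} [NonUnitalCStarAlgebra D₁]
    [NonUnitalCStarAlgebra D] (h : IsSubhomogeneous D) {j : D₁ →⋆ₙₐ[ℂ] D} (hj : IsHereditaryHom j)
    (hj' : IsFullHom j) {t : D₁ →L[ℂ] ℂ} (ht : IsPosTrace t) :
    ∃ τ : D →L[ℂ] ℂ, IsPosTrace τ ∧ ∀ a, τ (j a) = t a := by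
  obtain ⟨F, _, _, ι, hι⟩ := h
  let _ := CStarAlgebra.spectralOrder D
  let _ := CStarAlgebra.spectralOrderedRing D
  let _ := CStarAlgebra.spectralOrder D₁
  let _ := CStarAlgebra.spectralOrderedRing D₁
  obtain ⟨N, hN, hBD⟩ := exists_norm_sum_mul_star_le ι hι
  exact ht.exists_extension hN hBD j hj.injective hj.exists_eq hj'

/-! ### Compressions of completely positive maps -/

section CompletelyPositive

variable {A A₁ A₂ B S : Type*} [NonUnitalCStarAlgebra A] [PartialOrder A] [StarOrderedRing A]
  [NonUnitalCStarAlgebra A₁] [PartialOrder A₁] [StarOrderedRing A₁]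
  [NonUnitalCStarAlgebra A₂] [PartialOrder A₂] [StarOrderedRing A₂]
  [NonUnitalCStarAlgebra B] [PartialOrder B] [StarOrderedRing B]
  [NonUnitalCStarAlgebra S] [PartialOrder S] [StarOrderedRing S]

theorem exists_eq_star_mul_self {a : A} (ha : 0 ≤ a) : ∃ b, a = star b * b :=
  CStarAlgebra.nonneg_iff_eq_star_mul_self.1 ha

theorem CStarMatrix.map_conj_nonneg {k : ℕ} {M : CStarMatrix (Fin k) (Fin k) A} (hM : 0 ≤ M)
    (w : A) : 0 ≤ M.map fun x => w * x * star w := by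
  obtain ⟨N, rfl⟩ := exists_eq_star_mul_self hM
  convert star_mul_self_nonneg (N.map fun x => x * star w) using 1
  ext i j
  simp only [CStarMatrix.map_apply, CStarMatrix.mul_apply, CStarMatrix.star_apply, star_mul,
    star_star, Finset.mul_sum, Finset.sum_mul, mul_assoc]

/-- If the compression `w χ(·) w*` of a completely positive map takes values in the image of an
injective *-homomorphism `π`, then it lifts along `π` to a completely positive map. -/
theorem exists_completelyPositive_lift (ι : B →⋆ₙₐ[ℂ] A₁) (χ : A₁ →CP A₂) (κ : A₂ →⋆ₙₐ[ℂ] A)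
    (w : A) (π : S →⋆ₙₐ[ℂ] A) (hπ : Function.Injective π)
    (h : ∀ b, ∃ s, π s = w * κ (χ (ι b)) * star w) :
    ∃ φ : B →CP S, ∀ b, π (φ b) = w * κ (χ (ι b)) * star w := by
  choose f hf using h
  let g : B →ₗ[ℂ] S :=
    { toFun := f
      map_add' := fun a b => hπ (by
        rw [map_add π, hf, hf, hf, map_add ι, map_add χ, map_add κ, mul_add, add_mul])
      map_smul' := fun c b => hπ (by
        simp only [RingHom.id_apply]
        rw [map_smul π, hf, hf, map_smul ι, map_smul χ, map_smul κ, mul_smul_comm,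
          smul_mul_assoc]) }
  refine ⟨{ g with map_cstarMatrix_nonneg' := fun k M hM => ?_ }, hf⟩
  have h1 : 0 ≤ M.map ι := map_nonneg (CStarMatrix.mapₙₐ (n := Fin k) ι) hM
  have h2 : 0 ≤ (M.map ι).map χ := χ.map_cstarMatrix_nonneg' k _ h1
  have h3 : 0 ≤ ((M.map ι).map χ).map κ := map_nonneg (CStarMatrix.mapₙₐ (n := Fin k) κ) h2
  have h4 := CStarMatrix.map_conj_nonneg h3 w
  -- Positivity at each matrix level is tested after applying π entrywise, which is injective on
  -- matrices and so reflects positivity.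
  refine nonneg_of_map_nonneg (CStarMatrix.mapₙₐ (n := Fin k) π) ?_ (h4.trans_eq ?_)
  · exact fun M N hMN => CStarMatrix.map_injective hπ hMN
  · ext i j
    exact (hf _).symm

end CompletelyPositive

/-! ### Simple algebras and strictly positive elements -/

section Simple

variable {A B : Type*} [NonUnitalCStarAlgebra A] [NonUnitalCStarAlgebra B]

/-- A nonzero closed ideal I of B induces the closed ideal J of all x in A with k(b)yxzk(c) ∈ k(I)
for all b, c, y, z. It contains k(I)'s nonzero elements, so J = A by simplicity; approximate units
of B then recover I = B. -/
theorem IsSimpleCStar.of_isHereditaryHom (hA : IsSimpleCStar A) {k : B →⋆ₙₐ[ℂ] A}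
    (hk : IsHereditaryHom k) : IsSimpleCStar B := by
  let _ := CStarAlgebra.spectralOrder B
  let _ := CStarAlgebra.spectralOrderedRing B
  have hu := CStarAlgebra.increasingApproximateUnit B
  have := hu.neBot
  intro I hI
  by_cases hbot : I = ⊥
  · exact Or.inl hbot
  have hkc : Continuous k := map_continuous k
  obtain ⟨i, hiI, hi0⟩ : ∃ i ∈ I, i ≠ 0 := by
    by_contra! hcon
    exact hbot (eq_bot_iff.2 fun x hx => (TwoSidedIdeal.mem_bot B).2 (hcon x hx))
  have hkI : IsClosed (k '' (I : Set B)) :=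
    (NonUnitalStarAlgHom.isometry k hk.injective).isClosedEmbedding.isClosedMap _ hI
  let J : TwoSidedIdeal A := TwoSidedIdeal.mk'
    {x | ∀ b c y z, k b * y * x * z * k c ∈ k '' (I : Set B)}
    (fun b c y z => ⟨0, I.zero_mem, by simp⟩)
    (fun {x x'} hx hx' b c y z => by
      obtain ⟨e, he, he'⟩ := hx b c y z
      obtain ⟨f, hf, hf'⟩ := hx' b c y z
      exact ⟨e + f, I.add_mem he hf, by rw [map_add, he', hf', mul_add, add_mul, add_mul]⟩)
    (fun {x} hx b c y z => by
      obtain ⟨e, he, he'⟩ := hx b c y z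
      exact ⟨-e, I.neg_mem he, by rw [map_neg, he', mul_neg, neg_mul, neg_mul]⟩)
    (fun {x x'} hx' b c y z => by
      simpa only [mul_assoc] using hx' b c (y * x) z)
    (fun {x x'} hx b c y z => by
      simpa only [mul_assoc] using hx b c y (x' * z))
  have hJ : ∀ x, x ∈ J ↔ ∀ b c y z, k b * y * x * z * k c ∈ k '' (I : Set B) := fun x => by
    have h : (J : Set A) = {x | ∀ b c y z, k b * y * x * z * k c ∈ k '' (I : Set B)} :=
      TwoSidedIdeal.coe_mk' ..
    exact Set.ext_iff.1 h x
  have hJc : IsClosed (J : Set A) := by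
    have : (J : Set A) = ⋂ (b : B) (c : B) (y : A) (z : A),
        (fun x => k b * y * x * z * k c) ⁻¹' (k '' (I : Set B)) := by
      ext x; simp [hJ]
    rw [this]
    exact isClosed_iInter fun b => isClosed_iInter fun c => isClosed_iInter fun y =>
      isClosed_iInter fun z => hkI.preimage (by fun_prop)
  have hJi : k i ∈ J := by
    refine (hJ _).2 fun b c y z => ?_
    have h1 : Filter.Tendsto (fun u => k b * y * k (u * i) * z * k c)
        (CStarAlgebra.approximateUnit B) (nhds (k b * y * k i * z * k c)) :=
      ((((hkc.tendsto _).comp (hu.tendsto_mul_right i)).const_mul (k b * y)).mul_const z).mul_const _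
    refine hkI.mem_of_tendsto h1 (.of_forall fun u => ?_)
    have h2 : Filter.Tendsto (fun v => k b * y * k (u * (i * v)) * z * k c)
        (CStarAlgebra.approximateUnit B) (nhds (k b * y * k (u * i) * z * k c)) :=
      ((((hkc.tendsto _).comp ((hu.tendsto_mul_left i).const_mul u)).const_mul
        (k b * y)).mul_const z).mul_const _
    refine hkI.mem_of_tendsto h2 (.of_forall fun v => ?_)
    obtain ⟨e, he⟩ := hk.exists_eq b u y
    obtain ⟨f, hf⟩ := hk.exists_eq v c z
    refine ⟨e * i * f, I.mul_mem_right _ _ (I.mul_mem_left _ _ hiI), ?_⟩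
    rw [map_mul, map_mul, he, hf, map_mul, map_mul]
    simp only [mul_assoc]
  have hJtop : J = ⊤ := (hA J hJc).resolve_left fun h => hi0 (hk.injective (by
    rw [map_zero]; exact (TwoSidedIdeal.mem_bot A).1 (h ▸ hJi)))
  refine Or.inr (eq_top_iff.2 fun x _ => ?_)
  have hmem : ∀ b c y z : B, b * y * x * z * c ∈ I := fun b c y z => by
    obtain ⟨e, he, he'⟩ := (hJ (k x)).1 (hJtop ▸ trivial) b c (k y) (k z)
    simp only [← map_mul] at he'
    exact hk.injective he' ▸ he
  have h1 : ∀ y z : B, y * x * z ∈ I := fun y z => by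
    refine hI.mem_of_tendsto ((hu.tendsto_mul_right (y * x * z)))
      (.of_forall fun u => hI.mem_of_tendsto (hu.tendsto_mul_left (u * (y * x * z)))
        (.of_forall fun v => ?_))
    have := hmem u v y z
    simp only [mul_assoc] at this ⊢
    exact this
  exact hI.mem_of_tendsto (hu.tendsto_mul_right x) (.of_forall fun u =>
    hI.mem_of_tendsto (hu.tendsto_mul_left (u * x)) (.of_forall fun v => h1 u v))

theorem IsSimpleCStar.exists_norm_sub_sum_lt (hA : IsSimpleCStar A) {h : A} (h0 : h ≠ 0) (a : A)
    {ε : ℝ} (hε : 0 < ε) :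
    ∃ S : Multiset (A × A), ‖a - (S.map fun p => p.1 * h * p.2).sum‖ < ε := by
  let _ := CStarAlgebra.spectralOrder A
  let _ := CStarAlgebra.spectralOrderedRing A
  have hu := CStarAlgebra.increasingApproximateUnit A
  have := hu.neBot
  let J : TwoSidedIdeal A := TwoSidedIdeal.mk'
    {x | ∃ S : Multiset (A × A), (S.map fun p => p.1 * h * p.2).sum = x}
    ⟨0, by simp⟩
    (by rintro x y ⟨S, rfl⟩ ⟨T, rfl⟩; exact ⟨S + T, by simp⟩)
    (by
      rintro x ⟨S, rfl⟩
      exact ⟨S.map fun p => (-p.1, p.2), by simp⟩)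
    (by
      rintro x y ⟨S, rfl⟩
      exact ⟨S.map fun p => (x * p.1, p.2), by
        simp [← Multiset.sum_map_mul_left, mul_assoc]⟩)
    (by
      rintro x y ⟨S, rfl⟩
      exact ⟨S.map fun p => (p.1, p.2 * y), by
        simp [← Multiset.sum_map_mul_right, mul_assoc]⟩)
  have hJ : (J : Set A) = {x | ∃ S : Multiset (A × A), (S.map fun p => p.1 * h * p.2).sum = x} := by
    simp only [J, TwoSidedIdeal.coe_mk']
  have hc := coe_closureIdeal J
  have hcl := isClosed_closureIdeal J
  have hh : h ∈ closureIdeal J := by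
    change h ∈ (closureIdeal J : Set A)
    refine hcl.mem_of_tendsto (hu.tendsto_mul_right h) (.of_forall fun u =>
      hcl.mem_of_tendsto (hu.tendsto_mul_left (u * h)) (.of_forall fun v => ?_))
    rw [hc, hJ]
    exact subset_closure ⟨{(u, v)}, by simp⟩
  have htop : closureIdeal J = ⊤ := (hA _ hcl).resolve_left fun h' =>
    h0 ((TwoSidedIdeal.mem_bot A).1 (h' ▸ hh))
  have ha : a ∈ closure (J : Set A) := by
    rw [← hc, htop]; trivial
  rw [hJ] at ha
  obtain ⟨_, ⟨S, rfl⟩, hS⟩ := Metric.mem_closure_iff.1 ha ε hε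
  exact ⟨S, by rwa [← dist_eq_norm]⟩

end Simple

section StrictlyPositive

variable {B : Type*} [NonUnitalCStarAlgebra B] [PartialOrder B] [StarOrderedRing B]

/-- Domination on both sides gives pzp → z over cut-offs p of m, and p = mq = q*m, so pzp lies in
mBm. -/
theorem dense_mul_mul_of_dominates {m : B} (hm : 0 ≤ m) {s : Set B} (hs : Dense s)
    (h : ∀ z ∈ s, ∃ K : ℝ, star z * z ≤ K • m ∧ z * star z ≤ K • m) :
    Dense (Set.range fun x : B => m * x * m) := by
  refine dense_iff_closure_eq.2 (Set.eq_univ_of_univ_subset ?_)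
  rw [← hs.closure_eq]
  refine closure_minimal (fun z hz => ?_) isClosed_closure
  obtain ⟨K, h1, h2⟩ := h z hz
  set p : ℕ → B := fun n => cfcₙ (cubeCut (1 / ((n : ℝ) + 1))) m with hp
  have hps : ∀ n, star (p n) = p n := fun n =>
    (IsSelfAdjoint.of_nonneg (cubeCut_nonneg_cfc hm _)).star_eq
  have l1 : Filter.Tendsto (fun n => z * p n) Filter.atTop (nhds z) := tendsto_mul_cubeCut hm h1
  have l2 : Filter.Tendsto (fun n => p n * z) Filter.atTop (nhds z) := by
    have := (tendsto_mul_cubeCut (x := star z) hm (by rwa [star_star])).star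
    rw [star_star] at this
    refine this.congr fun n => ?_
    rw [star_mul, star_star]
    exact congrArg (· * z) (hps n)
  have l3 : Filter.Tendsto (fun n => p n * (z * p n - z)) Filter.atTop (nhds 0) := by
    have h0 : Filter.Tendsto (fun n => ‖z * p n - z‖) Filter.atTop (nhds 0) := by
      simpa using (l1.sub_const z).norm
    refine squeeze_zero_norm (fun n => (norm_mul_le _ _).trans ?_) h0
    exact mul_le_of_le_one_left (norm_nonneg _) (norm_cubeCut_le hm (by positivity))
  have l4 : Filter.Tendsto (fun n => p n * z * p n) Filter.atTop (nhds z) := by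
    simpa [mul_sub, mul_assoc] using l3.add l2
  refine mem_closure_of_tendsto l4 (.of_forall fun n => ?_)
  set q := cfcₙ (fun t => rootCut (1 / ((n : ℝ) + 1)) t ^ 2) m
  have e1 : p n = m * q := cfcₙ_cubeCut_left (.of_nonneg hm) (by positivity)
  have e2 : p n = star q * m := by
    rw [← hps n, e1, star_mul, (IsSelfAdjoint.of_nonneg hm).star_eq]
  refine ⟨q * z * star q, ?_⟩
  calc _ = (m * q) * z * (star q * m) := by simp only [mul_assoc]
    _ = _ := by rw [← e1, ← e2]

/-- Sum z*z + zz* over a dense sequence, with weights making the series absolutely convergent. This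
is where separability is used. -/
theorem exists_dominating [TopologicalSpace.SeparableSpace B] :
    ∃ m : B, 0 ≤ m ∧ ∃ s : Set B, Dense s ∧
      ∀ z ∈ s, ∃ K : ℝ, star z * z ≤ K • m ∧ z * star z ≤ K • m := by
  set z := TopologicalSpace.denseSeq B
  set c : ℕ → ℝ := fun n => (1 / 2) ^ n * (1 + ‖z n‖ ^ 2)⁻¹ with hc
  have hc0 : ∀ n, 0 < c n := fun n => by positivity
  set f : ℕ → B := fun n => c n • (star (z n) * z n + z n * star (z n)) with hf
  have hf0 : ∀ n, 0 ≤ f n := fun n => smul_nonneg (hc0 n).le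
    (add_nonneg (star_mul_self_nonneg _) (mul_star_self_nonneg _))
  have hsum : Summable f := by
    refine Summable.of_norm_bounded (g := fun n => 2 * (1 / 2 : ℝ) ^ n)
      (summable_geometric_two.mul_left 2) fun n => ?_
    rw [hf, norm_smul, Real.norm_of_nonneg (hc0 n).le]
    calc c n * ‖star (z n) * z n + z n * star (z n)‖ ≤ c n * (‖z n‖ ^ 2 + ‖z n‖ ^ 2) := by
          have := hc0 n
          gcongr
          refine (norm_add_le _ _).trans (le_of_eq ?_)
          rw [CStarRing.norm_star_mul_self, CStarRing.norm_self_mul_star, sq]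
      _ ≤ c n * (2 * (1 + ‖z n‖ ^ 2)) := by
          have := hc0 n
          gcongr
          linarith
      _ = 2 * (1 / 2) ^ n := by
          rw [hc]
          have : (0 : ℝ) < 1 + ‖z n‖ ^ 2 := by positivity
          field_simp
  refine ⟨∑' n, f n, tsum_nonneg hf0, Set.range z, TopologicalSpace.denseRange_denseSeq B, ?_⟩
  rintro _ ⟨n, rfl⟩
  have hle : star (z n) * z n + z n * star (z n) ≤ (c n)⁻¹ • ∑' n, f n := by
    have h1 := smul_le_smul_of_nonneg_left (hsum.le_tsum n fun j _ => hf0 j)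
      (inv_nonneg.2 (hc0 n).le)
    rwa [hf, smul_smul, inv_mul_cancel₀ (hc0 n).ne', one_smul] at h1
  exact ⟨(c n)⁻¹, (le_add_of_nonneg_right (mul_star_self_nonneg _)).trans hle,
    (le_add_of_nonneg_left (star_mul_self_nonneg _)).trans hle⟩

/-- Normalize a dominating element to norm 1 and take e = min(1, 2t), h = max(0, 2t - 1): e equals 1
wherever h is nonzero, and h = 0 would force the norm to be at most 1/2. The relation eh = h later
converts trace bounds on h into bounds on cut-offs of e. -/
theorem exists_strictly_positive [TopologicalSpace.SeparableSpace B] [Nontrivial B] :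
    ∃ e h : B, 0 ≤ e ∧ ‖e‖ = 1 ∧ Dense (Set.range fun x : B => e * x * e) ∧
      0 ≤ h ∧ h ≠ 0 ∧ ‖h‖ ≤ 1 ∧ e * h = h := by
  obtain ⟨m, hm, s, hs, hms⟩ := exists_dominating (B := B)
  have hm0 : m ≠ 0 := by
    rintro rfl
    obtain ⟨x, hx⟩ := exists_ne (0 : B)
    refine hx (closure_minimal (s := s) (fun z hz => ?_) isClosed_singleton (hs x))
    obtain ⟨K, h1, -⟩ := hms z hz
    rw [smul_zero] at h1
    exact (CStarRing.star_mul_self_eq_zero_iff z).1 (le_antisymm h1 (star_mul_self_nonneg z))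
  have hn : 0 < ‖m‖ := norm_pos_iff.2 hm0
  set e₀ := ‖m‖⁻¹ • m with he₀
  have he0 : 0 ≤ e₀ := smul_nonneg (by positivity) hm
  have hsa : IsSelfAdjoint e₀ := .of_nonneg he0
  have hn1 : ‖e₀‖ = 1 := by
    rw [he₀, norm_smul, norm_inv, norm_norm, inv_mul_cancel₀ hn.ne']
  have hspec : ∀ t ∈ quasispectrum ℝ e₀, 0 ≤ t ∧ t ≤ 1 := fun t ht =>
    ⟨real_quasispectrum_nonneg he0 ht, hn1 ▸ (le_abs_self t).trans (quasispectrum_le_norm hsa ht)⟩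
  set e := cfcₙ (fun t : ℝ => min 1 (2 * t)) e₀ with he
  set h := cfcₙ (fun t : ℝ => max 0 (2 * t - 1)) e₀ with hh
  have hle : e₀ ≤ e := by
    conv_lhs => rw [← cfcₙ_id' ℝ e₀]
    refine cfcₙ_mono fun t ht => ?_
    obtain ⟨h0, h1⟩ := hspec t ht
    exact le_min h1 (by linarith)
  have he1 : ‖e‖ ≤ 1 := norm_cfcₙ_le fun t ht => by
    obtain ⟨h0, h1⟩ := hspec t ht
    rw [Real.norm_of_nonneg (le_min zero_le_one (by linarith))]
    exact min_le_left _ _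
  have heq : e₀ = cfcₙ (fun t : ℝ => min t (1 / 2)) e₀ + (1 / 2 : ℝ) • h := by
    rw [hh, ← cfcₙ_smul _ _ _, ← cfcₙ_add _ _ _]
    conv_lhs => rw [← cfcₙ_id' ℝ e₀]
    congr 1
    ext t
    simp only [smul_eq_mul]
    rcases le_total t (1 / 2) with ht | ht
    · rw [min_eq_left ht, max_eq_left (by linarith)]; ring
    · rw [min_eq_right ht, max_eq_right (by linarith)]; ring
  refine ⟨e, h, he0.trans hle, le_antisymm he1 ?_, ?_, ?_, ?_, ?_, ?_⟩
  · rw [← hn1]; exact CStarAlgebra.norm_le_norm_of_nonneg_of_le he0 hle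
  · refine dense_mul_mul_of_dominates (he0.trans hle) hs fun z hz => ?_
    obtain ⟨K, h1, h2⟩ := hms z hz
    have h3 : K • m ≤ (|K| * ‖m‖) • e := by
      calc K • m ≤ |K| • m := smul_le_smul_of_nonneg_right (le_abs_self K) hm
        _ = (|K| * ‖m‖) • e₀ := by
          rw [he₀, smul_smul, mul_assoc, mul_inv_cancel₀ hn.ne', mul_one]
        _ ≤ _ := smul_le_smul_of_nonneg_left hle (by positivity)
    exact ⟨_, h1.trans h3, h2.trans h3⟩
  · exact cfcₙ_nonneg fun t _ => le_max_left _ _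
  · intro h0
    rw [h0, smul_zero, add_zero] at heq
    have : ‖e₀‖ ≤ 1 / 2 := by
      rw [heq]
      refine norm_cfcₙ_le fun t ht => ?_
      rw [Real.norm_of_nonneg (le_min (hspec t ht).1 (by norm_num))]
      exact min_le_right _ _
    rw [hn1] at this
    norm_num at this
  · refine norm_cfcₙ_le fun t ht => ?_
    rw [Real.norm_of_nonneg (le_max_left _ _)]
    exact max_le zero_le_one (by linarith [(hspec t ht).2])
  · rw [he, hh, ← cfcₙ_mul (fun t : ℝ => min 1 (2 * t)) (fun t : ℝ => max 0 (2 * t - 1)) e₀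
      (by fun_prop) (by simp) (by fun_prop) (by simp)]
    refine cfcₙ_congr fun t _ => ?_
    rcases le_total t (1 / 2) with ht | ht
    · rw [max_eq_left (by linarith), mul_zero]
    · rw [min_eq_left (by linarith), one_mul]

end StrictlyPositive

/-! ### Estimates for cutoffs, Cuntz subequivalence and traces -/

section Estimates

variable {A : Type*} [NonUnitalCStarAlgebra A] [PartialOrder A] [StarOrderedRing A]

theorem cfcₙ_fCut_nonneg (ε : ℝ) (s : A) : 0 ≤ cfcₙ (fCut ε) s :=
  cfcₙ_nonneg fun t _ => fCut_nonneg ε t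

theorem star_cfcₙ_fCut (ε : ℝ) (s : A) : star (cfcₙ (fCut ε) s) = cfcₙ (fCut ε) s :=
  (IsSelfAdjoint.of_nonneg (cfcₙ_fCut_nonneg ε s)).star_eq

theorem norm_cfcₙ_fCut_le (ε : ℝ) (s : A) : ‖cfcₙ (fCut ε) s‖ ≤ 1 :=
  norm_cfcₙ_le fun t _ => by
    rw [Real.norm_of_nonneg (fCut_nonneg ε t)]; exact fCut_le_one ε t

theorem cfcₙ_fCut_mul_fCut {s : A} (_hs : IsSelfAdjoint s) {ε : ℝ} (hε : 0 < ε) :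
    cfcₙ (fCut ε) s * cfcₙ (fCut (2 * ε)) s = cfcₙ (fCut (2 * ε)) s := by
  rw [← cfcₙ_mul (fCut ε) (fCut (2 * ε)) s (continuous_fCut ε).continuousOn (fCut_zero hε)
    (continuous_fCut _).continuousOn (fCut_zero (by linarith))]
  exact cfcₙ_congr fun t _ => fCut_mul_fCut hε t

theorem cfcₙ_fCut_mul_fCut' {s : A} (hs : IsSelfAdjoint s) {ε : ℝ} (hε : 0 < ε) :
    cfcₙ (fCut (2 * ε)) s * cfcₙ (fCut ε) s = cfcₙ (fCut (2 * ε)) s := by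
  have := congrArg star (cfcₙ_fCut_mul_fCut hs hε)
  rwa [star_mul, star_cfcₙ_fCut, star_cfcₙ_fCut] at this

theorem norm_sub_mul_fCut_le {s : A} (hs : 0 ≤ s) {ε : ℝ} (hε : 0 < ε) :
    ‖s - s * cfcₙ (fCut ε) s‖ ≤ ε := by
  have hc := continuous_fCut ε
  have h0 := fCut_zero hε
  have e : s - s * cfcₙ (fCut ε) s = cfcₙ (fun t => t - t * fCut ε t) s := by
    rw [cfcₙ_sub (fun t => t) (fun t => t * fCut ε t) s (by fun_prop) (by simp) (by fun_prop)
      (by simp), cfcₙ_mul (fun t => t) (fCut ε) s (by fun_prop) (by simp) (by fun_prop) h0,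
      cfcₙ_id' ℝ s]
  rw [e]
  refine norm_cfcₙ_le fun t ht => ?_
  have ht0 := real_quasispectrum_nonneg hs ht
  have h1 := fCut_nonneg ε t
  have h2 := fCut_le_one ε t
  rw [Real.norm_of_nonneg (by nlinarith)]
  rcases le_total t ε with h | h
  · nlinarith
  · rw [fCut_of_le hε h]; linarith

theorem norm_sub_mul_le_of_norm_le_one {x s z : A} {η : ℝ} (hz : ‖z‖ ≤ 1)
    (hs : ‖s - s * z‖ ≤ η) : ‖x - x * z‖ ≤ 2 * ‖x - x * s‖ + ‖x‖ * η := by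
  have e : x - x * z = (x - x * s) - (x - x * s) * z + x * (s - s * z) := by
    simp only [sub_mul, mul_sub, mul_assoc]; abel
  calc ‖x - x * z‖ ≤ ‖x - x * s‖ + ‖x - x * s‖ * ‖z‖ + ‖x‖ * ‖s - s * z‖ := by
        rw [e]
        refine (norm_add_le _ _).trans (add_le_add ((norm_sub_le _ _).trans ?_) (norm_mul_le _ _))
        gcongr
        exact norm_mul_le _ _
    _ ≤ ‖x - x * s‖ + ‖x - x * s‖ * 1 + ‖x‖ * η := by gcongr
    _ = _ := by ring

theorem norm_sub_mul_fCut_mul_fCut_le {s : A} (hs : 0 ≤ s) {ε : ℝ} (hε : 0 < ε) :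
    ‖s - s * (cfcₙ (fCut ε) s * cfcₙ (fCut ε) s)‖ ≤ 2 * ε := by
  have h1 := norm_sub_mul_fCut_le hs hε
  set g := cfcₙ (fCut ε) s with hg
  have e : s - s * (g * g) = (s - s * g) + (s - s * g) * g := by
    simp only [sub_mul, mul_assoc]; abel
  calc _ ≤ ‖s - s * g‖ + ‖s - s * g‖ * ‖g‖ := by
        rw [e]; exact (norm_add_le _ _).trans (by gcongr; exact norm_mul_le _ _)
    _ ≤ ε + ε * 1 := by gcongr; exact norm_cfcₙ_fCut_le _ _
    _ = 2 * ε := by ring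

/-- On the support of f_{2ε} one has t ≥ ε, so gcg ≥ εg². Replacing c by q costs at most (ε/2)g². -/
theorem smul_fCut_mul_fCut_le {c q : A} (hc : 0 ≤ c) (hq : IsSelfAdjoint q) {ε : ℝ} (hε : 0 < ε)
    (hcq : ‖c - q‖ ≤ ε / 2) :
    (ε / 2) • (cfcₙ (fCut (2 * ε)) c * cfcₙ (fCut (2 * ε)) c) ≤
      cfcₙ (fCut (2 * ε)) c * q * cfcₙ (fCut (2 * ε)) c := by
  have hε2 : 0 < 2 * ε := by linarith
  have hcc := continuous_fCut (2 * ε)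
  have h0 := fCut_zero hε2
  set g := cfcₙ (fCut (2 * ε)) c with hg
  have hgs : star g = g := star_cfcₙ_fCut _ _
  have h1 : ε • (g * g) ≤ g * c * g := by
    have e1 : g * c * g = cfcₙ (fun t => fCut (2 * ε) t * t * fCut (2 * ε) t) c := by
      rw [cfcₙ_mul (fun t => fCut (2 * ε) t * t) (fCut (2 * ε)) c (by fun_prop) (by simp)
        (by fun_prop) h0, cfcₙ_mul (fCut (2 * ε)) (fun t => t) c (by fun_prop) h0 (by fun_prop)
        (by simp), cfcₙ_id' ℝ c]
    have e2 : ε • (g * g) = cfcₙ (fun t => ε • (fCut (2 * ε) t * fCut (2 * ε) t)) c := by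
      rw [cfcₙ_smul ε (fun t => fCut (2 * ε) t * fCut (2 * ε) t) c (by fun_prop) (by simp [h0]),
        cfcₙ_mul (fCut (2 * ε)) (fCut (2 * ε)) c (by fun_prop) h0 (by fun_prop) h0]
    rw [e1, e2]
    refine cfcₙ_mono (fun t ht => ?_) (by fun_prop) (by fun_prop) (by simp [h0]) (by simp [h0])
    rcases le_total t ε with h | h
    · rw [fCut_of_le_half hε2 (by linarith)]; simp
    · simp only [smul_eq_mul]
      nlinarith [mul_self_nonneg (fCut (2 * ε) t)]
  have h2 : g * (c - q) * g ≤ (ε / 2) • (g * g) := by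
    have := CStarAlgebra.star_left_conjugate_le_norm_smul (a := g) (b := c - q)
      ((IsSelfAdjoint.of_nonneg hc).sub hq)
    rw [hgs] at this
    refine this.trans (smul_le_smul_of_nonneg_right hcq ?_)
    have := star_mul_self_nonneg g
    rwa [hgs] at this
  have e3 : ε • (g * g) = (ε / 2) • (g * g) + (ε / 2) • (g * g) := by
    rw [← add_smul, add_halves]
  rw [mul_sub, sub_mul, sub_le_iff_le_add] at h2
  have h3 := h1.trans h2
  rw [e3] at h3
  exact le_of_add_le_add_left h3

/-- The cut-down satisfies gxg ≤ ‖x‖g² ≤ ‖x‖(2/ε) · gr*prg. After conjugation by w this is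
domination by a conjugate of p. -/
theorem cuntzLE_of_norm_sub_conj_le {c p r w x : A} (hc : 0 ≤ c) (hp : 0 ≤ p) (hx : 0 ≤ x)
    {ε : ℝ} (hε : 0 < ε) (h : ‖c - star r * p * r‖ ≤ ε / 2) :
    CuntzLE (w * (cfcₙ (fCut (2 * ε)) c * x * cfcₙ (fCut (2 * ε)) c) * star w) p := by
  have h1 := smul_fCut_mul_fCut_le hc (.of_nonneg (star_left_conjugate_nonneg hp r)) hε h
  set g := cfcₙ (fCut (2 * ε)) c with hg
  have hgs : star g = g := star_cfcₙ_fCut _ _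
  set K := ‖x‖ * (2 / ε) with hK
  have hK0 : 0 ≤ K := by positivity
  have h2 : g * x * g ≤ K • (g * (star r * p * r) * g) := by
    have h3 := CStarAlgebra.star_left_conjugate_le_norm_smul (a := g) (.of_nonneg hx)
    rw [hgs] at h3
    have h4 := smul_le_smul_of_nonneg_left h1 hK0
    rw [smul_smul, show K * (ε / 2) = ‖x‖ by rw [hK]; field_simp] at h4
    exact h3.trans h4
  refine cuntzLE_of_le_conj (y := √K • (r * g * star w)) ?_ hp ?_
  · have := star_left_conjugate_nonneg hx g
    rw [hgs] at this
    exact star_right_conjugate_nonneg this w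
  · refine (star_right_conjugate_le_conjugate h2 w).trans (le_of_eq ?_)
    rw [star_smul, star_trivial √K, smul_mul_assoc √K, smul_mul_assoc √K, mul_smul_comm √K, smul_smul,
      Real.mul_self_sqrt hK0, mul_smul_comm K, smul_mul_assoc K]
    simp only [star_mul, star_star, hgs, mul_assoc]

variable {τ : A →L[ℂ] ℂ}

/-- On [0, 1] the function (4/3)t - f_{1/4}(t) is at most 1/3; the slope 4/3 makes this sharp at
both t = 1/4 and t = 1. Conjugating by √z gives (4/3)τ(yz) - τ(f_{1/4}(y)) ≤ τ(z)/3, and τ(yz) is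
close to τ(z) when y almost fixes z. -/
theorem IsPosTrace.le_re_fCut (hτ : IsPosTrace τ) {y z : A} (hy : 0 ≤ y) (hy1 : ‖y‖ ≤ 1)
    (hz : 0 ≤ z) (hz1 : ‖z‖ ≤ 1) :
    (τ z).re - 4 / 3 * (‖τ‖ * ‖z - y * z‖) ≤ (τ (cfcₙ (fCut (1 / 4)) y)).re := by
  have h4 : (0 : ℝ) < 1 / 4 := by norm_num
  have hcc := continuous_fCut (1 / 4)
  have h0 := fCut_zero h4
  set f := cfcₙ (fCut (1 / 4)) y with hf
  have hf0 : 0 ≤ f := cfcₙ_fCut_nonneg _ _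
  set v := CFC.sqrt z with hv
  have hvs : star v = v := (CFC.sqrt_nonneg z).isSelfAdjoint.star_eq
  have hvv : v * v = z := CFC.sqrt_mul_sqrt_self z hz
  have hvn : ‖v‖ * ‖v‖ ≤ 1 := by
    rw [← CStarRing.norm_star_mul_self, hvs, hvv]; exact hz1
  set q := cfcₙ (fun t => max 0 (4 / 3 * t - fCut (1 / 4) t)) y with hq
  have hqn : ‖q‖ ≤ 1 / 3 := norm_cfcₙ_le fun t ht => by
    rw [Real.norm_of_nonneg (le_max_left _ _)]
    have ht1 := (le_abs_self t).trans ((quasispectrum_le_norm (.of_nonneg hy) ht).trans hy1)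
    refine max_le (by norm_num) ?_
    rcases le_total t (1 / 4) with h | h
    · linarith [fCut_nonneg (1 / 4) t]
    · rw [fCut_of_le h4 h]; linarith
  have hq0 : 0 ≤ q := cfcₙ_nonneg fun t _ => le_max_left _ _
  have hyq : (4 / 3 : ℝ) • y - f ≤ q := by
    have e : (4 / 3 : ℝ) • y - f = cfcₙ (fun t => (4 / 3 : ℝ) • t - fCut (1 / 4) t) y := by
      rw [cfcₙ_sub (fun t => (4 / 3 : ℝ) • t) (fCut (1 / 4)) y (by fun_prop) (by simp)
        (by fun_prop) h0, cfcₙ_smul (4 / 3 : ℝ) (fun t => t) y (by fun_prop) (by simp),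
        cfcₙ_id' ℝ y]
    rw [e]
    exact cfcₙ_mono (fun t _ => le_max_right _ _) (by fun_prop) (by fun_prop)
      (by rw [h0]; simp) (by rw [h0]; simp)
  have h1 : v * ((4 / 3 : ℝ) • y - f) * v ≤ (1 / 3 : ℝ) • z := by
    have h2 := star_left_conjugate_le_conjugate hyq v
    have h3 := CStarAlgebra.star_left_conjugate_le_norm_smul (a := v) (.of_nonneg hq0)
    rw [hvs] at h2 h3
    rw [hvv] at h3
    exact h2.trans (h3.trans (smul_le_smul_of_nonneg_right hqn hz))
  have h2 := hτ.re_mono h1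
  have e1 : v * ((4 / 3 : ℝ) • y - f) * v = ((4 / 3 : ℝ) : ℂ) • (v * y * v) - v * f * v := by
    rw [mul_sub, sub_mul, mul_smul_comm, smul_mul_assoc, Complex.coe_smul]
  have e2 : τ (v * y * v) = τ (y * z) := by
    rw [mul_assoc, hτ.comm, mul_assoc, hvv]
  rw [e1, map_sub, map_smul, e2, ← Complex.coe_smul, map_smul, smul_eq_mul, smul_eq_mul,
    Complex.sub_re, Complex.re_ofReal_mul, Complex.re_ofReal_mul] at h2
  have h3 : (τ (v * f * v)).re ≤ (τ f).re := by
    refine (hτ.re_mul_mul_le hf0 v v).trans ?_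
    exact mul_le_of_le_one_left (hτ.re_nonneg hf0) hvn
  have h5 : (τ z).re - (τ (y * z)).re ≤ ‖τ‖ * ‖z - y * z‖ := by
    rw [← Complex.sub_re, ← map_sub]
    exact (Complex.re_le_norm _).trans (τ.le_opNorm _)
  linarith

theorem IsPosTrace.re_sum_mul_mul_le (hτ : IsPosTrace τ) {k : A} (hk : 0 ≤ k)
    (S : Multiset (A × A)) :
    (τ (S.map fun p => p.1 * k * p.2).sum).re ≤
      (S.map fun p => ‖p.1‖ * ‖p.2‖).sum * (τ k).re := by
  induction S using Multiset.induction_on with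
  | empty => simp
  | cons p S ih =>
    simp only [Multiset.map_cons, Multiset.sum_cons, map_add, Complex.add_re, add_mul]
    exact add_le_add (hτ.re_mul_mul_le hk _ _) ih

/-- Normalize τ and use f_{1/4}(t) ≤ 8t for t ≥ 0. -/
theorem IsPosTrace.le_re_of_tracialStates (hτ : IsPosTrace τ) {x : A} (hx : 0 ≤ x) {𝔣 : ℝ}
    (h : ∀ t ∈ tracialStates A, 𝔣 ≤ (t (cfcₙ (fCut (1 / 4)) x)).re) :
    𝔣 / 8 * ‖τ‖ ≤ (τ x).re := by
  rcases eq_or_ne τ 0 with rfl | h0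
  · simp
  have hn : 0 < ‖τ‖ := norm_pos_iff.2 h0
  obtain ⟨t, ht, htτ⟩ := hτ.exists_tracialState h0
  have h1 := h t ht
  have hcc := continuous_fCut (1 / 4)
  have h2 : cfcₙ (fCut (1 / 4)) x ≤ (8 : ℝ) • x := by
    have e : (8 : ℝ) • x = cfcₙ (fun t : ℝ => (8 : ℝ) • t) x := by
      rw [cfcₙ_smul (8 : ℝ) (fun t => t) x (by fun_prop) (by simp), cfcₙ_id' ℝ x]
    rw [e]
    refine cfcₙ_mono (fun t ht => ?_) (by fun_prop) (by fun_prop) (fCut_zero (by norm_num))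
      (by simp)
    refine (fCut_le_mul (by norm_num) (real_quasispectrum_nonneg hx ht)).trans (le_of_eq ?_)
    rw [smul_eq_mul]; norm_num
  have h3 := hτ.re_mono h2
  rw [htτ, Complex.re_ofReal_mul, inv_mul_eq_div, le_div_iff₀ hn] at h1
  rw [← Complex.coe_smul, map_smul, smul_eq_mul, Complex.re_ofReal_mul] at h3
  linarith

end Estimates

/-! ### Corners -/

section Corner

variable {A D : Type*} [NonUnitalCStarAlgebra A] [PartialOrder A] [StarOrderedRing A]
  [NonUnitalCStarAlgebra D] [PartialOrder D] [StarOrderedRing D]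

theorem map_mul_apply_eq_zero {δ : D →⋆ₙₐ[ℂ] A} {φ : A →CP A} (h0 : ∀ x d, φ x * δ d = 0)
    (d : D) (x : A) : δ d * φ x = 0 := by
  have h := congrArg star (h0 (star x) (star d))
  rwa [map_star, map_star, star_mul, star_star, star_star, star_zero] at h

/-- Since φ(e) kills δ(D), the sum φ(e) + δ(ψ(e)) acts there as δ(ψ(e)), and the same holds for
continuous functions of the sum. They therefore map δ(D) into itself. -/
theorem exists_cfcₙ_mul_map_eq {δ : D →⋆ₙₐ[ℂ] A} (hδ : Function.Injective δ) {φ : A →CP A}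
    {ψ : A →CP D} (h0 : ∀ x d, φ x * δ d = 0) {e : A} (he : 0 ≤ e) {f : ℝ → ℝ}
    (hf : Continuous f) (d : D) : ∃ d', cfcₙ f (φ e + δ (ψ e)) * δ d = δ d' := by
  have hφ : 0 ≤ φ e := map_nonneg φ he
  have hψ : 0 ≤ δ (ψ e) := map_nonneg δ (map_nonneg ψ he)
  have hE : IsClosed (NonUnitalStarAlgHom.range δ : Set A) := by
    simpa using isClosed_range_of_injective hδ
  obtain ⟨h1, h2⟩ := cfcₙ_mul_eq_of_mul_eq hE (s := φ e + δ (ψ e)) (c := δ (ψ e))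
    (.of_nonneg (add_nonneg hφ hψ)) (.of_nonneg hψ) ⟨ψ e, rfl⟩ (by
      rintro _ ⟨z, rfl⟩
      change (φ e + δ (ψ e)) * δ z = _
      rw [add_mul, h0, zero_add]
      rfl) hf
  rw [h2 (δ d) ⟨d, rfl⟩]
  obtain ⟨z, hz⟩ := mul_mem h1 (show δ d ∈ NonUnitalStarAlgHom.range δ from ⟨d, rfl⟩)
  exact ⟨z, hz.symm⟩

/-- The mirror statement: on the two-sided annihilator of δ(D), which contains φ(A), the sum acts as
φ(e). -/
theorem cfcₙ_mul_apply_eq {δ : D →⋆ₙₐ[ℂ] A} {φ : A →CP A}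
    {ψ : A →CP D} (h0 : ∀ x d, φ x * δ d = 0) {e : A} (he : 0 ≤ e) {f : ℝ → ℝ}
    (hf : Continuous f) (x : A) : cfcₙ f (φ e + δ (ψ e)) * φ x = cfcₙ f (φ e) * φ x := by
  have hφ : 0 ≤ φ e := map_nonneg φ he
  have hψ : 0 ≤ δ (ψ e) := map_nonneg δ (map_nonneg ψ he)
  have h0' := map_mul_apply_eq_zero h0
  let E : NonUnitalStarSubalgebra ℂ A :=
    { carrier := {b | ∀ d, b * δ d = 0 ∧ δ d * b = 0}
      add_mem' := fun {a b} ha hb d => by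
        simp [add_mul, mul_add, (ha d).1, (ha d).2, (hb d).1, (hb d).2]
      zero_mem' := fun d => by simp
      mul_mem' := fun {a b} ha hb d => by
        constructor
        · rw [mul_assoc, (hb d).1, mul_zero]
        · rw [← mul_assoc, (ha d).2, zero_mul]
      smul_mem' := fun c a ha d => by
        simp [smul_mul_assoc, mul_smul_comm, (ha d).1, (ha d).2]
      star_mem' := fun {a} ha d => by
        have h1 := congrArg star (ha (star d)).1
        have h2 := congrArg star (ha (star d)).2
        rw [star_mul, map_star, star_star, star_zero] at h1 h2
        exact ⟨h2, h1⟩ }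
  have hE : IsClosed (E : Set A) := by
    have : (E : Set A) = ⋂ d, {b | b * δ d = 0} ∩ {b | δ d * b = 0} := by
      ext b; simp only [Set.mem_iInter]; rfl
    rw [this]
    exact isClosed_iInter fun d => (isClosed_eq (by fun_prop) continuous_const).inter
      (isClosed_eq (by fun_prop) continuous_const)
  have hmem : ∀ y, φ y ∈ E := fun y d => ⟨h0 y d, h0' d y⟩
  exact (cfcₙ_mul_eq_of_mul_eq hE (s := φ e + δ (ψ e)) (c := φ e)
    (.of_nonneg (add_nonneg hφ hψ)) (.of_nonneg hφ) (hmem e) (fun z hz => by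
      rw [add_mul, (hz (ψ e)).2, add_zero]) hf).2 _ (hmem x)

/-- D₁ consists of the elements on which F is a two-sided unit; F itself need not lie in δ(D). A
product axb takes the left condition from a and the right one from b. -/
theorem exists_corner.{u} {D : Type u} [NonUnitalCStarAlgebra D] (δ : D →⋆ₙₐ[ℂ] A) {F : A}
    (hF : star F = F) :
    ∃ (D₁ : Type u) (_ : NonUnitalCStarAlgebra D₁) (j : D₁ →⋆ₙₐ[ℂ] D), IsHereditaryHom j ∧
      ∀ z, (∃ y, j y = z) ↔ F * δ z = δ z ∧ δ z * F = δ z := by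
  let E : NonUnitalStarSubalgebra ℂ D :=
    { carrier := {z | F * δ z = δ z ∧ δ z * F = δ z}
      add_mem' := fun {a b} ha hb => by
        simp [add_mul, mul_add, ha.1, ha.2, hb.1, hb.2]
      zero_mem' := by simp
      mul_mem' := fun {a b} ha hb => by
        rw [Set.mem_ofPred_eq, map_mul]
        exact ⟨by rw [← mul_assoc, ha.1], by rw [mul_assoc, hb.2]⟩
      smul_mem' := fun c a ha => by
        rw [Set.mem_ofPred_eq, map_smul, mul_smul_comm, smul_mul_assoc, ha.1, ha.2]
        exact ⟨rfl, rfl⟩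
      star_mem' := fun {a} ha => by
        have h1 := congrArg star ha.1
        have h2 := congrArg star ha.2
        rw [star_mul, ← map_star, hF] at h1 h2
        exact ⟨h2, h1⟩ }
  have hE : IsClosed (E : Set D) := by
    have hδ : Continuous δ := map_continuous δ
    exact (isClosed_eq (by fun_prop) hδ).inter (isClosed_eq (by fun_prop) hδ)
  refine ⟨E, inferInstance, NonUnitalStarSubalgebraClass.subtype E,
    ⟨Subtype.val_injective, fun a b x => ⟨⟨a.1 * x * b.1, ?_⟩, rfl⟩⟩, fun z => ?_⟩
  · change F * δ _ = δ _ ∧ δ _ * F = δ _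
    rw [map_mul, map_mul]
    exact ⟨by rw [← mul_assoc, ← mul_assoc, a.2.1], by rw [mul_assoc, b.2.2]⟩
  · exact ⟨fun ⟨y, hy⟩ => hy ▸ y.2, fun h => ⟨⟨z, h⟩, rfl⟩⟩

end Corner

section
attribute [local instance] CStarAlgebra.spectralOrder CStarAlgebra.spectralOrderedRing

variable {A B : Type*} [NonUnitalCStarAlgebra A] [NonUnitalCStarAlgebra B]

theorem IsHereditaryHom.exists_conj_eq {k : B →⋆ₙₐ[ℂ] A} (hk : IsHereditaryHom k) {e : B}
    (he : star e = e) {w : A} (hw : w ∈ closure (Set.range fun y => k e * y)) (x : A) :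
    ∃ b, k b = w * x * star w := by
  have h1 : w * x * star w ∈ closure (Set.range k) := by
    refine map_mem_closure (f := fun w => w * x * star w) (by fun_prop) hw ?_
    rintro _ ⟨y, rfl⟩
    obtain ⟨c, hc⟩ := hk.exists_eq e e (y * x * star y)
    refine ⟨c, ?_⟩
    dsimp only
    rw [hc, star_mul, ← map_star k e, he]
    simp only [mul_assoc]
  rwa [(isClosed_range_of_injective hk.injective).closure_eq] at h1

/-- The element w*w = f² is a two-sided unit on the corner cut out by f, so z ↦ wzw* is
multiplicative and injective there. It lands in B because w is a limit of elements of k(e)A. As fg =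
g, the compression gψ(·)g takes values in that corner. -/
theorem exists_corner_maps.{u} {D : Type u} [NonUnitalCStarAlgebra D] {k : B →⋆ₙₐ[ℂ] A}
    (hk : IsHereditaryHom k) {δ : D →⋆ₙₐ[ℂ] A} (hδ : Function.Injective δ) {φ : CPMap A A}
    {ψ : CPMap A D} (h0 : ∀ x d, φ x * δ d = 0) {e : B} (he : 0 ≤ e) {w f g : A} {ε : ℝ}
    (hε : 0 < ε) (hw : w ∈ closure (Set.range fun y => k e * y))
    (hf : f = cfcₙ (fCut ε) (φ (k e) + δ (ψ (k e))))
    (hg : g = cfcₙ (fCut (2 * ε)) (φ (k e) + δ (ψ (k e)))) (hwf : star w * w = f * f) :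
    ∃ (D₁ : Type u) (_ : NonUnitalCStarAlgebra D₁) (j : D₁ →⋆ₙₐ[ℂ] D) (θ : D₁ →⋆ₙₐ[ℂ] B)
      (φ' : CPMap B B) (ψ' : CPMap B D₁), IsHereditaryHom j ∧ Function.Injective θ ∧
      (∀ x z, φ' x * θ z = 0) ∧ (∀ x, k (φ' x) = w * g * φ (k x) * star (w * g)) ∧
      (∀ x, k (θ (ψ' x)) = w * g * δ (ψ (k x)) * star (w * g)) ∧
      ∀ x, δ (j (ψ' x)) = g * δ (ψ (k x)) * g := by
  have he' : 0 ≤ k e := map_nonneg k he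
  set s := φ (k e) + δ (ψ (k e)) with hs
  have hs0 : 0 ≤ s := add_nonneg (map_nonneg φ he') (map_nonneg δ (map_nonneg ψ he'))
  have hssa : IsSelfAdjoint s := .of_nonneg hs0
  have hfs : star f = f := hf ▸ star_cfcₙ_fCut _ _
  have hgs : star g = g := hg ▸ star_cfcₙ_fCut _ _
  have hfg : f * g = g := by rw [hf, hg]; exact cfcₙ_fCut_mul_fCut hssa hε
  have hgf : g * f = g := by rw [hf, hg]; exact cfcₙ_fCut_mul_fCut' hssa hε
  have hgδ : ∀ d, ∃ d', g * δ d = δ d' := fun d => by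
    rw [hg]; exact exists_cfcₙ_mul_map_eq hδ h0 he' (continuous_fCut _) d
  have hgδg : ∀ d, ∃ d', δ d' = g * δ d * g := fun d => by
    obtain ⟨d', hd'⟩ := hgδ d
    obtain ⟨d'', hd''⟩ := hgδ (star d')
    refine ⟨star d'', ?_⟩
    rw [map_star, ← hd'', star_mul, map_star, star_star, hgs, hd']
  obtain ⟨D₁, _, j, hj, hjr⟩ := exists_corner δ hfs
  have hfj : ∀ z, f * δ (j z) = δ (j z) := fun z => ((hjr _).1 ⟨z, rfl⟩).1
  have hjf : ∀ z, δ (j z) * f = δ (j z) := fun z => ((hjr _).1 ⟨z, rfl⟩).2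
  have hwf2 : ∀ z, star w * (w * δ (j z)) = δ (j z) := fun z => by
    rw [← mul_assoc, hwf, mul_assoc, hfj, hfj]
  have hconj := hk.exists_conj_eq (IsSelfAdjoint.of_nonneg he).star_eq hw
  choose t ht using fun z => hconj (δ (j z))
  let θ : D₁ →⋆ₙₐ[ℂ] B :=
    { toFun := t
      map_smul' := fun c z => hk.injective (by
        simp only [MonoidHom.id_apply]
        rw [map_smul k, ht, ht, map_smul j, map_smul δ, mul_smul_comm, smul_mul_assoc])
      map_zero' := hk.injective (by rw [ht]; simp)
      map_add' := fun z z' => hk.injective (by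
        rw [map_add k, ht, ht, ht, map_add j, map_add δ, mul_add, add_mul])
      map_mul' := fun z z' => hk.injective (by
        rw [map_mul k, ht, ht, ht, map_mul j, map_mul δ]
        calc _ = w * δ (j z) * δ (j z') * star w := by simp only [mul_assoc]
          _ = w * δ (j z) * (star w * (w * δ (j z'))) * star w := by rw [hwf2]
          _ = _ := by simp only [mul_assoc])
      map_star' := fun z => hk.injective (by
        rw [map_star k, ht, ht, map_star j, map_star δ]
        simp only [star_mul, star_star, mul_assoc]) }
  have hθ : ∀ z, k (θ z) = w * δ (j z) * star w := ht
  obtain ⟨φ', hφ'⟩ := exists_completelyPositive_lift k φ (.id ℂ A) (w * g) k hk.injective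
    fun b => by
      obtain ⟨c, hc⟩ := hconj (g * φ (k b) * g)
      refine ⟨c, ?_⟩
      rw [hc, star_mul, hgs]
      simp only [mul_assoc, NonUnitalStarAlgHom.coe_id, id_eq]
  obtain ⟨ψ', hψ'⟩ := exists_completelyPositive_lift k ψ δ g (δ.comp j)
    (injective_comp hδ hj.injective) fun b => by
      obtain ⟨d, hd⟩ := hgδg (ψ (k b))
      obtain ⟨z, rfl⟩ := (hjr d).2 ⟨by rw [hd, ← mul_assoc, ← mul_assoc, hfg],
        by rw [hd, mul_assoc, hgf]⟩
      exact ⟨z, by rw [hgs]; exact hd⟩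
  have hψ'' : ∀ x, δ (j (ψ' x)) = g * δ (ψ (k x)) * g := fun x => by
    have := hψ' x
    rwa [hgs] at this
  refine ⟨D₁, inferInstance, j, θ, φ', ψ', hj, ?_, fun x z => hk.injective ?_, hφ', fun x => ?_,
    hψ''⟩
  · refine (injective_iff_map_eq_zero θ).2 fun z hz => ?_
    have h1 := hθ z
    rw [hz, map_zero] at h1
    have h2 : δ (j z) = star w * (w * δ (j z) * star w) * w := by
      calc δ (j z) = δ (j z) * (f * f) := by rw [← mul_assoc, hjf, hjf]
        _ = (star w * (w * δ (j z))) * (star w * w) := by rw [hwf2, hwf]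
        _ = _ := by simp only [mul_assoc]
    rw [← h1, mul_zero, zero_mul] at h2
    exact injective_comp hδ hj.injective (h2.trans (map_zero (δ.comp j)).symm)
  -- Between φ and the corner only g survives, since w*w acts as a unit on the corner; gδ(jz) is
  -- still in δ(D), so φ annihilates it.
  · obtain ⟨d', hd'⟩ := hgδ (j z)
    rw [map_mul, hφ', hθ, map_zero, star_mul, hgs]
    calc _ = w * g * (φ (k x) * (g * (star w * (w * δ (j z))))) * star w := by
          simp only [mul_assoc, NonUnitalStarAlgHom.coe_id, id_eq]
      _ = 0 := by rw [hwf2, hd', h0]; simp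
  · rw [hθ, hψ'', star_mul, hgs]
    simp only [mul_assoc]

end

/-! ### Quantitative compression to a corner -/

section Estimates

variable {A B : Type*} [NonUnitalCStarAlgebra A] [NonUnitalCStarAlgebra B]

theorem norm_conj_le {V : A} (hV : ‖V‖ ≤ 1) (x : A) : ‖V * x * star V‖ ≤ ‖x‖ :=
  calc ‖V * x * star V‖ ≤ ‖V‖ * ‖x‖ * ‖star V‖ :=
        (norm_mul_le _ _).trans (by gcongr; exact norm_mul_le _ _)
    _ ≤ 1 * ‖x‖ * 1 := by rw [norm_star]; gcongr
    _ = ‖x‖ := by ring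

theorem norm_conj_sub_mul_le {V G : A} (hV : ‖V‖ ≤ 1) (hVG : star V * V = G) (x y z : A) :
    ‖V * z * star V - (V * x * star V) * (V * y * star V)‖ ≤
      ‖z - x * y‖ + ‖x - x * G‖ * ‖y‖ := by
  have e : V * z * star V - (V * x * star V) * (V * y * star V) =
      V * ((z - x * y) + (x - x * G) * y) * star V := by
    rw [← hVG]
    simp only [mul_sub, sub_mul, mul_add, add_mul, mul_assoc]
    abel
  rw [e]
  exact (norm_conj_le hV _).trans ((norm_add_le _ _).trans (by gcongr; exact norm_mul_le _ _))

/-- Conjugation by V almost fixes sχs because Vs ≈ s, and χ is compared with sχs. -/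
theorem norm_sub_conj_le {V s χ : A} {β : ℝ} (hV : ‖V‖ ≤ 1) (hs : star s = s) (hs2 : ‖s‖ ≤ 2)
    (hVs : ‖V * s - s‖ ≤ β) :
    ‖χ - V * χ * star V‖ ≤ 2 * ‖χ - s * χ * s‖ + 4 * β * ‖χ‖ := by
  have hβ : 0 ≤ β := (norm_nonneg _).trans hVs
  have hVs2 : ‖V * s‖ ≤ 2 := (norm_mul_le _ _).trans (by nlinarith [norm_nonneg V, norm_nonneg s])
  have hVs' : ‖s * star V - s‖ ≤ β := by
    rw [← norm_star, star_sub, star_mul, star_star, hs]; exact hVs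
  have e : χ - V * χ * star V = (χ - s * χ * s) - V * (χ - s * χ * s) * star V -
      ((V * s - s) * χ * s + V * s * χ * (s * star V - s)) := by
    simp only [mul_sub, sub_mul, mul_assoc]
    abel
  calc _ ≤ ‖χ - s * χ * s‖ + ‖χ - s * χ * s‖ + (β * ‖χ‖ * 2 + 2 * ‖χ‖ * β) := by
        rw [e]
        refine (norm_sub_le _ _).trans (add_le_add ((norm_sub_le _ _).trans ?_)
          ((norm_add_le _ _).trans (add_le_add ?_ ?_)))
        · gcongr; exact norm_conj_le hV _
        · refine (norm_mul_le _ _).trans ?_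
          gcongr
          exact (norm_mul_le _ _).trans (by gcongr)
        · refine (norm_mul_le _ _).trans ?_
          gcongr
          exact (norm_mul_le _ _).trans (by gcongr)
    _ = _ := by ring

theorem norm_sub_mul_mul_le {e s y χ : A} {η : ℝ} (he : ‖e‖ ≤ 1) (hs2 : ‖s‖ ≤ 2)
    (hes : ‖e - s‖ ≤ η) (hye : ‖y - e * y * e‖ ≤ η) (hyχ : ‖y - χ‖ ≤ η) (hχ : ‖χ‖ ≤ 2 * ‖y‖) :
    ‖χ - s * χ * s‖ ≤ 4 * η + 5 * η * ‖y‖ := by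
  have hη : 0 ≤ η := (norm_nonneg _).trans hes
  have e1 : χ - s * χ * s = -(y - χ) + (y - e * y * e) + (e * y * (e - s) + e * (y - χ) * s +
      (e - s) * χ * s) := by
    simp only [mul_sub, sub_mul, mul_assoc]
    abel
  calc _ ≤ η + η + (1 * ‖y‖ * η + 1 * η * 2 + η * (2 * ‖y‖) * 2) := by
        rw [e1]
        refine (norm_add_le _ _).trans (add_le_add ((norm_add_le _ _).trans (add_le_add ?_ hye))
          ((norm_add_le _ _).trans (add_le_add ((norm_add_le _ _).trans (add_le_add ?_ ?_)) ?_)))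
        · rwa [norm_neg]
        · refine (norm_mul_le _ _).trans ?_
          gcongr
          exact (norm_mul_le _ _).trans (by gcongr)
        · refine (norm_mul_le _ _).trans ?_
          gcongr
          exact (norm_mul_le _ _).trans (by gcongr)
        · refine (norm_mul_le _ _).trans ?_
          gcongr
          exact (norm_mul_le _ _).trans (by gcongr)
    _ = _ := by ring

variable [PartialOrder A] [StarOrderedRing A]

/-- Chain: Ω(x) ≈ Ω(xe) ≈ Ω(x)Ω(e) = Ω(x)s, and z is almost a right unit for s. The equality comes
from orthogonality, so one lemma serves both the φ part and the ψ part. -/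
theorem norm_apply_sub_mul_le {Ω : B → A} (hsub : ∀ x y, Ω (x - y) = Ω x - Ω y)
    (hc : ∀ x, ‖Ω x‖ ≤ ‖x‖) {e x : B} {η ν : ℝ} (hm : ‖Ω (x * e) - Ω x * Ω e‖ ≤ η)
    (hxe : ‖x - x * e‖ ≤ η) {s z : A} (hs : Ω x * s = Ω x * Ω e) (hz : ‖z‖ ≤ 1)
    (hsz : ‖s - s * z‖ ≤ ν) : ‖Ω x - Ω x * z‖ ≤ 4 * η + ν * ‖x‖ := by
  have hν : 0 ≤ ν := (norm_nonneg _).trans hsz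
  have h1 : ‖Ω x - Ω x * s‖ ≤ 2 * η := by
    rw [hs, show Ω x - Ω x * Ω e = Ω (x - x * e) + (Ω (x * e) - Ω x * Ω e) by rw [hsub]; abel]
    refine (norm_add_le _ _).trans ?_
    linarith [(hc (x - x * e)).trans hxe]
  refine (norm_sub_mul_le_of_norm_le_one hz hsz).trans ?_
  have := mul_le_mul_of_nonneg_right (hc x) hν
  linarith

theorem norm_conj_apply_sub_mul_le {Ω : B → A} (hsub : ∀ x y, Ω (x - y) = Ω x - Ω y)
    (hc : ∀ x, ‖Ω x‖ ≤ ‖x‖) {e x y : B} {η ν : ℝ} (hm : ‖Ω (x * e) - Ω x * Ω e‖ ≤ η)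
    (hm' : ‖Ω (x * y) - Ω x * Ω y‖ ≤ η) (hxe : ‖x - x * e‖ ≤ η) {s V G : A}
    (hs : Ω x * s = Ω x * Ω e) (hV : ‖V‖ ≤ 1) (hVG : star V * V = G) (hsG : ‖s - s * G‖ ≤ ν) :
    ‖V * Ω (x * y) * star V - (V * Ω x * star V) * (V * Ω y * star V)‖ ≤
      η + (4 * η + ν * ‖x‖) * ‖y‖ := by
  have hG : ‖G‖ ≤ 1 := by
    rw [← hVG, CStarRing.norm_star_mul_self]; nlinarith [norm_nonneg V]
  have h1 := norm_apply_sub_mul_le hsub hc hm hxe hs hG hsG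
  refine (norm_conj_sub_mul_le hV hVG _ _ _).trans (add_le_add hm' ?_)
  exact mul_le_mul h1 (hc y) (norm_nonneg _) ((norm_nonneg _).trans h1)

end Estimates

section
attribute [local instance] CStarAlgebra.spectralOrder CStarAlgebra.spectralOrderedRing

variable {A B : Type*} [NonUnitalCStarAlgebra A] [NonUnitalCStarAlgebra B]

-- V = wg satisfies V*V = g², almost a right unit for φ(x) and ψ(x), so conjugation by V stays
-- almost multiplicative; and Vs ≈ s makes the two new maps still sum to almost the identity on G.
set_option maxHeartbeats 1000000 in
theorem exists_corner_approx.{u} {D : Type u} [NonUnitalCStarAlgebra D] {k : B →⋆ₙₐ[ℂ] A}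
    (hk : IsHereditaryHom k) {δ : D →⋆ₙₐ[ℂ] A} (hδ : Function.Injective δ) {φ : CPMap A A}
    {ψ : CPMap A D} (h0 : ∀ x d, φ x * δ d = 0) (hφ : ∀ x, ‖φ x‖ ≤ ‖x‖) (hψ : ∀ x, ‖ψ x‖ ≤ ‖x‖)
    {G : Set B} {L ε r η : ℝ} (hL : 1 ≤ L) (hGL : ∀ y ∈ G, ‖y‖ ≤ L) (hε : ε ≤ 1) (hr : 0 < r)
    (hrε : 64 * L ^ 2 * r ≤ ε) (hη : 0 < η) (hηr : 6 * η ≤ r ^ 3) {e : B} (he : 0 ≤ e)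
    (he1 : ‖e‖ ≤ 1) (hGe : ∀ y ∈ G, ‖y - y * e‖ ≤ η ∧ ‖y - e * y * e‖ ≤ η)
    (hφm : ∀ x ∈ G, ∀ y ∈ insert e G, ‖φ (k x * k y) - φ (k x) * φ (k y)‖ ≤ η)
    (hψm : ∀ x ∈ G, ∀ y ∈ insert e G, ‖ψ (k x * k y) - ψ (k x) * ψ (k y)‖ ≤ η)
    (hφψ : ∀ y ∈ insert e G, ‖k y - (φ (k y) + δ (ψ (k y)))‖ ≤ η) {p q : A} (hp : 0 ≤ p)
    (hq : ‖φ (k e) - star q * p * q‖ ≤ r / 2) :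
    ∃ (D₁ : Type u) (_ : NonUnitalCStarAlgebra D₁) (j : D₁ →⋆ₙₐ[ℂ] D) (θ : D₁ →⋆ₙₐ[ℂ] B)
      (φ' : CPMap B B) (ψ' : CPMap B D₁), IsHereditaryHom j ∧ Function.Injective θ ∧
      (∀ x z, φ' x * θ z = 0) ∧ (∀ x, ‖φ' x‖ ≤ ‖x‖) ∧ (∀ x, ‖ψ' x‖ ≤ ‖x‖) ∧
      (∀ x ∈ G, ∀ y ∈ G, ‖φ' (x * y) - φ' x * φ' y‖ < ε) ∧
      (∀ x ∈ G, ∀ y ∈ G, ‖ψ' (x * y) - ψ' x * ψ' y‖ < ε) ∧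
      (∀ y ∈ G, ‖y - (φ' y + θ (ψ' y))‖ < ε) ∧
      (∀ x, 0 ≤ x → CuntzLE (k (φ' x)) p) ∧
      ∀ y ∈ G, IsSelfAdjoint y → ‖ψ (k y) - j (ψ' y)‖ ≤ ε := by
  have hkn := NonUnitalStarAlgHom.norm_map k hk.injective
  have hδn := NonUnitalStarAlgHom.norm_map δ hδ
  have he' : 0 ≤ k e := map_nonneg k he
  have hL2 : L ≤ L ^ 2 := by nlinarith
  have hr1 : r ≤ 1 / 64 := by nlinarith
  have hLr : L * r ≤ L ^ 2 * r := by gcongr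
  have hrL : r ≤ L ^ 2 * r := le_mul_of_one_le_left hr.le (by nlinarith)
  have hr3 : r ^ 3 ≤ r := by nlinarith [mul_pos hr hr]
  have hηr' : 6 * η ≤ r := hηr.trans hr3
  set s := φ (k e) + δ (ψ (k e)) with hs
  have hs0 : 0 ≤ s := add_nonneg (map_nonneg φ he') (map_nonneg δ (map_nonneg ψ he'))
  have hssa : star s = s := (IsSelfAdjoint.of_nonneg hs0).star_eq
  have hes : ‖k e - s‖ ≤ η := hφψ e (Set.mem_insert _ _)
  have hke1 : ‖k e‖ ≤ 1 := (hkn e).trans_le he1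
  have hs2 : ‖s‖ ≤ 2 := by
    have : s = k e - (k e - s) := by abel
    rw [this]
    refine (norm_sub_le _ _).trans ?_
    linarith
  obtain ⟨w, hw, hwf, hws⟩ := exists_conjugator he' hs0 hs2 hr (δ := η) (by linarith) hes
  set f := cfcₙ (fCut r) s with hf
  set g := cfcₙ (fCut (2 * r)) s with hg
  have hgs : star g = g := star_cfcₙ_fCut _ _
  have hg1 : ‖g‖ ≤ 1 := norm_cfcₙ_fCut_le _ _
  set V := w * g with hV
  have hVg : star V * V = g * g := by
    have h1 : f * g = g := cfcₙ_fCut_mul_fCut (.of_nonneg hs0) hr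
    calc star V * V = g * (star w * w) * g := by
          rw [hV, star_mul, hgs]; simp only [mul_assoc]
      _ = _ := by rw [hwf, mul_assoc, mul_assoc, h1, h1]
  have hV1 : ‖V‖ ≤ 1 := by
    have h1 : ‖V‖ * ‖V‖ ≤ 1 := by
      rw [← CStarRing.norm_star_mul_self, hVg]
      exact (norm_mul_le _ _).trans (by nlinarith [norm_nonneg g])
    nlinarith [norm_nonneg V]
  have hVs : ‖V * s - s‖ ≤ 5 * r := by
    refine hws.trans ?_
    -- The cubic bound on η is needed because the polar decomposition loses √(6η/r), which must be
    -- at most r.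
    have h1 : 2 * η / r ≤ r ^ 2 / 3 := by
      rw [div_le_iff₀ hr]
      nlinarith
    have h2 : √(3 * (2 * η / r)) ≤ r := by
      rw [Real.sqrt_le_left hr.le]
      linarith
    nlinarith
  have hsg : ‖s - s * g‖ ≤ 2 * r := norm_sub_mul_fCut_le hs0 (by linarith)
  have hsgg : ‖s - s * (g * g)‖ ≤ 4 * r :=
    (norm_sub_mul_fCut_mul_fCut_le hs0 (by linarith)).trans (by linarith)
  obtain ⟨D₁, _, j, θ, φ', ψ', hj, hθ, hφθ, hφ', hψ', hjψ⟩ :=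
    exists_corner_maps hk hδ h0 he hr hw hf hg hwf
  have hjn := NonUnitalStarAlgHom.norm_map j hj.injective
  have hθn := NonUnitalStarAlgHom.norm_map θ hθ
  have h0' := map_mul_apply_eq_zero h0
  let Φ : B → A := fun x => φ (k x)
  let Ψ : B → A := fun x => δ (ψ (k x))
  have hΦsub : ∀ x y, Φ (x - y) = Φ x - Φ y := fun x y => by
    change φ (k (x - y)) = _; rw [map_sub k, map_sub φ]
  have hΨsub : ∀ x y, Ψ (x - y) = Ψ x - Ψ y := fun x y => by
    change δ (ψ (k (x - y))) = _; rw [map_sub k, map_sub ψ, map_sub δ]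
  have hΦc : ∀ x, ‖Φ x‖ ≤ ‖x‖ := fun x => (hφ _).trans (hkn x).le
  have hΨc : ∀ x, ‖Ψ x‖ ≤ ‖x‖ := fun x => (hδn _).trans_le ((hψ _).trans (hkn x).le)
  have hΦm : ∀ x ∈ G, ∀ y ∈ insert e G, ‖Φ (x * y) - Φ x * Φ y‖ ≤ η := fun x hx y hy => by
    have := hφm x hx y hy
    rwa [← map_mul k] at this
  have hΨm : ∀ x ∈ G, ∀ y ∈ insert e G, ‖Ψ (x * y) - Ψ x * Ψ y‖ ≤ η := fun x hx y hy => by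
    have := hψm x hx y hy
    rwa [← map_mul k, ← hδn, map_sub δ, map_mul δ] at this
  have hΦs : ∀ x, Φ x * s = Φ x * Φ e := fun x => by
    change φ (k x) * (φ (k e) + δ (ψ (k e))) = _
    rw [mul_add, h0, add_zero]
  have hΨs : ∀ x, Ψ x * s = Ψ x * Ψ e := fun x => by
    change δ (ψ (k x)) * (φ (k e) + δ (ψ (k e))) = _
    rw [mul_add, h0', zero_add]
  have hbound : ∀ x ∈ G, ∀ y ∈ G, η + (4 * η + 4 * r * ‖x‖) * ‖y‖ < ε := by
    intro x hx y hy
    have h1 : (4 * η + 4 * r * ‖x‖) * ‖y‖ ≤ (4 * η + 4 * r * L) * L :=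
      mul_le_mul (by gcongr; exact hGL x hx) (hGL y hy) (norm_nonneg _) (by positivity)
    have h2 : η * L ≤ r * L ^ 2 := by
      have : η ≤ r := by linarith
      calc η * L ≤ r * L := by gcongr
        _ ≤ _ := by linarith
    have h3 : r * L * L = L ^ 2 * r := by ring
    linarith
  have heG : ∀ y ∈ G, y ∈ insert e G := fun y hy => Set.mem_insert_of_mem _ hy
  have heI : e ∈ insert e G := Set.mem_insert _ _
  refine ⟨D₁, inferInstance, j, θ, φ', ψ', hj, hθ, hφθ, fun x => ?_, fun x => ?_,
    fun x hx y hy => ?_, fun x hx y hy => ?_, fun y hy => ?_, fun x hx => ?_, fun y hy hys => ?_⟩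
  · rw [← hkn, hφ']
    exact (norm_conj_le hV1 _).trans (hΦc x)
  · rw [← hθn, ← hkn, hψ']
    exact (norm_conj_le hV1 _).trans (hΨc x)
  · rw [← hkn, map_sub k, map_mul k, hφ', hφ', hφ']
    exact (norm_conj_apply_sub_mul_le hΦsub hΦc (hΦm x hx e heI) (hΦm x hx y (heG y hy))
      (hGe x hx).1 (hΦs x) hV1 hVg hsgg).trans_lt (hbound x hx y hy)
  · rw [← hθn, ← hkn, map_sub θ, map_mul θ, map_sub k, map_mul k, hψ', hψ', hψ']
    exact (norm_conj_apply_sub_mul_le hΨsub hΨc (hΨm x hx e heI) (hΨm x hx y (heG y hy))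
      (hGe x hx).1 (hΨs x) hV1 hVg hsgg).trans_lt (hbound x hx y hy)
  · set χ := Φ y + Ψ y with hχ
    have h1 : k (φ' y + θ (ψ' y)) = V * χ * star V := by
      rw [map_add k, hφ', hψ', ← add_mul, ← mul_add]
    have hyχ : ‖k y - χ‖ ≤ η := hφψ y (heG y hy)
    have hχn : ‖χ‖ ≤ 2 * ‖k y‖ := by
      refine (norm_add_le _ _).trans ?_
      rw [hkn]
      linarith [hΦc y, hΨc y]
    have hye : ‖k y - k e * k y * k e‖ ≤ η := by
      rw [← map_mul, ← map_mul, ← map_sub, hkn]; exact (hGe y hy).2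
    have h2 := norm_sub_mul_mul_le hke1 hs2 hes hye hyχ hχn
    have h3 := norm_sub_conj_le (χ := χ) hV1 hssa hs2 hVs
    have hyL : ‖k y‖ ≤ L := (hkn y).trans_le (hGL y hy)
    rw [← hkn, map_sub k, h1]
    have h4 : ‖k y - V * χ * star V‖ ≤ ‖k y - χ‖ + ‖χ - V * χ * star V‖ := by
      rw [show k y - V * χ * star V = (k y - χ) + (χ - V * χ * star V) by abel]
      exact norm_add_le _ _
    have h5 : η * ‖k y‖ ≤ η * L := by gcongr
    have h6 : r * ‖χ‖ ≤ r * (2 * L) := by gcongr; linarith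
    have h7 : η * L ≤ r / 6 * L := by gcongr; linarith
    linarith
  · rw [hφ']
    -- Next to φ(kx), g may be replaced by the same function of φ(ke) alone, which is close to a
    -- conjugate of p.
    have h1 : V * φ (k x) * star V = w * (cfcₙ (fCut (2 * r)) (φ (k e)) * φ (k x) *
        cfcₙ (fCut (2 * r)) (φ (k e))) * star w := by
      have h2 : g * φ (k x) = cfcₙ (fCut (2 * r)) (φ (k e)) * φ (k x) :=
        cfcₙ_mul_apply_eq h0 he' (continuous_fCut _) (k x)
      have h3 : φ (k x) * g = φ (k x) * cfcₙ (fCut (2 * r)) (φ (k e)) := by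
        have h4 := congrArg star h2
        rwa [star_mul, star_mul, hgs, star_cfcₙ_fCut,
          (IsSelfAdjoint.of_nonneg (map_nonneg φ (map_nonneg k hx))).star_eq] at h4
      calc V * φ (k x) * star V = w * (g * φ (k x)) * g * star w := by
            rw [hV, star_mul, hgs]; simp only [mul_assoc]
        _ = w * (cfcₙ (fCut (2 * r)) (φ (k e)) * (φ (k x) * g)) * star w := by
            rw [h2]; simp only [mul_assoc]
        _ = _ := by rw [h3]; simp only [mul_assoc]
    rw [h1]
    exact cuntzLE_of_norm_sub_conj_le (map_nonneg φ he') hp (map_nonneg φ (map_nonneg k hx)) hr hq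
  · have hz : star (Ψ y) = Ψ y := by
      change star (δ (ψ (k y))) = _
      rw [← map_star, ← map_star, ← map_star, hys.star_eq]
    have h1 : ‖Ψ y - Ψ y * g‖ ≤ 4 * η + 2 * r * ‖y‖ :=
      norm_apply_sub_mul_le hΨsub hΨc (hΨm y hy e heI) (hGe y hy).1 (hΨs y) hg1 hsg
    have h2 : ‖Ψ y - g * Ψ y‖ ≤ 4 * η + 2 * r * ‖y‖ := by
      rw [← norm_star, star_sub, star_mul, hgs, hz]; exact h1
    rw [← hδn, map_sub, hjψ]
    change ‖Ψ y - g * Ψ y * g‖ ≤ ε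
    have h3 : ‖Ψ y - g * Ψ y * g‖ ≤ ‖Ψ y - Ψ y * g‖ + ‖Ψ y - g * Ψ y‖ := by
      rw [show Ψ y - g * Ψ y * g = (Ψ y - Ψ y * g) + (Ψ y - g * Ψ y) * g by
        rw [sub_mul]; abel]
      refine (norm_add_le _ _).trans ?_
      gcongr
      exact (norm_mul_le _ _).trans (mul_le_of_le_one_right (norm_nonneg _) hg1)
    have h4 : r * ‖y‖ ≤ r * L := by gcongr; exact hGL y hy
    linarith

end

/-! ### Tracial approximation through embedded algebras -/

open scoped ComplexOrder in
theorem exists_tracialState_comp {D E : Type*} [NonUnitalCStarAlgebra D]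
    [NonUnitalCStarAlgebra E] (e : D ≃⋆ₐ[ℂ] E) {t : WeakDual ℂ E} (ht : t ∈ tracialStates E) :
    ∃ t' ∈ tracialStates D, ∀ x, t' x = t (e x) := by
  have hn : ∀ x, ‖e x‖ = ‖x‖ := fun x =>
    NonUnitalStarAlgHom.norm_map (e : D →⋆ₙₐ[ℂ] E) e.injective x
  rw [mem_tracialStates_iff] at ht
  set T := WeakDual.toStrongDual t with hT
  let T' : D →L[ℂ] ℂ := LinearMap.mkContinuous
    ((T : E →ₗ[ℂ] ℂ).comp ((e : D →⋆ₙₐ[ℂ] E) : D →ₗ[ℂ] E)) ‖T‖ fun x =>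
      (T.le_opNorm (e x)).trans_eq (by rw [hn])
  have hT' : ∀ x, T' x = T (e x) := fun x => rfl
  refine ⟨StrongDual.toWeakDual T', mem_tracialStates_iff.2 ⟨?_, ⟨fun x => ?_, fun x y => ?_⟩⟩,
    hT'⟩
  · change ‖T'‖ = 1
    rw [← ht.1]
    refine le_antisymm (LinearMap.mkContinuous_norm_le _ (norm_nonneg _) _)
      (ContinuousLinearMap.opNorm_le_bound _ (norm_nonneg _) fun x => ?_)
    obtain ⟨y, hy⟩ : ∃ y, e y = x := e.surjective x
    rw [← hy, hn]
    exact T'.le_opNorm y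
  · change 0 ≤ T (e (star x * x))
    rw [map_mul e, map_star e]
    exact ht.2.nonneg _
  · change T (e (x * y)) = T (e (y * x))
    rw [map_mul e, map_mul e, ht.2.comm]

section
attribute [local instance] CStarAlgebra.spectralOrder CStarAlgebra.spectralOrderedRing

theorem exists_cpMap_comp {A D E : Type*} [NonUnitalCStarAlgebra A] [NonUnitalCStarAlgebra D]
    [NonUnitalCStarAlgebra E] (e : D →⋆ₙₐ[ℂ] E) (ψ : CPMap A D) :
    ∃ ψ' : CPMap A E, ∀ x, ψ' x = e (ψ x) := by
  let g : A →ₗ[ℂ] E := (e : D →ₗ[ℂ] E).comp ψ.toLinearMap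
  refine ⟨{ g with map_cstarMatrix_nonneg' := fun k M hM => ?_ }, fun x => rfl⟩
  have h1 : 0 ≤ M.map ψ := ψ.map_cstarMatrix_nonneg' k _ hM
  exact map_nonneg (CStarMatrix.mapₙₐ (n := Fin k) e) h1

/-- The defining property of `IsTraciallyIn`, with embedded algebras in place of subalgebras. -/
def HasTracialApproximation.{u} (𝒮 : (D : Type u) → [NonUnitalCStarAlgebra D] → Prop)
    (A : Type u) [NonUnitalCStarAlgebra A] (a : A) (𝔣 : ℝ) : Prop :=
  ∀ ε : ℝ, 0 < ε → ∀ (F : Finset A) (b : A), 0 ≤ b → b ≠ 0 →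
    ∃ (D : Type u) (_ : NonUnitalCStarAlgebra D) (δ : D →⋆ₙₐ[ℂ] A)
      (φ : CPMap A A) (ψ : CPMap A D), Function.Injective δ ∧
      IsApproxMultContractive F ε φ ∧ IsApproxMultContractive F ε ψ ∧
      (∀ x d, φ x * δ d = 0) ∧
      (∀ x : A, x ∈ F ∨ x = a → ‖x - (φ x + δ (ψ x))‖ < ε) ∧
      Nontrivial D ∧ 𝒮 D ∧ CuntzLE (φ a) b ∧
      ∀ t ∈ tracialStates D, 𝔣 ≤ (t (cfcₙ (fCut (1 / 4)) (ψ a))).re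

/-- The corner arises with an embedding θ, not as a subset of B. Passing to the range is harmless:
the class and the trace condition are isomorphism invariant. -/
theorem isTraciallyIn_iff.{u} {𝒮 : (C : Type) → [NonUnitalCStarAlgebra C] → Prop}
    {A : Type u} [NonUnitalCStarAlgebra A] :
    IsTraciallyIn (fun D _ => IsFullHereditaryIn 𝒮 D) A ↔
      IsSimpleCStar A ∧ (Subsingleton A ∨ ∃ a : A, IsStrictlyPositiveElem a ∧ ‖a‖ = 1 ∧
        ∃ 𝔣 : ℝ, 0 < 𝔣 ∧ 𝔣 < 1 ∧
          HasTracialApproximation (fun D _ => IsFullHereditaryIn 𝒮 D) A a 𝔣) := by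
  refine and_congr_right fun _ => or_congr_right (exists_congr fun a => and_congr_right fun ha =>
    and_congr_right fun _ => exists_congr fun 𝔣 => and_congr_right fun _ => and_congr_right fun _ =>
    forall₂_congr fun ε _ => forall₂_congr fun F b => forall₂_congr fun _ _ => ⟨?_, ?_⟩)
  · rintro ⟨D, _, φ, ψ, h1, h2, h3, h4, h5, h6, h7, h8⟩
    exact ⟨D, inferInstance, NonUnitalStarSubalgebraClass.subtype D, φ, ψ, Subtype.val_injective,
      h1, h2, fun x d => h3 x d d.2, h4, h5, h6, h7, h8⟩
  · rintro ⟨D, _, δ, φ, ψ, hδ, h1, h2, h3, h4, h5, h6, h7, h8⟩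
    have hc : IsClosed (NonUnitalStarAlgHom.range δ : Set A) := by
      simpa using isClosed_range_of_injective hδ
    let e := StarAlgEquiv.ofInjective' δ hδ
    obtain ⟨ψ', hψ'⟩ := exists_cpMap_comp (e : D →⋆ₙₐ[ℂ] NonUnitalStarAlgHom.range δ) ψ
    have hen : ∀ x, ‖e x‖ = ‖x‖ := fun x => NonUnitalStarAlgHom.norm_map δ hδ x
    have hψe : ∀ x, ψ' x = e (ψ x) := hψ'
    refine ⟨NonUnitalStarAlgHom.range δ, hc, φ, ψ', h1, ⟨fun x => ?_, fun x hx y hy => ?_⟩, ?_,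
      fun x hx => ?_, e.toEquiv.symm.nontrivial, ?_, h7, fun t ht => ?_⟩
    · rw [hψe, hen]; exact h2.1 x
    · rw [hψe, hψe, hψe, ← map_mul, ← map_sub, hen]; exact h2.2 x hx y hy
    · rintro x _ ⟨d, rfl⟩; exact h3 x d
    · rw [hψe]; exact h4 x hx
    · exact h6.comp (isHereditaryHom_equiv e.symm) (isFullHom_equiv e.symm)
    · obtain ⟨t', ht', htt⟩ := exists_tracialState_comp e ht
      have h9 := h8 t' ht'
      have h10 : e (cfcₙ (fCut (1 / 4)) (ψ a)) = cfcₙ (fCut (1 / 4)) (e (ψ a)) := by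
        have he : Continuous (e : D →⋆ₙₐ[ℂ] NonUnitalStarAlgHom.range δ) := map_continuous _
        have ha : IsSelfAdjoint (ψ a) := .of_nonneg (map_nonneg ψ ha.1)
        exact NonUnitalStarAlgHom.map_cfcₙ (e : D →⋆ₙₐ[ℂ] NonUnitalStarAlgHom.range δ)
          (fCut (1 / 4)) (ψ a) (continuous_fCut _).continuousOn (fCut_zero (by norm_num)) he ha
          (ha.map e)
      rw [htt, h10] at h9
      rwa [hψe]

end

/-! ### Hereditary subalgebras and traces of tracially approximated algebras -/

section
attribute [local instance] CStarAlgebra.spectralOrder CStarAlgebra.spectralOrderedRing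

/-- By density √e ≈ y = axa. Then e ≈ y*y, and y*y is the conjugate of a by √a · xa. -/
theorem exists_norm_sub_conj_lt {A : Type*} [NonUnitalCStarAlgebra A] {a : A}
    (ha : IsStrictlyPositiveElem a) {e : A} (he : 0 ≤ e) (he1 : ‖e‖ ≤ 1) {ρ : ℝ} (hρ : 0 < ρ) :
    ∃ q : A, ‖e - star q * a * q‖ < ρ := by
  set v := CFC.sqrt e with hv
  have hvs : star v = v := (CFC.sqrt_nonneg e).isSelfAdjoint.star_eq
  have hvv : v * v = e := CFC.sqrt_mul_sqrt_self e he
  have hvn : ‖v‖ ≤ 1 := by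
    have h1 : ‖v‖ * ‖v‖ ≤ 1 := by
      rw [← CStarRing.norm_star_mul_self, hvs, hvv]; exact he1
    nlinarith [norm_nonneg v]
  set σ := min 1 (ρ / 4) with hσ
  have hσ0 : 0 < σ := lt_min one_pos (by linarith)
  have hσ1 : σ ≤ 1 := min_le_left _ _
  have hσρ : σ ≤ ρ / 4 := min_le_right _ _
  obtain ⟨_, hx, ⟨x, rfl⟩⟩ := Metric.dense_iff.1 ha.2 v σ hσ0
  rw [Metric.mem_ball, dist_eq_norm] at hx
  set y := a * x * a with hy
  set b := CFC.sqrt a with hb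
  have has : star a = a := ha.1.isSelfAdjoint.star_eq
  have hbs : star b = b := (CFC.sqrt_nonneg a).isSelfAdjoint.star_eq
  have hbb : b * b = a := CFC.sqrt_mul_sqrt_self a ha.1
  refine ⟨b * x * a, ?_⟩
  have e1 : star (b * x * a) * a * (b * x * a) = star y * y := by
    have h1 : b * a * b = a * a := by
      conv_lhs => rw [← hbb]
      conv_rhs => rw [← hbb]
      simp only [mul_assoc]
    calc _ = a * star x * (b * a * b) * x * a := by
          simp only [star_mul, hbs, has, mul_assoc]
      _ = _ := by rw [h1, hy]; simp only [star_mul, has, mul_assoc]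
  have e2 : e - star y * y = -(star v * (y - v) + star (y - v) * y) := by
    rw [← hvv]
    simp only [star_sub, sub_mul, mul_sub, hvs]
    abel
  have hyn : ‖y‖ ≤ 2 := by
    rw [show y = (y - v) + v by abel]
    refine (norm_add_le _ _).trans ?_
    linarith
  rw [e1, e2, norm_neg]
  calc _ ≤ ‖star v‖ * ‖y - v‖ + ‖star (y - v)‖ * ‖y‖ :=
        (norm_add_le _ _).trans (add_le_add (norm_mul_le _ _) (norm_mul_le _ _))
    _ ≤ 1 * ‖y - v‖ + ‖y - v‖ * 2 := by rw [norm_star, norm_star]; gcongr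
    _ < ρ := by linarith

theorem norm_apply_conj_sub_le {A E : Type*} [NonUnitalCStarAlgebra A] [NonUnitalCStarAlgebra E]
    {ω : CPMap A E} {x y z : A} {η : ℝ} (h1 : ‖ω (x * y) - ω x * ω y‖ ≤ η)
    (h2 : ‖ω (x * y * z) - ω (x * y) * ω z‖ ≤ η) (hω : ‖ω z‖ ≤ ‖z‖) :
    ‖ω (x * y * z) - ω x * ω y * ω z‖ ≤ η * (1 + ‖z‖) := by
  have hη : 0 ≤ η := (norm_nonneg _).trans h1
  have e : ω (x * y * z) - ω x * ω y * ω z = (ω (x * y * z) - ω (x * y) * ω z) +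
      (ω (x * y) - ω x * ω y) * ω z := by
    rw [sub_mul]; abel
  rw [e]
  refine (norm_add_le _ _).trans ?_
  have : ‖(ω (x * y) - ω x * ω y) * ω z‖ ≤ η * ‖z‖ :=
    (norm_mul_le _ _).trans (mul_le_mul h1 hω (norm_nonneg _) hη)
  linarith

/-- Values of traces of `D` on `ψ h` are bounded below, if `a` is close to `∑ x h y`. -/
theorem IsPosTrace.le_re_apply_of_sum {A D : Type*} [NonUnitalCStarAlgebra A]
    [NonUnitalCStarAlgebra D] {ψ : CPMap A D} (hψ : ∀ x, ‖ψ x‖ ≤ ‖x‖) {a h : A} (ha : 0 ≤ a)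
    (hh : 0 ≤ h) {S : Multiset (A × A)} {𝔣 M η : ℝ}
    (hS : ‖a - (S.map fun p => p.1 * h * p.2).sum‖ ≤ 𝔣 / 32)
    (hM : (S.map fun p => ‖p.1‖ * ‖p.2‖).sum ≤ M) (hM0 : 0 < M)
    (hη : η * (S.map fun p => 1 + ‖p.2‖).sum ≤ 𝔣 / 32)
    (hm : ∀ p ∈ S, ‖ψ (p.1 * h) - ψ p.1 * ψ h‖ ≤ η ∧
      ‖ψ (p.1 * h * p.2) - ψ (p.1 * h) * ψ p.2‖ ≤ η)
    (ht : ∀ t ∈ tracialStates D, 𝔣 ≤ (t (cfcₙ (fCut (1 / 4)) (ψ a))).re) {τ : D →L[ℂ] ℂ}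
    (hτ : IsPosTrace τ) : 𝔣 / (16 * M) * ‖τ‖ ≤ (τ (ψ h)).re := by
  have h1 := hτ.le_re_of_tracialStates (map_nonneg ψ ha) ht
  have hψh : 0 ≤ ψ h := map_nonneg ψ hh
  set T := (S.map fun p => (ψ p.1, ψ p.2)) with hT
  have h2 : ‖ψ (S.map fun p => p.1 * h * p.2).sum -
      (T.map fun p => p.1 * ψ h * p.2).sum‖ ≤ η * (S.map fun p => 1 + ‖p.2‖).sum := by
    clear hS hM hη
    rw [hT]
    clear hT T
    induction S using Multiset.induction_on with
    | empty => simp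
    | cons p S ih =>
      have h3 := ih fun q hq => hm q (Multiset.mem_cons_of_mem hq)
      have h4 := hm p (Multiset.mem_cons_self p S)
      have h5 := norm_apply_conj_sub_le h4.1 h4.2 (hψ p.2)
      simp only [Multiset.map_cons, Multiset.sum_cons, map_add, mul_add η] at h3 ⊢
      rw [add_sub_add_comm, ← mul_add η 1]
      exact (norm_add_le _ _).trans (add_le_add h5 h3)
  -- Half of the lower bound 𝔣/8 for τ(ψ(a)) is spent here: 𝔣/32 on approximating a, 𝔣/32 on
  -- multiplicativity.
  have h3 : ‖ψ a - (T.map fun p => p.1 * ψ h * p.2).sum‖ ≤ 𝔣 / 16 := by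
    rw [show ψ a - (T.map fun p => p.1 * ψ h * p.2).sum =
      ψ (a - (S.map fun p => p.1 * h * p.2).sum) + (ψ (S.map fun p => p.1 * h * p.2).sum -
      (T.map fun p => p.1 * ψ h * p.2).sum) by rw [map_sub]; abel]
    refine (norm_add_le _ _).trans ?_
    linarith [(hψ _).trans hS]
  have h4 : (τ (ψ a)).re - (τ (T.map fun p => p.1 * ψ h * p.2).sum).re ≤ ‖τ‖ * (𝔣 / 16) := by
    rw [← Complex.sub_re, ← map_sub]
    exact (Complex.re_le_norm _).trans ((τ.le_opNorm _).trans (by gcongr))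
  have h5 := hτ.re_sum_mul_mul_le hψh T
  have h6 : (T.map fun p => ‖p.1‖ * ‖p.2‖).sum ≤ M := by
    refine le_trans ?_ hM
    rw [hT, Multiset.map_map]
    exact Multiset.sum_map_le_sum_map _ _ fun p _ =>
      mul_le_mul (hψ _) (hψ _) (norm_nonneg _) (norm_nonneg _)
  have h7 := mul_le_mul_of_nonneg_right h6 (hτ.re_nonneg hψh)
  rw [div_mul_eq_mul_div, div_le_iff₀ (by positivity)]
  linarith

set_option maxHeartbeats 2000000 in
theorem HasTracialApproximation.exists_of_isHereditaryHom.{u}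
    {𝒮 : (C : Type) → [NonUnitalCStarAlgebra C] → Prop}
    (h𝒮 : ∀ (C : Type) [NonUnitalCStarAlgebra C], 𝒮 C → InC C) {A B : Type u}
    [NonUnitalCStarAlgebra A] [NonUnitalCStarAlgebra B] [TopologicalSpace.SeparableSpace B]
    [Nontrivial B] {k : B →⋆ₙₐ[ℂ] A} (hk : IsHereditaryHom k) (hA : IsSimpleCStar A) {a : A}
    (ha : IsStrictlyPositiveElem a) {𝔣 : ℝ} (h𝔣 : 0 < 𝔣) (h𝔣1 : 𝔣 < 1)
    (h : HasTracialApproximation (fun D _ => IsFullHereditaryIn 𝒮 D) A a 𝔣) :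
    ∃ a' : B, IsStrictlyPositiveElem a' ∧ ‖a'‖ = 1 ∧ ∃ 𝔣' : ℝ, 0 < 𝔣' ∧ 𝔣' < 1 ∧
      HasTracialApproximation (fun D _ => IsFullHereditaryIn 𝒮 D) B a' 𝔣' := by
  classical
  obtain ⟨a', h', ha'0, ha'1, ha'd, hh0, hhne, hh1, hah⟩ := exists_strictly_positive (B := B)
  have hkh : k h' ≠ 0 := fun h0 => hhne (hk.injective (h0.trans (map_zero k).symm))
  -- This sum, and with it M and κ, is fixed before ε, F and b, so the new constant κ/4 is uniform
  -- in them.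
  obtain ⟨S, hS⟩ := hA.exists_norm_sub_sum_lt hkh a (ε := 𝔣 / 32) (by positivity)
  have hsum0 : 0 ≤ (S.map fun p => ‖p.1‖ * ‖p.2‖).sum := Multiset.sum_nonneg fun x hx => by
    obtain ⟨p, -, rfl⟩ := Multiset.mem_map.1 hx; positivity
  have hsum1 : 0 ≤ (S.map fun p => 1 + ‖p.2‖).sum := Multiset.sum_nonneg fun x hx => by
    obtain ⟨p, -, rfl⟩ := Multiset.mem_map.1 hx; positivity
  set M := 1 + (S.map fun p => ‖p.1‖ * ‖p.2‖).sum with hM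
  set M' := 1 + (S.map fun p => 1 + ‖p.2‖).sum with hM'
  have hM1 : 1 ≤ M := by linarith
  have hM'1 : 1 ≤ M' := by linarith
  set κ := 𝔣 / (16 * M) with hκ
  have hκ0 : 0 < κ := by positivity
  have hκ1 : κ < 1 := by rw [hκ, div_lt_one (by positivity)]; linarith
  refine ⟨a', ⟨ha'0, ha'd⟩, ha'1, κ / 4, by positivity, by linarith, fun ε₁ hε₁ F b hb hb0 => ?_⟩
  -- The bound κ/8 serves twice: for the loss from ψ(h') to its compression, and for the defect of
  -- ψ'(a') as a unit on ψ'(h').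
  set ε := min (min ε₁ 1) (κ / 8) with hε
  have hε0 : 0 < ε := lt_min (lt_min hε₁ one_pos) (by positivity)
  have hεε : ε ≤ ε₁ := (min_le_left _ _).trans (min_le_left _ _)
  have hε1 : ε ≤ 1 := (min_le_left _ _).trans (min_le_right _ _)
  have hεκ : ε ≤ κ / 8 := min_le_right _ _
  set G : Finset B := F ∪ {a', h'} with hG
  have haG : a' ∈ G := by simp [hG]
  have hhG : h' ∈ G := by simp [hG]
  set L := 1 + ∑ y ∈ G, ‖y‖ with hL
  have hL1 : 1 ≤ L := by
    have : 0 ≤ ∑ y ∈ G, ‖y‖ := Finset.sum_nonneg fun _ _ => norm_nonneg _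
    linarith
  have hGL : ∀ y ∈ (G : Set B), ‖y‖ ≤ L := fun y hy => by
    have := Finset.single_le_sum (f := fun y => ‖y‖) (fun _ _ => norm_nonneg _) hy
    linarith
  set r := ε / (64 * L ^ 2) with hr
  have hr0 : 0 < r := by positivity
  have hrε : 64 * L ^ 2 * r ≤ ε := by rw [hr]; field_simp; rfl
  obtain ⟨e, he0, he1, hGe⟩ := exists_approx_unit G (ε := r ^ 3 / 6) (by positivity)
  have hke1 : ‖k e‖ ≤ 1 := (NonUnitalStarAlgHom.norm_apply_le k e).trans he1
  obtain ⟨q, hq⟩ := exists_norm_sub_conj_lt ha (map_nonneg k he0) hke1 (ρ := r / 8) (by positivity)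
  -- The order of choices matters: r depends on G, e on r, q on e, and η on q and the sum S. Only
  -- then is the approximation in A invoked.
  set η := min (r ^ 3 / 6) (min (r / 8 / (1 + ‖q‖)) (𝔣 / 32 / M')) with hη
  have hη0 : 0 < η := lt_min (by positivity) (lt_min (by positivity) (by positivity))
  have hηr : η ≤ r ^ 3 / 6 := min_le_left _ _
  have hηq : η * (1 + ‖q‖) ≤ r / 8 := by
    rw [← le_div_iff₀ (by positivity)]; exact (min_le_right _ _).trans (min_le_left _ _)
  have hηM : η * M' ≤ 𝔣 / 32 := by
    rw [← le_div_iff₀ (by positivity)]; exact (min_le_right _ _).trans (min_le_right _ _)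
  set FA : Finset A := insert (k e) (G.image k) ∪ {star q, a, q, star q * a} ∪
    (S.map Prod.fst + S.map Prod.snd + S.map fun p => p.1 * k h').toFinset with hFA
  have hkeF : k e ∈ FA := by simp [hFA]
  have hkGF : ∀ y ∈ insert e (G : Set B), k y ∈ FA := fun y hy => by
    rcases hy with rfl | hy
    · exact hkeF
    · simp only [hFA, Finset.mem_union, Finset.mem_insert]
      exact Or.inl (Or.inl (Or.inr (Finset.mem_image_of_mem k hy)))
  have hqF : star q ∈ FA ∧ a ∈ FA ∧ q ∈ FA ∧ star q * a ∈ FA := by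
    simp [hFA]
  have hSF : ∀ p ∈ S, p.1 ∈ FA ∧ p.2 ∈ FA ∧ p.1 * k h' ∈ FA := fun p hp => by
    simp only [hFA, Finset.mem_union, Multiset.mem_toFinset, Multiset.mem_add]
    exact ⟨Or.inr (Or.inl (Or.inl (Multiset.mem_map_of_mem _ hp))),
      Or.inr (Or.inl (Or.inr (Multiset.mem_map_of_mem _ hp))),
      Or.inr (Or.inr (Multiset.mem_map_of_mem (fun p => p.1 * k h') hp))⟩
  have hhF : k h' ∈ FA := hkGF h' (Set.mem_insert_of_mem _ hhG)
  obtain ⟨D, _, δ, φ, ψ, hδ, ⟨hφ, hφm⟩, ⟨hψ, hψm⟩, hφδ, hφψ, hDn, hD, hφb, hD𝔣⟩ :=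
    h η hη0 FA (k b) (map_nonneg k hb) fun h0 => hb0 (hk.injective (h0.trans (map_zero k).symm))
  have hsub := hD.isSubhomogeneous h𝒮
  have hκτ : ∀ τ : D →L[ℂ] ℂ, IsPosTrace τ → κ * ‖τ‖ ≤ (τ (ψ (k h'))).re := fun τ hτ =>
    IsPosTrace.le_re_apply_of_sum hψ ha.1 (map_nonneg k hh0) hS.le (by linarith) (by linarith)
      (η := η) (by nlinarith) (fun p hp => ⟨(hψm _ (hSF p hp).1 _ hhF).le,
        (hψm _ (hSF p hp).2.2 _ (hSF p hp).2.1).le⟩) hD𝔣 hτ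
  have hqc : ‖φ (k e) - star (φ q) * φ a * φ q‖ ≤ r / 2 := by
    have h1 : φ (star q) = star (φ q) := map_star φ q
    have h2 := norm_apply_conj_sub_le (ω := φ) (x := star q) (y := a) (z := q)
      (hφm _ hqF.1 _ hqF.2.1).le (hφm _ hqF.2.2.2 _ hqF.2.2.1).le (hφ q)
    rw [show φ (k e) - star (φ q) * φ a * φ q = φ (k e - star q * a * q) +
      (φ (star q * a * q) - φ (star q) * φ a * φ q) by rw [map_sub, h1]; abel]
    refine (norm_add_le _ _).trans ?_
    linarith [hφ (k e - star q * a * q)]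
  obtain ⟨D₁, _, j, θ, φ', ψ', hj, hθ, hφθ, hφ'c, hψ'c, hφ'm, hψ'm, hφψ', hcu, hjψ⟩ :=
    exists_corner_approx hk hδ hφδ hφ hψ (G := (G : Set B)) hL1 hGL hε1 hr0 hrε
      (η := r ^ 3 / 6) (by positivity) (by linarith) he0 he1
      (fun y hy => ⟨(hGe y hy).2.1.le, (hGe y hy).2.2.le⟩)
      (fun x hx y hy => ((hφm _ (hkGF x (Set.mem_insert_of_mem _ hx)) _ (hkGF y hy)).le.trans hηr))
      (fun x hx y hy => ((hψm _ (hkGF x (Set.mem_insert_of_mem _ hx)) _ (hkGF y hy)).le.trans hηr))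
      (fun y hy => (hφψ _ (Or.inl (hkGF y hy))).le.trans hηr) (map_nonneg φ ha.1) hqc
  have hjτ : ∀ τ : D →L[ℂ] ℂ, IsPosTrace τ → κ / 2 * ‖τ‖ ≤ (τ (j (ψ' h'))).re := fun τ hτ => by
    have h1 := hκτ τ hτ
    have h2 := hjψ h' hhG (.of_nonneg hh0)
    have h3 : (τ (ψ (k h'))).re - (τ (j (ψ' h'))).re ≤ ‖τ‖ * (κ / 8) := by
      rw [← Complex.sub_re, ← map_sub]
      refine (Complex.re_le_norm _).trans ((τ.le_opNorm _).trans ?_)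
      gcongr
      exact h2.trans hεκ
    nlinarith [norm_nonneg τ]
  -- A proper closed ideal containing j(D₁) would be killed by a nonzero trace, contradicting the
  -- lower bound at j(ψ'(h')).
  have hjfull : IsFullHom j := by
    intro I hI hjI
    by_contra hne
    obtain ⟨τ, hτ, hτ0, hτI⟩ := hsub.exists_trace hI hne
    have h1 := hjτ τ hτ
    rw [hτI _ (hjI _), Complex.zero_re] at h1
    have h2 : 0 < ‖τ‖ := norm_pos_iff.2 hτ0
    nlinarith
  have hD₁n : Nontrivial D₁ := by
    by_contra hcon
    rw [not_nontrivial_iff_subsingleton] at hcon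
    have hb : ((⊥ : TwoSidedIdeal D) : Set D) = {0} := by ext; simp
    have h1 := hjfull ⊥ (by rw [hb]; exact isClosed_singleton) fun y => by
      rw [Subsingleton.elim y 0, map_zero]; exact zero_mem _
    obtain ⟨x, hx⟩ := exists_ne (0 : D)
    exact hx ((TwoSidedIdeal.mem_bot D).1 (h1 ▸ trivial))
  have hFG : ∀ y, y ∈ F ∨ y = a' → y ∈ (G : Set B) := by
    rintro y (hy | rfl)
    · exact Finset.mem_union_left _ hy
    · exact haG
  refine ⟨D₁, inferInstance, θ, φ', ψ', hθ, ⟨hφ'c, fun x hx y hy =>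
    (hφ'm x (hFG x (Or.inl hx)) y (hFG y (Or.inl hy))).trans_le hεε⟩, ⟨hψ'c, fun x hx y hy =>
    (hψ'm x (hFG x (Or.inl hx)) y (hFG y (Or.inl hy))).trans_le hεε⟩, hφθ,
    fun x hx => (hφψ' x (hFG x hx)).trans_le hεε, hD₁n, hD.comp hj hjfull,
    cuntzLE_of_map k hk.injective hk.exists_eq ((hcu a' ha'0).trans hφb), fun t ht => ?_⟩
  obtain ⟨ht1, htp⟩ := mem_tracialStates_iff.1 ht
  set T := WeakDual.toStrongDual t
  change κ / 4 ≤ (T _).re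
  obtain ⟨τ, hτ, hτT⟩ := htp.exists_extension_of_isSubhomogeneous hsub hj hjfull
  -- The extension restricts to t along an isometry, so its norm is at least 1; no upper bound is
  -- needed.
  have hτ1 : 1 ≤ ‖τ‖ := by
    rw [← ht1]
    refine ContinuousLinearMap.opNorm_le_bound _ (norm_nonneg _) fun x => ?_
    rw [← hτT, ← NonUnitalStarAlgHom.norm_map j hj.injective x]
    exact τ.le_opNorm _
  have h1 := hjτ τ hτ
  rw [hτT] at h1
  -- Final count: t(ψ'(h')) ≥ κ/2 and the defect is below κ/8, leaving at least κ/2 - (4/3)(κ/8) =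
  -- κ/3 ≥ κ/4.
  have h2 := htp.le_re_fCut (map_nonneg ψ' ha'0) ((hψ'c a').trans ha'1.le)
    (map_nonneg ψ' hh0) ((hψ'c h').trans hh1)
  have h3 := hψ'm a' haG h' hhG
  rw [hah] at h3
  rw [ht1, one_mul] at h2
  nlinarith

/-- The functionals t ∘ ψ are positive contractions, tracial up to 2η on the given finite set, and
at least 𝔣/8 at a. The last bound keeps their weak* limit nonzero. -/
theorem HasTracialApproximation.nonempty_tracialStates.{u}
    {𝒮 : (C : Type) → [NonUnitalCStarAlgebra C] → Prop}
    (h𝒮 : ∀ (C : Type) [NonUnitalCStarAlgebra C], 𝒮 C → InC C) {A : Type u}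
    [NonUnitalCStarAlgebra A] {a : A} (ha : 0 ≤ a) (ha0 : a ≠ 0) {𝔣 : ℝ} (h𝔣 : 0 < 𝔣)
    (h : HasTracialApproximation (fun D _ => IsFullHereditaryIn 𝒮 D) A a 𝔣) :
    (tracialStates A).Nonempty := by
  classical
  have key : ∀ p : Finset A × ℕ, ∃ T : A →L[ℂ] ℂ, ‖T‖ ≤ 1 ∧ (∀ x, 0 ≤ x → 0 ≤ (T x).re ∧
      (T x).im = 0) ∧ 𝔣 / 8 ≤ (T a).re ∧
      ∀ x ∈ p.1, ∀ y ∈ p.1, ‖T (x * y) - T (y * x)‖ ≤ 2 * (1 / ((p.2 : ℝ) + 1)) := by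
    intro p
    set η := 1 / ((p.2 : ℝ) + 1) with hη
    obtain ⟨D, _, δ, φ, ψ, -, -, ⟨hψ, hψm⟩, -, -, hDn, hD, -, hD𝔣⟩ :=
      h η (by positivity) p.1 a ha ha0
    obtain ⟨t, ht⟩ := (hD.isSubhomogeneous h𝒮).nonempty_tracialStates
    obtain ⟨ht1, htp⟩ := mem_tracialStates_iff.1 ht
    set τ := WeakDual.toStrongDual t
    refine ⟨τ.comp (LinearMap.mkContinuous ψ.toLinearMap 1 fun x => by
      rw [one_mul]; exact hψ x), ?_, fun x hx => ?_, ?_, fun x hx y hy => ?_⟩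
    · refine (ContinuousLinearMap.opNorm_comp_le _ _).trans ?_
      rw [ht1, one_mul]
      exact LinearMap.mkContinuous_norm_le _ zero_le_one _
    · exact ⟨htp.re_nonneg (map_nonneg ψ hx), htp.im_eq_zero (map_nonneg ψ hx)⟩
    · have := htp.le_re_of_tracialStates (map_nonneg ψ ha) hD𝔣
      rwa [ht1, mul_one] at this
    · change ‖τ (ψ (x * y)) - τ (ψ (y * x))‖ ≤ _
      have h1 : τ (ψ (x * y)) - τ (ψ (y * x)) =
          τ (ψ (x * y) - ψ x * ψ y) - τ (ψ (y * x) - ψ y * ψ x) := by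
        rw [map_sub τ, map_sub τ, htp.comm (ψ x)]; abel
      rw [h1]
      have h2 : ∀ z, ‖τ z‖ ≤ ‖z‖ := fun z => (τ.le_opNorm z).trans_eq (by rw [ht1, one_mul])
      refine (norm_sub_le _ _).trans ?_
      linarith [(h2 _).trans (hψm x hx y hy).le, (h2 _).trans (hψm y hy x hx).le]
  choose T hT1 hTp hTa hTc using key
  obtain ⟨τ, U, hU, hUl, hτ⟩ := exists_weak_limit
    (Filter.atTop : Filter (Finset A × ℕ)) T hT1
  have hpos : IsPosTrace τ := by
    refine .of_re_im (fun x => ?_) fun x y => ?_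
    · have h0 : (0 : A) ≤ star x * x := star_mul_self_nonneg x
      exact ⟨ge_of_tendsto' ((Complex.continuous_re.tendsto _).comp (hτ (star x * x)))
        fun p => (hTp p _ h0).1, tendsto_nhds_unique
          ((Complex.continuous_im.tendsto _).comp (hτ (star x * x)))
          (tendsto_const_nhds.congr fun p => (hTp p _ h0).2.symm)⟩
    · have h1 : Filter.Tendsto (fun p => T p (x * y) - T p (y * x)) Filter.atTop (nhds 0) := by
        refine squeeze_zero_norm' ?_ (a := fun p : Finset A × ℕ => 2 * (1 / ((p.2 : ℝ) + 1))) ?_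
        · filter_upwards [Filter.eventually_ge_atTop (({x, y} : Finset A), 0)] with p hp
          exact hTc p x (hp.1 (by simp)) y (hp.1 (by simp))
        · have h2 : Filter.Tendsto (fun p : Finset A × ℕ => p.2) Filter.atTop Filter.atTop := by
            rw [← Filter.prod_atTop_atTop_eq]; exact Filter.tendsto_snd
          simpa using ((tendsto_one_div_add_atTop_nhds_zero_nat (𝕜 := ℝ)).comp h2).const_mul 2
      exact sub_eq_zero.1 (tendsto_nhds_unique ((hτ _).sub (hτ _)) (h1.mono_left hUl))
  have hne : τ ≠ 0 := by
    rintro rfl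
    have := ge_of_tendsto' ((Complex.continuous_re.tendsto _).comp (hτ a)) hTa
    simp at this
    linarith
  obtain ⟨t, ht, -⟩ := hpos.exists_tracialState hne
  exact ⟨t, ht⟩

end

theorem IsTraciallyIn.heredity.{u} {𝒮 : (C : Type) → [NonUnitalCStarAlgebra C] → Prop}
    (h𝒮 : ∀ (C : Type) [NonUnitalCStarAlgebra C], 𝒮 C → InC C) {A : Type u}
    [NonUnitalCStarAlgebra A] [TopologicalSpace.SeparableSpace A]
    (h : IsTraciallyIn (fun D _ => IsFullHereditaryIn 𝒮 D) A) :
    (∀ (B : NonUnitalStarSubalgebra ℂ A) [IsClosed (B : Set A)], IsHereditary B →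
      IsTraciallyIn (fun D _ => IsFullHereditaryIn 𝒮 D) B) ∧
    (Nontrivial A → (tracialStates A).Nonempty) := by
  rw [isTraciallyIn_iff] at h
  obtain ⟨hA, h⟩ := h
  refine ⟨fun B _ hB => ?_, fun hn => ?_⟩
  · have hk := hB.isHereditaryHom
    rw [isTraciallyIn_iff]
    refine ⟨hA.of_isHereditaryHom hk, ?_⟩
    rcases subsingleton_or_nontrivial B with hs | hn
    · exact Or.inl hs
    have : Nontrivial A := Subtype.val_injective.nontrivial (α := B)
    obtain ⟨a, ha, -, 𝔣, h1, h2, h3⟩ := h.resolve_left (not_subsingleton A)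
    have : TopologicalSpace.SeparableSpace B :=
      (TopologicalSpace.IsSeparable.of_separableSpace (B : Set A)).separableSpace
    exact Or.inr (h3.exists_of_isHereditaryHom h𝒮 hk hA ha h1 h2)
  · obtain ⟨a, ha, ha1, 𝔣, h1, -, h3⟩ := h.resolve_left (not_subsingleton A)
    exact h3.nonempty_tracialStates h𝒮 ha.1 (norm_ne_zero_iff.1 (ha1 ▸ one_ne_zero)) h1

end

theorem mainTheorem11 {A : Type*} [NonUnitalCStarAlgebra A] [TopologicalSpace.SeparableSpace A]
    (hsimple : IsSimpleCStar A) :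
    (InD A →
      (∀ (B : NonUnitalStarSubalgebra ℂ A) [IsClosed (B : Set A)], IsHereditary B → InD B) ∧
      (Nontrivial A → (tracialStates A).Nonempty)) ∧
    (InD0 A →
      (∀ (B : NonUnitalStarSubalgebra ℂ A) [IsClosed (B : Set A)], IsHereditary B → InD0 B) ∧
      (Nontrivial A → (tracialStates A).Nonempty)) :=
  ⟨fun h => IsTraciallyIn.heredity (𝒮 := fun C _ => InC0 C) (fun _ _ hC => hC.inC) h,
    fun h => IsTraciallyIn.heredity (𝒮 := fun C _ => InC00 C) (fun _ _ hC => hC.inC) h⟩
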